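/- Let $(W,S)$ be a finite Coxeter system with set of reflections $T=\{wsw^{-1}:w\in W,\ s\in S\}$, lengths $\ell_S$ and $\ell_T$ with respect to $S$ and $T$, and long element $w_\circ$ (the element with $\ell_S(w_\circ)=|T|$). Let $c$ be a standard Coxeter element, i.e. a product of all the simple reflections, each used once, in some order, and let $W_c^+=\{u\in W:\ell_S(uc)=\ell_S(u)+\ell_S(c)\}$. *Orders.* The Bruhat order $\le_{\mathrm B}$ is the partial order with covers $u\lessdot_{\mathrm B} ut$ for $t\in T$, $\ell_S(ut)=\ell_S(u)+1$; the absolute order $\le_T$ is the partial order with covers $u\lessdot_T ut$ for $t\in T$, $\ell_T(ut)=\ell_T(u)+1$. The right weak order is given by $u\le_{\mathrm R}v$ if and only if $\{t\in T:\ell_S(tu)<\ell_S(u)\}\subseteq\{t\in T:\ell_S(tv)<\ell_S(v)\}$. *Chains.* A maximal noncrossing chain is a maximal chain $\vec\pi=\{e=\pi_0\lessdot_T\pi_1\lessdot_T\cdots\lessdot_T\pi_r=c\}$ of the interval $[e,c]_T$; its reflection word is $t_1\cdots t_r$ with $t_i=\pi_{i-1}^{-1}\pi_i$. Two such chains are commutation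 equivalent if their reflection words are related by exchanges of adjacent commuting letters. The chain $\vec\pi$ is concordant with $u\in W_c^+$ if $u\pi_0\le_{\mathrm B}u\pi_1\le_{\mathrm B}\cdots\le_{\mathrm B}u\pi_r$. Let $\mathrm{Class}_c(u)$ be the set of commutation equivalence classes of maximal noncrossing chains concordant with $u$. *Sorting words.* For a standard Coxeter element $d$ and a reduced $S$-word $\mathsf d$ for $d$, the $d$-sorting word of $w\in W$ is the lexicographically first (with respect to positions) subword of $\mathsf d^\infty=\mathsf{ddd}\cdots$ that is a reduced $S$-word for $w$. The element $w$ is $d$-sortable if $I^{(1)}\supseteq I^{(2)}\supseteq\cdots$, where $I^{(k)}$ is the set of letters that the $d$-sorting word of $w$ uses in the $k$-th copy of $\mathsf d$. Two elements of $W$ are in the same $d$-Cambrian class if the maximum (in right weak order) $d$-sortable element that is $\le_{\mathrm R}$ the one equals the maximum $d$-sortable element that is $\le_{\mathrm R}$ the other. *Decreasing classes.* Let $s_1\cdots s_N$ be the $c$-sorting word of $w_\circ$. For $t,t'\in T$, write $t\preceq_c t'$ if $t=t'$ or $t$ appears to the left of $t'$ in every word obtained from $(a_1,\dots,a_N)$,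 $a_i=s_1\cdots s_{i-1}s_is_{i-1}\cdots s_1$, by exchanges of adjacent commuting letters. A maximal noncrossing chain with reflection word $t_1\cdots t_r$ is $\preceq_c$-decreasing if there are no $i<j$ with $t_i\preceq_c t_j$, and a commutation class is $\preceq_c$-decreasing if it contains a $\preceq_c$-decreasing chain. For $u\in W_c^+$, let $\mathcal D_c(u)$ be the unique $\preceq_c$-decreasing class in $\mathrm{Class}_c(u)$. **Theorem.** Let $u_1,u_2\in W_c^+$, and fix any reduced $S$-words for $c$ and for $c^{-1}$ in the definitions above. The following are equivalent: 1. $\mathcal D_c(u_1)=\mathcal D_c(u_2)$ (that is, some commutation class is the unique $\preceq_c$-decreasing element of $\mathrm{Class}_c(u_1)$ and also of $\mathrm{Class}_c(u_2)$); 2. $\mathrm{Class}_c(u_1)=\mathrm{Class}_c(u_2)$; 3. the Bruhat intervals $[u_1,u_1c]_{\mathrm B}$ and $[u_2,u_2c]_{\mathrm B}$ are reflection isomorphic: there is a poset isomorphism $\varphi\colon[u_1,u_1c]_{\mathrm B}\to[u_2,u_2c]_{\mathrm B}$ with $x^{-1}y=\varphi(x)^{-1}\varphi(y)$ for every cover relation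 $x\lessdot_{\mathrm B}y$ in $[u_1,u_1c]_{\mathrm B}$; 4. $u_1^{-1}$ and $u_2^{-1}$ are in the same $c^{-1}$-Cambrian class. -/

import Mathlib

/-- One commutation move on a word in a group: two adjacent commuting letters are exchanged. -/
inductive CommutationMove {G : Type*} [Group G] : List G → List G → Prop
  | swap (l₁ l₂ : List G) (x y : G) (h : x * y = y * x) :
      CommutationMove (l₁ ++ x :: y :: l₂) (l₁ ++ y :: x :: l₂)

/-- Two words are commutation equivalent if they are related by a sequence of commutation moves. -/
def CommutationEquiv {G : Type*} [Group G] : List G → List G → Prop :=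
  Relation.EqvGen CommutationMove

namespace CoxeterSystem

variable {B W : Type*} [Group W] {M : CoxeterMatrix B} (cs : CoxeterSystem M W)

/-! ### Coxeter elements, Bruhat order, right weak order -/

/-- `c` is the product of all simple reflections, each used exactly once, in some order. -/
def IsStandardCoxeterElement (c : W) : Prop :=
  ∃ ω : List B, ω.Nodup ∧ (∀ i : B, i ∈ ω) ∧ cs.wordProd ω = c

/-- `ω` is a reduced `S`-word for `w`. -/
def IsReducedWordFor (ω : List B) (w : W) : Prop :=
  cs.IsReduced ω ∧ cs.wordProd ω = w

/-- The set `W_c^+` of all `u` with `ℓ_S(uc) = ℓ_S(u) + ℓ_S(c)`. -/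
def positiveElements (c : W) : Set W :=
  {u | cs.length (u * c) = cs.length u + cs.length c}

/-- The cover relation of the Bruhat order. -/
def BruhatCover (u v : W) : Prop :=
  cs.length v = cs.length u + 1 ∧ ∃ t, cs.IsReflection t ∧ v = u * t

/-- The Bruhat order. -/
def BruhatLE : W → W → Prop :=
  Relation.ReflTransGen cs.BruhatCover

/-- The Bruhat interval `[u, v]`. -/
def bruhatInterval (u v : W) : Set W :=
  {x | cs.BruhatLE u x ∧ cs.BruhatLE x v}

/-- The right weak order: containment of sets of left inversions. -/
def RightWeakLE (u v : W) : Prop :=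
  ∀ t, cs.IsLeftInversion u t → cs.IsLeftInversion v t

/-- The Bruhat intervals `[u₁, v₁]` and `[u₂, v₂]` are reflection isomorphic: there is a poset
isomorphism `φ` with `x⁻¹ y = φ(x)⁻¹ φ(y)` for every cover relation `x ⋖ y` of `[u₁, v₁]`. -/
def ReflectionIsomorphic (u₁ v₁ u₂ v₂ : W) : Prop :=
  ∃ φ : cs.bruhatInterval u₁ v₁ ≃ cs.bruhatInterval u₂ v₂,
    (∀ x y : cs.bruhatInterval u₁ v₁, cs.BruhatLE (φ x : W) (φ y) ↔ cs.BruhatLE (x : W) y) ∧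
    ∀ x y : cs.bruhatInterval u₁ v₁, cs.BruhatCover (x : W) y → (x : W)⁻¹ * y = (φ x : W)⁻¹ * φ y

/-! ### Maximal chains of noncrossing partitions -/

/-- The reflection length `ℓ_T`. -/
noncomputable def reflectionLength (w : W) : ℕ :=
  sInf {n | ∃ l : List W, l.length = n ∧ (∀ t ∈ l, cs.IsReflection t) ∧ l.prod = w}

/-- The cover relation of the absolute order. -/
def AbsoluteCover (u v : W) : Prop :=
  cs.reflectionLength v = cs.reflectionLength u + 1 ∧ ∃ t, cs.IsReflection t ∧ v = u * t

/-- A maximal chain `1 = π₀ ⋖ π₁ ⋖ ⋯ ⋖ πᵣ = c` of the noncrossing partition lattice, which is the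
interval `[1, c]` of the absolute order. -/
structure NoncrossingChain (c : W) where
  /-- The list `[π₀, …, πᵣ]`. -/
  elems : List W
  head_eq : elems.head? = some 1
  last_eq : elems.getLast? = some c
  isChain : elems.IsChain cs.AbsoluteCover

variable {cs} in
/-- The reduced `T`-word `t₁ ⋯ tᵣ` of a chain, where `tᵢ = πᵢ₋₁⁻¹ πᵢ`. -/
def NoncrossingChain.reflectionWord {c : W} (π : cs.NoncrossingChain c) : List W :=
  List.zipWith (fun x y => x⁻¹ * y) π.elems π.elems.tail

/-- Commutation equivalence of chains. -/
def chainSetoid (c : W) : Setoid (cs.NoncrossingChain c) where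
  r π π' := CommutationEquiv π.reflectionWord π'.reflectionWord
  iseqv :=
    ⟨fun _ => .refl _, fun h => .symm _ _ h, fun h h' => .trans _ _ _ h h'⟩

/-- Commutation classes of maximal chains of noncrossing partitions. -/
def CommutationClass (c : W) : Type _ :=
  Quotient (cs.chainSetoid c)

/-- `u` and the chain `π` are concordant: `uπ₀ ≤ uπ₁ ≤ ⋯ ≤ uπᵣ` in Bruhat order. -/
def Concordant {c : W} (u : W) (π : cs.NoncrossingChain c) : Prop :=
  (π.elems.map (fun x => u * x)).IsChain cs.BruhatLE

/-- The set of commutation classes of chains that are concordant with `u`. -/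
def concordantClasses (c u : W) : Set (cs.CommutationClass c) :=
  {C | ∃ π : cs.NoncrossingChain c, cs.Concordant u π ∧ Quotient.mk (cs.chainSetoid c) π = C}

/-! ### Coxeter-sorting words and the order `≼_c` on reflections

Here `γ` is a word in the simple reflections, and the `n`-th letter (`n = 0, 1, 2, …`) of the
infinite word `γγγ⋯` is `γ[n % γ.length]`. -/

/-- The subword of `γγγ⋯` in the increasing list `p` of positions is the word `ω`, which is a
reduced word for `w`. -/
def IsReducedSubword (γ : List B) (w : W) (p : List ℕ) (ω : List B) : Prop :=
  p.Pairwise (· < ·) ∧ p.map (fun n => γ[n % γ.length]?) = ω.map some ∧ cs.IsReducedWordFor ω w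

/-- `ω`, in the positions `p`, is the sorting word of `w` with respect to `γ`: the lexicographically
first subword of `γγγ⋯` that is a reduced word for `w`. -/
def IsSortingWord (γ : List B) (w : W) (p : List ℕ) (ω : List B) : Prop :=
  cs.IsReducedSubword γ w p ω ∧
    ∀ p' ω', cs.IsReducedSubword γ w p' ω' → ¬ List.Lex (· < ·) p' p

/-- The long element: its Coxeter length is the number of reflections. -/
def IsLongElement (w : W) : Prop :=
  cs.length w = Nat.card {t : W // cs.IsReflection t}

/-- The partial order `≼_c` on reflections: `t` is to the left of `t'` in every word that is
commutation equivalent to the inversion sequence of the sorting word of the long element. -/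
def SortingLE (γ : List B) (t t' : W) : Prop :=
  t = t' ∨ ∃ w₀ p ω, cs.IsLongElement w₀ ∧ cs.IsSortingWord γ w₀ p ω ∧
    ∀ l, CommutationEquiv (cs.leftInvSeq ω) l → [t, t'].Sublist l

variable {cs} in
/-- The chain with reduced `T`-word `t₁ ⋯ tᵣ` is `≼_c`-decreasing: there are no `i < j` with
`tᵢ ≼_c tⱼ`. -/
def NoncrossingChain.IsDecreasing {c : W} (γ : List B) (π : cs.NoncrossingChain c) : Prop :=
  π.reflectionWord.Pairwise (fun t t' => ¬ cs.SortingLE γ t t')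

/-- A commutation class is `≼_c`-decreasing if it contains a `≼_c`-decreasing chain. -/
def IsDecreasingClass {c : W} (γ : List B) (C : cs.CommutationClass c) : Prop :=
  ∃ π : cs.NoncrossingChain c, π.IsDecreasing γ ∧ Quotient.mk (cs.chainSetoid c) π = C

/-- `C` is the `≼_c`-decreasing class of `u`: the unique `≼_c`-decreasing commutation class that is
concordant with `u`. -/
def IsDecreasingClassOf {c : W} (γ : List B) (u : W) (C : cs.CommutationClass c) : Prop :=
  (C ∈ cs.concordantClasses c u ∧ cs.IsDecreasingClass γ C) ∧
    ∀ C' ∈ cs.concordantClasses c u, cs.IsDecreasingClass γ C' → C' = C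

/-! ### Sortable elements and the Cambrian congruence -/

/-- The letters that the positions `p` use in the `k`-th copy (`k = 0, 1, 2, …`) of `γ`. -/
def lettersInCopy (γ : List B) (p : List ℕ) (k : ℕ) : Set B :=
  {i | ∃ n ∈ p, n / γ.length = k ∧ γ[n % γ.length]? = some i}

/-- `w` is sortable: the sets of letters that its sorting word uses in the successive copies of `γ`
are weakly decreasing under inclusion. -/
def IsSortable (γ : List B) (w : W) : Prop :=
  ∃ p ω, cs.IsSortingWord γ w p ω ∧ Antitone (lettersInCopy γ p)

/-- `v` is the maximum, in the right weak order, of the sortable elements below `u`. -/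
def IsSortableProjection (γ : List B) (u v : W) : Prop :=
  (cs.IsSortable γ v ∧ cs.RightWeakLE v u) ∧
    ∀ v', cs.IsSortable γ v' → cs.RightWeakLE v' u → cs.RightWeakLE v' v

/-- `u₁` and `u₂` lie in the same Cambrian class: they have the same image under the map that sends
`u` to the maximum sortable element below `u`. -/
def SameCambrianClass (γ : List B) (u₁ u₂ : W) : Prop :=
  ∃ v, cs.IsSortableProjection γ u₁ v ∧ cs.IsSortableProjection γ u₂ v

end CoxeterSystem

/-! Chains of noncrossing partitions are studied through the positive roots of their reflections in
the geometric representation, with form B. Call a factorization of c into ℓ_S(c) reflections acute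
if the positive roots of its letters have pairwise nonnegative inner products. All four conditions
reduce to one relation, `SameClass`: some acute factorization ascends in length from both u₁ and u₂.

Decreasing means acute, up to commutation. The Euler form E of a word for c satisfies E(y, (1 - c)z)
= B(y, z). Hence the roots of a factorization form an exceptional sequence: E(β', β) = 0 when β
comes before β', so that B(β, β') = E(β, β'). In the inversion sequence of the c-sorting word of the
long element, an earlier root β and a later root β' satisfy E(β, β') ≤ E(β', β). Comparing the two
facts, a pair of letters with B < 0 occurs in the same order in both sequences, a pair with B > 0 in
opposite orders, and a pair with B = 0 commutes (`IsFactorization.acute_of_decreasing`,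
`IsFactorization.exists_decreasing_of_acute`).

Acute factorizations ascending from u exist and are unique up to commutation, by recursion on the
last letter s of the word γs for c. If u α_s > 0, then s is forced to be a letter, can be commuted
to the front and is peeled off, leaving the word γ and the same u. If u α_s < 0, conjugation by s
replaces (γs, u) by (sγ, us). After inversion of u this is the recursion defining sortable elements,
so each class contains the inverse of exactly one sortable element m, and m lies below u⁻¹ in weak
order (`exists_recSortable`, `RecSortable.eq_of_sameClass`). Classes are convex, and an argument on
rank two intervals shows that m is the largest sortable element below u⁻¹ (`RecSortable.le_of_le`).
This gives condition 4.

One common acute factorization forces all ascending factorizations to be common. A weak order cover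
from u to qu stays inside a class exactly when qu is not Bruhat-below uc, and then every
factorization ascending from one of u, qu ascends from the other (`not_sameClass_of_bruhatLE`,
`SameClass.ascends_iff`). Conditions 2 and 3 both say that the ascending factorizations of u₁ and u₂
coincide; the isomorphism in 3 is left multiplication by u₂u₁⁻¹. -/

/-! ### The geometric representation -/

namespace CoxeterMatrix

variable {B : Type*} (M : CoxeterMatrix B)

/-- The Gram matrix of the canonical form, normalised so that simple roots have square length 2. -/
noncomputable def gram (i j : B) : ℝ := -2 * Real.cos (Real.pi / M i j)

lemma gram_comm (i j : B) : M.gram i j = M.gram j i := by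
  simp [gram, M.symmetric i j]

@[simp] lemma gram_self (i : B) : M.gram i i = 2 := by
  simp [gram]

/-- Off the diagonal the angle π/m lies in [0, π/2]. The entry 0 encodes m = ∞; division by zero
then gives the angle 0 and the value -2, as it should. -/
lemma gram_nonpos {i j : B} (h : i ≠ j) : M.gram i j ≤ 0 := by
  have h1 := M.off_diagonal i j h
  have : 0 ≤ Real.cos (Real.pi / M i j) := by
    apply Real.cos_nonneg_of_mem_Icc
    constructor
    · have : 0 ≤ Real.pi / M i j := by positivity
      linarith [Real.pi_pos]
    · rcases Nat.eq_zero_or_pos (M i j) with h0 | h0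
      · rw [h0]; simp; positivity
      · have : (2 : ℝ) ≤ M i j := by exact_mod_cast (show 2 ≤ M i j by lia)
        exact div_le_div_of_nonneg_left Real.pi_pos.le (by norm_num) this
  simp only [gram]; linarith

/-- The canonical bilinear form. -/
noncomputable def bil : (B →₀ ℝ) →ₗ[ℝ] (B →₀ ℝ) →ₗ[ℝ] ℝ :=
  Finsupp.linearCombination ℝ (fun i => Finsupp.linearCombination ℝ (M.gram i))

/-- The simple root. -/
noncomputable def sroot (_ : CoxeterMatrix B) (i : B) : B →₀ ℝ := Finsupp.single i 1

lemma sroot_apply_self (i : B) : M.sroot i i = 1 := by simp [sroot]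

lemma sroot_apply_of_ne {i j : B} (h : i ≠ j) : M.sroot i j = 0 := by
  simp [sroot, h]

lemma sroot_nonneg (i : B) : 0 ≤ M.sroot i := by simp [sroot]

lemma sroot_ne_zero (i : B) : M.sroot i ≠ 0 := by simp [sroot]

lemma bil_sroot_sroot (i j : B) : M.bil (M.sroot i) (M.sroot j) = M.gram i j := by
  simp [bil, sroot]

lemma bil_comm (x y : B →₀ ℝ) : M.bil x y = M.bil y x := by
  have : M.bil = M.bil.flip := by
    ext i j
    simpa [sroot] using (M.bil_sroot_sroot i j).trans
      ((M.gram_comm i j).trans (M.bil_sroot_sroot j i).symm)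
  conv_lhs => rw [this]
  rfl

lemma bil_sroot_left (i : B) (x : B →₀ ℝ) : M.bil (M.sroot i) x = x.sum fun j a => a * M.gram i j := by
  simp [bil, sroot, Finsupp.linearCombination_apply]

/-- A vector vanishing at `i` with nonnegative coordinates pairs nonpositively with `α_i`. -/
lemma bil_sroot_nonpos {i : B} {x : B →₀ ℝ} (hx : 0 ≤ x) (hi : x i = 0) :
    M.bil (M.sroot i) x ≤ 0 := by
  rw [bil_sroot_left]
  apply Finset.sum_nonpos
  intro j hj
  have : i ≠ j := by rintro rfl; simp [hi] at hj
  exact mul_nonpos_of_nonneg_of_nonpos (hx j) (M.gram_nonpos this)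

/-- The reflection in the simple root `α_i`. -/
noncomputable def srefl (i : B) : Module.End ℝ (B →₀ ℝ) :=
  LinearMap.id - (M.bil (M.sroot i)).smulRight (M.sroot i)

lemma srefl_apply (i : B) (x : B →₀ ℝ) :
    M.srefl i x = x - M.bil (M.sroot i) x • M.sroot i := by
  simp [srefl]

lemma srefl_mul_self (i : B) : M.srefl i * M.srefl i = 1 := by
  refine LinearMap.ext fun x => ?_
  simp only [Module.End.mul_apply, srefl_apply, map_sub, map_smul, bil_sroot_sroot, gram_self,
    Module.End.one_apply]
  module

/-- The vector of the plane spanned by two simple roots at angle parameter `a`. -/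
noncomputable def planeVec (i j : B) (θ a : ℝ) : B →₀ ℝ :=
  Real.sin (a + θ) • M.sroot i + Real.sin a • M.sroot j

/-- Each simple reflection advances the angle by θ and exchanges the two roots, because sin(a + 2θ)
+ sin a = 2 cos θ sin(a + θ). -/
lemma srefl_planeVec {i j : B} {θ : ℝ} (hθ : M.gram i j = -2 * Real.cos θ) (a : ℝ) :
    M.srefl j (M.planeVec i j θ a) = M.planeVec j i θ (a + θ) := by
  have h : Real.sin (a + θ + θ) = 2 * Real.cos θ * Real.sin (a + θ) - Real.sin a := by
    have h1 := Real.sin_add (a + θ) θ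
    have h2 := Real.sin_sub (a + θ) θ
    rw [add_sub_cancel_right] at h2
    linarith
  simp only [planeVec, srefl_apply, map_add, map_smul, bil_sroot_sroot, gram_self, h,
    M.gram_comm j i, hθ]
  module

lemma srefl_mul_srefl_pow_planeVec {i j : B} {θ : ℝ} (hθ : M.gram i j = -2 * Real.cos θ) (a : ℝ)
    (n : ℕ) :
    ((M.srefl i * M.srefl j) ^ n) (M.planeVec i j θ a) = M.planeVec i j θ (a + n * (2 * θ)) := by
  induction n with
  | zero => simp
  | succ n ih =>
    rw [pow_succ', Module.End.mul_apply, ih, Module.End.mul_apply, srefl_planeVec M hθ,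
      srefl_planeVec M (by rw [M.gram_comm, hθ])]
    congr 1; push_cast; ring

/-- On the plane of α_i and α_j the product of the two reflections advances the angle by 2θ, so its
m-th power advances it by 2π. The form on this plane has determinant 4 sin²θ ≠ 0, so every vector is
a plane vector plus a vector orthogonal to both roots, which is fixed. For m = 0 the relation is
empty. -/
lemma srefl_isLiftable : M.IsLiftable M.srefl := by
  intro i j
  rcases eq_or_ne i j with rfl | hij
  · rw [M.diagonal, pow_one, srefl_mul_self]
  rcases Nat.eq_zero_or_pos (M i j) with h0 | h0
  · simp [h0]
  have h2 : (2 : ℝ) ≤ M i j := by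
    exact_mod_cast (show 2 ≤ M i j by have := M.off_diagonal i j hij; lia)
  set m := M i j with hm
  set θ : ℝ := Real.pi / m with hθ
  have hg : M.gram i j = -2 * Real.cos θ := rfl
  have hsin : Real.sin θ ≠ 0 := by
    apply ne_of_gt
    apply Real.sin_pos_of_pos_of_lt_pi
    · have := Real.pi_pos; positivity
    · rw [hθ, div_lt_iff₀ (by linarith)]; nlinarith [Real.pi_pos]
  have hper : ∀ a, ((M.srefl i * M.srefl j) ^ m) (M.planeVec i j θ a) = M.planeVec i j θ a := by
    intro a
    rw [srefl_mul_srefl_pow_planeVec M hg]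
    have : (m : ℝ) * (2 * θ) = 2 * Real.pi := by
      rw [hθ]; field_simp
    rw [this, planeVec, planeVec, Real.sin_add_two_pi,
      show a + 2 * Real.pi + θ = a + θ + 2 * Real.pi by ring, Real.sin_add_two_pi]
  have hi : ((M.srefl i * M.srefl j) ^ m) (M.sroot i) = M.sroot i := by
    have := hper 0
    simp only [planeVec, zero_add, Real.sin_zero, zero_smul, add_zero, map_smul] at this
    exact smul_right_injective _ hsin this
  have hj : ((M.srefl i * M.srefl j) ^ m) (M.sroot j) = M.sroot j := by
    have := hper (-θ)
    simp only [planeVec, neg_add_cancel, Real.sin_zero, zero_smul, zero_add, map_smul,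
      Real.sin_neg] at this
    exact smul_right_injective _ (neg_ne_zero.mpr hsin) this
  have hfix : ∀ z, M.bil (M.sroot i) z = 0 → M.bil (M.sroot j) z = 0 →
      ((M.srefl i * M.srefl j) ^ m) z = z := by
    intro z h1 h2
    have h3 : (M.srefl i * M.srefl j) z = z := by simp [srefl_apply, h1, h2]
    have : ∀ k : ℕ, ((M.srefl i * M.srefl j) ^ k) z = z := by
      intro k
      induction k with
      | zero => simp
      | succ k ihk => rw [pow_succ, Module.End.mul_apply, h3, ihk]
    exact this m
  refine LinearMap.ext fun z => ?_
  set p := M.bil (M.sroot i) z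
  set q := M.bil (M.sroot j) z
  set k := M.gram i j
  have hdet : 4 - k ^ 2 ≠ 0 := by
    have : 4 - k ^ 2 = 4 * Real.sin θ ^ 2 := by
      rw [hg, Real.sin_sq]; ring
    rw [this]; positivity
  -- Cramer's rule: `a` and `b` are the coefficients of the orthogonal projection of `z` to the
  -- plane.
  set a := (2 * p - k * q) / (4 - k ^ 2) with ha
  set b := (2 * q - k * p) / (4 - k ^ 2) with hb
  have hz : z = (z - a • M.sroot i - b • M.sroot j) + a • M.sroot i + b • M.sroot j := by module
  have h1 : M.bil (M.sroot i) (z - a • M.sroot i - b • M.sroot j) = 0 := by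
    simp only [map_sub, map_smul, bil_sroot_sroot, gram_self, smul_eq_mul]
    change p - a * 2 - b * k = 0
    rw [ha, hb]; field_simp; ring
  have h2 : M.bil (M.sroot j) (z - a • M.sroot i - b • M.sroot j) = 0 := by
    simp only [map_sub, map_smul, bil_sroot_sroot, gram_self, smul_eq_mul, M.gram_comm j i]
    change q - a * k - b * 2 = 0
    rw [ha, hb]; field_simp; ring
  rw [hz, map_add, map_add, map_smul, map_smul, hi, hj, hfix _ h1 h2]
  rfl

end CoxeterMatrix

namespace CoxeterSystem

open CoxeterMatrix

variable {B W : Type*} [Group W] {M : CoxeterMatrix B} (cs : CoxeterSystem M W)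

/-- The geometric representation. -/
noncomputable def rep : W →* Module.End ℝ (B →₀ ℝ) := cs.lift ⟨M.srefl, M.srefl_isLiftable⟩

lemma rep_simple_apply (i : B) (x : B →₀ ℝ) :
    cs.rep (cs.simple i) x = x - M.bil (M.sroot i) x • M.sroot i := by
  rw [rep, lift_apply_simple, srefl_apply]

lemma rep_simple_sroot (i : B) : cs.rep (cs.simple i) (M.sroot i) = -M.sroot i := by
  rw [rep_simple_apply, bil_sroot_sroot, gram_self]; module

lemma rep_mul_apply (v w : W) (x : B →₀ ℝ) : cs.rep (v * w) x = cs.rep v (cs.rep w x) := by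
  rw [map_mul, Module.End.mul_apply]

@[simp] lemma rep_one_apply (x : B →₀ ℝ) : cs.rep 1 x = x := by
  rw [map_one, Module.End.one_apply]

@[simp] lemma rep_inv_apply_self (w : W) (x : B →₀ ℝ) : cs.rep w⁻¹ (cs.rep w x) = x := by
  rw [← rep_mul_apply, inv_mul_cancel, rep_one_apply]

@[simp] lemma rep_apply_inv_self (w : W) (x : B →₀ ℝ) : cs.rep w (cs.rep w⁻¹ x) = x := by
  rw [← rep_mul_apply, mul_inv_cancel, rep_one_apply]

lemma rep_injective (w : W) : Function.Injective (cs.rep w) :=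
  Function.LeftInverse.injective (cs.rep_inv_apply_self w)

lemma bil_rep (w : W) (x y : B →₀ ℝ) : M.bil (cs.rep w x) (cs.rep w y) = M.bil x y := by
  induction w using cs.simple_induction_left with
  | one => simp
  | mul_simple_left w i ih =>
    rw [rep_mul_apply, rep_mul_apply, ← ih, rep_simple_apply, rep_simple_apply]
    simp only [map_sub, map_smul, LinearMap.sub_apply, LinearMap.smul_apply, bil_sroot_sroot,
      gram_self, smul_eq_mul, M.bil_comm _ (M.sroot i)]
    ring

lemma rep_simple_apply_of_ne (i : B) {j : B} (h : i ≠ j) (x : B →₀ ℝ) :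
    cs.rep (cs.simple i) x j = x j := by
  simp [rep_simple_apply, M.sroot_apply_of_ne h]

lemma rep_simple_apply_self (i : B) (x : B →₀ ℝ) :
    cs.rep (cs.simple i) x i = x i - M.bil (M.sroot i) x := by
  simp [rep_simple_apply, M.sroot_apply_self]

/-- For m = ∞ the vector α_i + α_j is isotropic and s_i s_j moves α_i by twice this vector each
time, so it has infinite order. -/
lemma coxeterMatrix_ne_zero (cs : CoxeterSystem M W) [Finite W] (i j : B) : M i j ≠ 0 := by
  intro h0
  have hij : i ≠ j := by rintro rfl; simp at h0
  have hg : M.gram i j = -2 := by simp [gram, h0]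
  set r := cs.simple i * cs.simple j
  have key : ∀ n : ℕ, cs.rep (r ^ n) (M.sroot i) =
      M.sroot i + (2 * n : ℝ) • (M.sroot i + M.sroot j) := by
    intro n
    induction n with
    | zero => simp
    | succ n ih =>
      rw [pow_succ', rep_mul_apply, ih, rep_mul_apply, rep_simple_apply, rep_simple_apply]
      simp only [map_add, map_sub, map_smul, bil_sroot_sroot, gram_self, M.gram_comm j i, hg]
      push_cast
      module
  have hfin := isOfFinOrder_of_finite r
  have h := key (orderOf r)
  rw [pow_orderOf_eq_one, rep_one_apply] at h
  have h' := DFunLike.congr_fun h j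
  simp only [Finsupp.coe_add, Finsupp.coe_smul, Pi.add_apply, Pi.smul_apply,
    M.sroot_apply_of_ne hij, M.sroot_apply_self, smul_eq_mul] at h'
  have := orderOf_pos r
  have : (0 : ℝ) < orderOf r := by exact_mod_cast this
  linarith

/-- The form is nondegenerate: a vector orthogonal to everything is zero. -/
lemma eq_zero_of_bil_sroot_eq_zero (cs : CoxeterSystem M W) [Finite W] {z : B →₀ ℝ} (hz : ∀ i, M.bil (M.sroot i) z = 0) :
    z = 0 := by
  by_contra hne
  obtain ⟨k, hk⟩ : ∃ k, z k ≠ 0 := by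
    by_contra! h; exact hne (Finsupp.ext h)
  have := Fintype.ofFinite W
  -- Averaging a coordinate over the group gives an invariant functional. Each s_i negates α_i, so
  -- the functional vanishes; on `z`, which the whole group fixes, its value is |W| times the
  -- coordinate.
  let φ : (B →₀ ℝ) →ₗ[ℝ] ℝ := ∑ w : W, (Finsupp.lapply k) ∘ₗ (cs.rep w)
  have hinv : ∀ i x, φ (cs.rep (cs.simple i) x) = φ x := by
    intro i x
    simp only [φ, LinearMap.sum_apply, LinearMap.comp_apply, ← rep_mul_apply]
    exact Fintype.sum_equiv (Equiv.mulRight (cs.simple i)) _ _ (fun w => rfl)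
  have h0 : φ = 0 := by
    ext i
    have := hinv i (M.sroot i)
    rw [rep_simple_sroot, map_neg] at this
    simpa [sroot] using (show φ (M.sroot i) = 0 by linarith)
  have hfix : ∀ w, cs.rep w z = z := by
    intro w
    induction w using cs.simple_induction_left with
    | one => simp
    | mul_simple_left w i ih => rw [rep_mul_apply, ih, rep_simple_apply, hz]; simp
  have : φ z = Fintype.card W * z k := by
    simp [φ, LinearMap.sum_apply, hfix]
  rw [h0] at this
  simp only [LinearMap.zero_apply, zero_eq_mul, hk, or_false] at this
  have h' : 0 < Fintype.card W := Fintype.card_pos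
  rw [Nat.cast_eq_zero] at this
  lia

/-! ### Positivity of roots -/

/-- Every element is a product `x a` with `x` minimal in its coset and `a` alternating. -/
lemma exists_eq_mul_alternatingWord (i j : B) (w : W) :
    ∃ x n, ∃ a b : B, ((a = i ∧ b = j) ∨ (a = j ∧ b = i)) ∧
      w = x * cs.wordProd (alternatingWord a b n) ∧
      cs.length w = cs.length x + n ∧
      ¬ cs.IsRightDescent x i ∧ ¬ cs.IsRightDescent x j := by
  induction hn : cs.length w using Nat.strong_induction_on generalizing w with
  | _ N ih =>
  subst hn
  by_cases h : ¬ cs.IsRightDescent w i ∧ ¬ cs.IsRightDescent w j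
  · exact ⟨w, 0, i, j, Or.inl ⟨rfl, rfl⟩, by simp [alternatingWord], by simp, h.1, h.2⟩
  obtain ⟨k, k', hk, hkk⟩ : ∃ k k', cs.IsRightDescent w k ∧ ((k' = i ∧ k = j) ∨ (k' = j ∧ k = i)) := by
    by_cases hi : cs.IsRightDescent w i
    · exact ⟨i, j, hi, Or.inr ⟨rfl, rfl⟩⟩
    · exact ⟨j, i, by tauto, Or.inl ⟨rfl, rfl⟩⟩
  obtain ⟨x, n, a, b, hab, hw, hl, hx⟩ := ih _ hk (w * cs.simple k) rfl
  have hk' := (cs.isRightDescent_iff).1 hk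
  rcases Nat.eq_zero_or_pos n with rfl | hn
  · refine ⟨x, 1, k', k, hkk, ?_, by lia, hx⟩
    have : w * cs.simple k = x := by simpa [alternatingWord] using hw
    simp [alternatingWord, ← this]
  obtain ⟨n, rfl⟩ : ∃ n', n = n' + 1 := ⟨n - 1, by lia⟩
  by_cases hbk : b = k
  · exfalso
    subst hbk
    rw [alternatingWord_succ, wordProd_concat, ← mul_assoc] at hw
    have hw' := mul_right_cancel hw
    have h1 := cs.length_mul_le x (cs.wordProd (alternatingWord b a n))
    have h2 := cs.length_wordProd_le (alternatingWord b a n)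
    rw [length_alternatingWord] at h2
    rw [← hw'] at h1
    lia
  · have hb : b = k' := by rcases hab with ⟨rfl, rfl⟩ | ⟨rfl, rfl⟩ <;> rcases hkk with ⟨rfl, rfl⟩ | ⟨rfl, rfl⟩ <;> tauto
    have ha : a = k := by rcases hab with ⟨rfl, rfl⟩ | ⟨rfl, rfl⟩ <;> rcases hkk with ⟨rfl, rfl⟩ | ⟨rfl, rfl⟩ <;> tauto
    subst ha hb
    refine ⟨x, n + 2, b, a, hkk, ?_, by lia, hx⟩
    rw [alternatingWord_succ _ _ (n + 1), wordProd_concat, ← mul_assoc, ← hw]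
    simp

/-- The image of a simple root under a short alternating word. -/
lemma rep_alternatingWord_sroot [Finite W] {i j : B} (hij : i ≠ j) {n : ℕ} (hn : n < M i j) :
    ∃ a b : ℝ, 0 ≤ a ∧ 0 ≤ b ∧
      cs.rep (cs.wordProd (alternatingWord i j n)) (M.sroot i) = a • M.sroot i + b • M.sroot j := by
  have h2 : 2 ≤ M i j := by have := M.off_diagonal i j hij; have := cs.coxeterMatrix_ne_zero i j; lia
  set θ : ℝ := Real.pi / M i j with hθ
  have hm : (2 : ℝ) ≤ M i j := by exact_mod_cast h2
  have hg : M.gram i j = -2 * Real.cos θ := rfl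
  have hθ0 : 0 < θ := by have := Real.pi_pos; positivity
  have hsin : 0 < Real.sin θ := by
    apply Real.sin_pos_of_pos_of_lt_pi hθ0
    rw [hθ, div_lt_iff₀ (by linarith)]; nlinarith [Real.pi_pos]
  -- The factor sin θ turns α_i into the plane vector of angle 0, and n reflections bring it to
  -- angle nθ. For n < m both sines are still nonnegative.
  have key : ∀ n : ℕ, Real.sin θ • cs.rep (cs.wordProd (alternatingWord i j n)) (M.sroot i) =
      if Even n then M.planeVec i j θ (n * θ) else M.planeVec j i θ (n * θ) := by
    intro n
    induction n with
    | zero => simp [alternatingWord, planeVec]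
    | succ n ih =>
      rw [alternatingWord_succ', wordProd_cons, rep_mul_apply, ← map_smul, ih]
      by_cases hn : Even n
      · have : ¬ Even (n + 1) := by simpa [Nat.even_add_one] using hn
        simp only [hn, this, if_true, if_false]
        rw [rep, lift_apply_simple, srefl_planeVec M hg]
        congr 1; push_cast; ring
      · have : Even (n + 1) := by simpa [Nat.even_add_one] using hn
        simp only [hn, this, if_true, if_false]
        rw [rep, lift_apply_simple, srefl_planeVec M (by rw [M.gram_comm, hg])]
        congr 1; push_cast; ring
  have hs : ∀ k : ℕ, k ≤ M i j → 0 ≤ Real.sin (k * θ) := by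
    intro k hk
    apply Real.sin_nonneg_of_nonneg_of_le_pi (by positivity)
    have : (k : ℝ) ≤ M i j := by exact_mod_cast hk
    calc k * θ ≤ M i j * θ := by gcongr
      _ = Real.pi := by rw [hθ]; field_simp
  have h1 := hs n hn.le
  have h3 := hs (n + 1) hn
  have h3' : ((n : ℝ) + 1) * θ = n * θ + θ := by ring
  push_cast at h3
  rw [h3'] at h3
  have hk := key n
  have hinv : ∀ v w : B →₀ ℝ, Real.sin θ • v = w → v = (Real.sin θ)⁻¹ • w := by
    intro v w h; rw [← h, smul_smul, inv_mul_cancel₀ hsin.ne', one_smul]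
  by_cases he : Even n
  · rw [if_pos he] at hk
    refine ⟨(Real.sin θ)⁻¹ * Real.sin (n * θ + θ), (Real.sin θ)⁻¹ * Real.sin (n * θ), by positivity,
      by positivity, ?_⟩
    rw [hinv _ _ hk, planeVec]; module
  · rw [if_neg he] at hk
    refine ⟨(Real.sin θ)⁻¹ * Real.sin (n * θ), (Real.sin θ)⁻¹ * Real.sin (n * θ + θ), by positivity,
      by positivity, ?_⟩
    rw [hinv _ _ hk, planeVec]; module

/-- With j a right descent of w, split w = x a, where x has neither i nor j as a descent and a is
alternating of length less than m. Then a α_i is a nonnegative combination of α_i and α_j, and the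
shorter x keeps both positive by induction. -/
lemma rep_sroot_nonneg [Finite W] {w : W} {i : B} (h : ¬ cs.IsRightDescent w i) :
    0 ≤ cs.rep w (M.sroot i) := by
  induction hn : cs.length w using Nat.strong_induction_on generalizing w i with
  | _ N ih =>
  subst hn
  rcases eq_or_ne w 1 with rfl | hw
  · simpa using M.sroot_nonneg i
  obtain ⟨j, hj⟩ := cs.exists_rightDescent_of_ne_one hw
  have hij : i ≠ j := by rintro rfl; exact h hj
  obtain ⟨x, n, a, b, hab, hwx, hl, hxi, hxj⟩ := cs.exists_eq_mul_alternatingWord i j w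
  have hn : n ≠ 0 := by
    rintro rfl
    apply hxj
    simpa [alternatingWord, ← hwx] using (show x = w by simpa [alternatingWord] using hwx.symm) ▸ hj
  obtain ⟨n, rfl⟩ : ∃ n', n = n' + 1 := ⟨n - 1, by lia⟩
  have hdesc : cs.IsRightDescent w b := by
    have : w * cs.simple b = x * cs.wordProd (alternatingWord b a n) := by
      rw [hwx, alternatingWord_succ, wordProd_concat]; simp [mul_assoc]
    have h1 := cs.length_mul_le x (cs.wordProd (alternatingWord b a n))
    have h2 := cs.length_wordProd_le (alternatingWord b a n)
    rw [length_alternatingWord] at h2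
    rw [IsRightDescent, this]
    lia
  have hab' : a = i ∧ b = j := by
    rcases hab with h' | ⟨rfl, rfl⟩
    · exact h'
    · exact absurd hdesc h
  obtain ⟨rfl, rfl⟩ := hab'
  -- Otherwise w s_a is x times an alternating word that is too long to be reduced, so its length
  -- cannot exceed that of w.
  have hlt : n + 1 < M a b := by
    by_contra hge
    have hred := cs.not_isReduced_alternatingWord b a (m := n + 2) (cs.coxeterMatrix_ne_zero b a)
      (by rw [M.symmetric b a]; lia)
    have h1 := cs.length_wordProd_le (alternatingWord b a (n + 2))
    rw [length_alternatingWord] at h1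
    have h2 : cs.length (cs.wordProd (alternatingWord b a (n + 2))) ≠ n + 2 := by
      intro h'; apply hred; rw [IsReduced, h', length_alternatingWord]
    have h3 := (cs.not_isRightDescent_iff).1 h
    have : w * cs.simple a = x * cs.wordProd (alternatingWord b a (n + 2)) := by
      rw [alternatingWord_succ _ _ (n + 1), wordProd_concat, ← mul_assoc, ← hwx]
    have h4 := cs.length_mul_le x (cs.wordProd (alternatingWord b a (n + 2)))
    rw [← this] at h4
    lia
  obtain ⟨p, q, hp, hq, hpq⟩ := cs.rep_alternatingWord_sroot hij hlt
  rw [hwx, rep_mul_apply, hpq, map_add, map_smul, map_smul]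
  have h1 := ih (cs.length x) (by lia) hxi rfl
  have h2 := ih (cs.length x) (by lia) hxj rfl
  exact add_nonneg (smul_nonneg hp h1) (smul_nonneg hq h2)

lemma rep_sroot_nonpos [Finite W] {w : W} {i : B} (h : cs.IsRightDescent w i) :
    cs.rep w (M.sroot i) ≤ 0 := by
  have h1 := cs.rep_sroot_nonneg ((cs.isRightDescent_iff_not_isRightDescent_mul).1 h)
  rw [rep_mul_apply, rep_simple_sroot, map_neg] at h1
  exact neg_nonneg.1 h1

lemma rep_eq_one_iff [Finite W] {w : W} : (∀ x, cs.rep w x = x) ↔ w = 1 := by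
  refine ⟨fun h => ?_, fun h x => by simp [h]⟩
  by_contra hw
  obtain ⟨i, hi⟩ := cs.exists_rightDescent_of_ne_one hw
  have h1 := cs.rep_sroot_nonpos hi
  rw [h] at h1
  exact M.sroot_ne_zero i (le_antisymm h1 (M.sroot_nonneg i))

lemma eq_of_rep_eq [Finite W] {v w : W} (h : ∀ x, cs.rep v x = cs.rep w x) : v = w := by
  have : v⁻¹ * w = 1 := cs.rep_eq_one_iff.1 fun x => by rw [rep_mul_apply, ← h]; simp
  exact (inv_mul_eq_one.1 this)

end CoxeterSystem

namespace CoxeterSystem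

open CoxeterMatrix

variable {B W : Type*} [Group W] {M : CoxeterMatrix B} (cs : CoxeterSystem M W)

/-! ### Positive roots of reflections -/

open Classical in
/-- The positive root of a reflection. -/
noncomputable def root (t : W) : B →₀ ℝ :=
  if h : ∃ β : B →₀ ℝ, 0 ≤ β ∧ ∃ w i, t = w * cs.simple i * w⁻¹ ∧ β = cs.rep w (M.sroot i) then
    h.choose else 0

/-- Only the i-th coordinate changes under s_i, so all other coordinates of β are both nonnegative
and nonpositive; the norm then fixes the remaining one. This is the source of every exchange
argument below. -/
lemma eq_sroot_of_rep_simple_nonpos {β : B →₀ ℝ} (h0 : 0 ≤ β) (h2 : M.bil β β = 2) {i : B}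
    (h : cs.rep (cs.simple i) β ≤ 0) : β = M.sroot i := by
  have h1 : β = β i • M.sroot i := by
    ext j
    rcases eq_or_ne i j with rfl | hij
    · simp [M.sroot_apply_self]
    · have := h j
      rw [cs.rep_simple_apply_of_ne i hij] at this
      simp [M.sroot_apply_of_ne hij, le_antisymm this (h0 j)]
  have h3 : β i ^ 2 = 1 := by
    rw [h1] at h2
    simp only [map_smul, LinearMap.smul_apply, bil_sroot_sroot, gram_self, smul_eq_mul] at h2
    nlinarith
  have h4 : 0 ≤ β i := h0 i
  have h5 : β i = 1 := by nlinarith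
  rw [h1, h5, one_smul]

variable [Finite W]

lemma root_spec {t : W} (ht : cs.IsReflection t) :
    0 ≤ cs.root t ∧ ∃ w i, t = w * cs.simple i * w⁻¹ ∧ cs.root t = cs.rep w (M.sroot i) := by
  have h : ∃ β : B →₀ ℝ, 0 ≤ β ∧ ∃ w i, t = w * cs.simple i * w⁻¹ ∧
      β = cs.rep w (M.sroot i) := by
    obtain ⟨w, i, rfl⟩ := ht
    by_cases h : cs.IsRightDescent w i
    · exact ⟨_, cs.rep_sroot_nonneg ((cs.isRightDescent_iff_not_isRightDescent_mul).1 h),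
        w * cs.simple i, i, by simp [mul_assoc], rfl⟩
    · exact ⟨_, cs.rep_sroot_nonneg h, w, i, rfl, rfl⟩
  rw [root, dif_pos h]
  exact h.choose_spec

lemma root_nonneg {t : W} (ht : cs.IsReflection t) : 0 ≤ cs.root t := (cs.root_spec ht).1

lemma bil_root_self {t : W} (ht : cs.IsReflection t) : M.bil (cs.root t) (cs.root t) = 2 := by
  obtain ⟨-, w, i, -, h⟩ := cs.root_spec ht
  rw [h, bil_rep, bil_sroot_sroot, gram_self]

lemma root_ne_zero {t : W} (ht : cs.IsReflection t) : cs.root t ≠ 0 := by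
  intro h
  have := cs.bil_root_self ht
  simp [h] at this

lemma rep_root_ne_zero {t : W} (ht : cs.IsReflection t) (w : W) : cs.rep w (cs.root t) ≠ 0 := by
  intro h
  exact cs.root_ne_zero ht (cs.rep_injective w (by rw [h, map_zero]))

lemma rep_reflection_apply {t : W} (ht : cs.IsReflection t) (x : B →₀ ℝ) :
    cs.rep t x = x - M.bil (cs.root t) x • cs.root t := by
  obtain ⟨-, w, i, h, h'⟩ := cs.root_spec ht
  have hb : M.bil (cs.rep w (M.sroot i)) x = M.bil (M.sroot i) (cs.rep w⁻¹ x) := by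
    rw [← cs.bil_rep w (M.sroot i), rep_apply_inv_self]
  rw [h', hb]
  conv_lhs => rw [h, rep_mul_apply, rep_mul_apply, rep_simple_apply, map_sub, map_smul]
  simp

lemma rep_root_nonneg_or_nonpos {t : W} (ht : cs.IsReflection t) (w : W) :
    0 ≤ cs.rep w (cs.root t) ∨ cs.rep w (cs.root t) ≤ 0 := by
  obtain ⟨-, v, i, -, h⟩ := cs.root_spec ht
  rw [h, ← rep_mul_apply]
  by_cases h : cs.IsRightDescent (w * v) i
  · exact Or.inr (cs.rep_sroot_nonpos h)
  · exact Or.inl (cs.rep_sroot_nonneg h)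

lemma rep_root_nonpos_iff {t : W} (ht : cs.IsReflection t) (w : W) :
    cs.rep w (cs.root t) ≤ 0 ↔ ¬ 0 ≤ cs.rep w (cs.root t) :=
  ⟨fun h h' => cs.rep_root_ne_zero ht w (le_antisymm h h'),
    fun h => (cs.rep_root_nonneg_or_nonpos ht w).resolve_left h⟩

lemma eq_root {t : W} (ht : cs.IsReflection t) {β : B →₀ ℝ} (h0 : 0 ≤ β) (h2 : M.bil β β = 2)
    (h : cs.rep t β = -β) : β = cs.root t := by
  rw [cs.rep_reflection_apply ht] at h
  set k := M.bil (cs.root t) β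
  have h1 : β = (k / 2) • cs.root t := by
    have : (2 : ℝ) • β = k • cs.root t := by
      rw [two_smul]; rw [sub_eq_iff_eq_add] at h; nth_rewrite 1 [h]; abel
    rw [div_eq_inv_mul, mul_smul, ← this, smul_smul]; norm_num
  have hk : (k / 2) ^ 2 = 1 := by
    rw [h1] at h2
    simp only [map_smul, LinearMap.smul_apply, cs.bil_root_self ht, smul_eq_mul] at h2
    nlinarith
  rcases (show k / 2 = 1 ∨ k / 2 = -1 by simpa using hk) with h' | h'
  · rw [h1, h', one_smul]
  · rw [h', neg_one_smul] at h1
    have h3 := cs.root_nonneg ht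
    rw [h1, neg_nonneg] at h0
    exact absurd (le_antisymm h0 h3) (cs.root_ne_zero ht)

lemma rep_reflection_root {t : W} (ht : cs.IsReflection t) :
    cs.rep t (cs.root t) = -cs.root t := by
  rw [cs.rep_reflection_apply ht, cs.bil_root_self ht]; module

lemma root_simple (i : B) : cs.root (cs.simple i) = M.sroot i :=
  (cs.eq_root (cs.isReflection_simple i) (M.sroot_nonneg i) (by simp [bil_sroot_sroot])
    (cs.rep_simple_sroot i)).symm

lemma root_injective {t t' : W} (ht : cs.IsReflection t) (ht' : cs.IsReflection t')
    (h : cs.root t = cs.root t') : t = t' :=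
  cs.eq_of_rep_eq fun x => by rw [cs.rep_reflection_apply ht, cs.rep_reflection_apply ht', h]

lemma root_conj {t : W} (ht : cs.IsReflection t) {w : W} (h : 0 ≤ cs.rep w (cs.root t)) :
    cs.root (w * t * w⁻¹) = cs.rep w (cs.root t) := by
  refine (cs.eq_root (ht.conj w) h (by rw [bil_rep, cs.bil_root_self ht]) ?_).symm
  rw [rep_mul_apply, rep_inv_apply_self, rep_mul_apply, cs.rep_reflection_root ht, map_neg]

lemma root_conj_neg {t : W} (ht : cs.IsReflection t) {w : W} (h : cs.rep w (cs.root t) ≤ 0) :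
    cs.root (w * t * w⁻¹) = -cs.rep w (cs.root t) := by
  refine (cs.eq_root (ht.conj w) (neg_nonneg.2 h) ?_ ?_).symm
  · simp [bil_rep, cs.bil_root_self ht]
  · rw [map_neg, rep_mul_apply, rep_inv_apply_self, rep_mul_apply, cs.rep_reflection_root ht,
      map_neg]

lemma rep_simple_root_nonneg {t : W} (ht : cs.IsReflection t) {i : B} (h : t ≠ cs.simple i) :
    0 ≤ cs.rep (cs.simple i) (cs.root t) := by
  refine (cs.rep_root_nonneg_or_nonpos ht _).resolve_right fun h' => h ?_
  apply cs.root_injective ht (cs.isReflection_simple i)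
  rw [root_simple]
  exact cs.eq_sroot_of_rep_simple_nonpos (cs.root_nonneg ht) (cs.bil_root_self ht) h'

lemma root_conj_simple {t : W} (ht : cs.IsReflection t) {i : B} (h : t ≠ cs.simple i) :
    cs.root (cs.simple i * t * cs.simple i) = cs.rep (cs.simple i) (cs.root t) := by
  simpa using cs.root_conj ht (cs.rep_simple_root_nonneg ht h)

lemma conj_eq_simple {t : W} (ht : cs.IsReflection t) {w : W} {i : B}
    (h : cs.rep w (cs.root t) = M.sroot i) : w * t * w⁻¹ = cs.simple i := by
  apply cs.root_injective (ht.conj w) (cs.isReflection_simple i)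
  rw [root_simple, ← h]
  exact cs.root_conj ht (h ▸ M.sroot_nonneg i)

/-- Strong exchange: applying the letters to the positive root from the right, there is a step at
which it turns negative. Just before, it is the simple root of that letter, and deleting the letter
amounts to right multiplication by t. -/
lemma exists_shorter_word {t : W} (ht : cs.IsReflection t) (ω : List B)
    (h : cs.rep (cs.wordProd ω) (cs.root t) ≤ 0) :
    ∃ ω' : List B, ω'.length < ω.length ∧ cs.wordProd ω' = cs.wordProd ω * t := by
  induction ω with
  | nil =>
    simp only [wordProd_nil, rep_one_apply] at h
    exact absurd (le_antisymm h (cs.root_nonneg ht)) (cs.root_ne_zero ht)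
  | cons i ω ih =>
    rcases cs.rep_root_nonneg_or_nonpos ht (cs.wordProd ω) with h' | h'
    · rw [wordProd_cons, rep_mul_apply] at h
      have h1 := cs.eq_sroot_of_rep_simple_nonpos h' (by rw [bil_rep, cs.bil_root_self ht]) h
      have h2 := cs.conj_eq_simple ht h1
      refine ⟨ω, by simp, ?_⟩
      rw [wordProd_cons, ← h2]
      simp only [mul_assoc, inv_mul_cancel_left]
      rw [ht.mul_self, mul_one]
    · obtain ⟨ω', h1, h2⟩ := ih h'
      exact ⟨i :: ω', by simpa using h1, by rw [wordProd_cons, wordProd_cons, h2, mul_assoc]⟩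

lemma length_mul_lt_of_rep_nonpos {t : W} (ht : cs.IsReflection t) {w : W}
    (h : cs.rep w (cs.root t) ≤ 0) : cs.length (w * t) < cs.length w := by
  obtain ⟨ω, hω, rfl⟩ := cs.exists_isReduced w
  obtain ⟨ω', h1, h2⟩ := cs.exists_shorter_word ht ω h
  rw [← h2, hω.eq]
  exact (cs.length_wordProd_le ω').trans_lt h1

lemma length_lt_mul_of_rep_nonneg {t : W} (ht : cs.IsReflection t) {w : W}
    (h : 0 ≤ cs.rep w (cs.root t)) : cs.length w < cs.length (w * t) := by
  have : cs.rep (w * t) (cs.root t) ≤ 0 := by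
    rw [rep_mul_apply, cs.rep_reflection_root ht, map_neg]; exact neg_nonpos.2 h
  simpa [mul_assoc, ht.mul_self] using cs.length_mul_lt_of_rep_nonpos ht this

lemma length_lt_mul_iff {t : W} (ht : cs.IsReflection t) {w : W} :
    cs.length w < cs.length (w * t) ↔ 0 ≤ cs.rep w (cs.root t) := by
  refine ⟨fun h => ?_, cs.length_lt_mul_of_rep_nonneg ht⟩
  by_contra h'
  have := cs.length_mul_lt_of_rep_nonpos ht ((cs.rep_root_nonpos_iff ht w).2 h')
  lia

lemma length_mul_lt_iff {t : W} (ht : cs.IsReflection t) {w : W} :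
    cs.length (w * t) < cs.length w ↔ cs.rep w (cs.root t) ≤ 0 := by
  refine ⟨fun h => ?_, cs.length_mul_lt_of_rep_nonpos ht⟩
  rw [cs.rep_root_nonpos_iff ht]
  intro h'
  have := cs.length_lt_mul_of_rep_nonneg ht h'
  lia

lemma isLeftInversion_iff_rep {w t : W} (ht : cs.IsReflection t) :
    cs.IsLeftInversion w t ↔ cs.rep w⁻¹ (cs.root t) ≤ 0 := by
  rw [← cs.length_mul_lt_iff ht, IsLeftInversion, and_iff_right ht, ← cs.length_inv (t * w),
    ← cs.length_inv w, mul_inv_rev, ht.inv]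

lemma isRightDescent_iff_rep {w : W} {i : B} :
    cs.IsRightDescent w i ↔ cs.rep w (M.sroot i) ≤ 0 := by
  rw [IsRightDescent, cs.length_mul_lt_iff (cs.isReflection_simple i), root_simple]

lemma not_isRightDescent_iff_rep {w : W} {i : B} :
    ¬ cs.IsRightDescent w i ↔ 0 ≤ cs.rep w (M.sroot i) := by
  rw [isRightDescent_iff_rep, ← cs.root_simple,
    cs.rep_root_nonpos_iff (cs.isReflection_simple i), not_not]

lemma isLeftDescent_iff_rep {w : W} {i : B} :
    cs.IsLeftDescent w i ↔ cs.rep w⁻¹ (M.sroot i) ≤ 0 := by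
  rw [← isRightDescent_inv_iff, isRightDescent_iff_rep]

/-- Distinct reflections commute exactly when their roots are orthogonal. -/
lemma mul_comm_iff_bil_eq_zero {t t' : W} (ht : cs.IsReflection t) (ht' : cs.IsReflection t')
    (hne : t ≠ t') : t * t' = t' * t ↔ M.bil (cs.root t) (cs.root t') = 0 := by
  constructor
  · intro h
    have hconj : t * t' * t⁻¹ = t' := by rw [h]; simp
    have h1 : cs.rep t (cs.root t') = cs.root t' ∨ cs.rep t (cs.root t') = -cs.root t' := by
      rcases cs.rep_root_nonneg_or_nonpos ht' t with h' | h'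
      · left; rw [← cs.root_conj ht' h', hconj]
      · right
        have := cs.root_conj_neg ht' h'
        rw [hconj] at this; exact (neg_eq_iff_eq_neg.2 this).symm
    rcases h1 with h1 | h1
    · rw [cs.rep_reflection_apply ht] at h1
      have : M.bil (cs.root t) (cs.root t') • cs.root t = 0 := by simpa using h1
      exact (smul_eq_zero.1 this).resolve_right (cs.root_ne_zero ht)
    · exact absurd (cs.root_injective ht' ht (cs.eq_root ht (cs.root_nonneg ht')
        (cs.bil_root_self ht') h1)).symm hne
  · intro h
    apply cs.eq_of_rep_eq
    intro x
    rw [rep_mul_apply, rep_mul_apply, cs.rep_reflection_apply ht, cs.rep_reflection_apply ht',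
      cs.rep_reflection_apply ht, cs.rep_reflection_apply ht']
    simp only [map_sub, map_smul, h, M.bil_comm (cs.root t') (cs.root t), smul_eq_mul]
    module

lemma simple_injective : Function.Injective cs.simple := by
  intro i j h
  have : M.sroot i = M.sroot j := by rw [← cs.root_simple, h, root_simple]
  by_contra hij
  have h' := DFunLike.congr_fun this i
  rw [M.sroot_apply_self, M.sroot_apply_of_ne (Ne.symm hij)] at h'
  norm_num at h'

lemma finite_index (cs : CoxeterSystem M W) : Finite B := Finite.of_injective _ cs.simple_injective

/-- The dual basis of the simple roots with respect to the form. -/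
lemma exists_fundamental_weight (cs : CoxeterSystem M W) (i : B) :
    ∃ ϖ : B →₀ ℝ, ∀ x, M.bil x ϖ = x i := by
  have := cs.finite_index
  have := Fintype.ofFinite B
  let f : (B →₀ ℝ) →ₗ[ℝ] (B → ℝ) := LinearMap.pi fun j => M.bil (M.sroot j)
  have hinj : Function.Injective f := by
    rw [← LinearMap.ker_eq_bot, LinearMap.ker_eq_bot']
    intro z hz
    exact cs.eq_zero_of_bil_sroot_eq_zero fun j => congrFun hz j
  have hsurj : Function.Surjective f :=
    (LinearMap.injective_iff_surjective_of_finrank_eq_finrank (by simp)).1 hinj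
  classical
  obtain ⟨z, hz⟩ := hsurj (Pi.single i 1)
  refine ⟨z, fun x => ?_⟩
  have : M.bil.flip z = Finsupp.lapply i := by
    ext j
    have := congrFun hz j
    simpa [f, sroot, Finsupp.single_apply, Pi.single_apply, eq_comm] using this
  exact LinearMap.congr_fun this x

end CoxeterSystem

namespace CoxeterSystem

open CoxeterMatrix

variable {B W : Type*} [Group W] {M : CoxeterMatrix B} (cs : CoxeterSystem M W)

/-! ### The Bruhat order -/

lemma BruhatLE.length_le {x y : W} (h : cs.BruhatLE x y) : cs.length x ≤ cs.length y := by
  induction h with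
  | refl => rfl
  | tail _ h ih => have := h.1; lia

lemma BruhatLE.length_lt {x y : W} (h : cs.BruhatLE x y) (hne : x ≠ y) :
    cs.length x < cs.length y := by
  rcases Relation.ReflTransGen.cases_head h with h | ⟨z, hz, h⟩
  · exact absurd h hne
  · have := hz.1; have := BruhatLE.length_le cs h; lia

lemma BruhatLE.trans {x y z : W} (h : cs.BruhatLE x y) (h' : cs.BruhatLE y z) : cs.BruhatLE x z :=
  Relation.ReflTransGen.trans h h'

lemma bruhatCover_simple_mul {x : W} {i : B} (h : ¬ cs.IsLeftDescent x i) :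
    cs.BruhatCover x (cs.simple i * x) := by
  refine ⟨(cs.not_isLeftDescent_iff).1 h, x⁻¹ * cs.simple i * x, ?_, by simp [mul_assoc]⟩
  simpa using (cs.isReflection_simple i).conj x⁻¹

lemma BruhatCover.inv {x y : W} (h : cs.BruhatCover x y) : cs.BruhatCover x⁻¹ y⁻¹ := by
  obtain ⟨h1, t, ht, rfl⟩ := h
  refine ⟨by rw [length_inv, length_inv]; exact h1, x * t * x⁻¹, ht.conj x, ?_⟩
  simp [mul_inv_rev, ht.inv, mul_assoc]

lemma BruhatLE.inv {x y : W} (h : cs.BruhatLE x y) : cs.BruhatLE x⁻¹ y⁻¹ := by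
  induction h with
  | refl => exact Relation.ReflTransGen.refl
  | tail _ h ih => exact ih.tail (BruhatCover.inv cs h)

lemma RightWeakLE.refl (x : W) : cs.RightWeakLE x x := fun _ h => h

lemma RightWeakLE.trans {x y z : W} (h : cs.RightWeakLE x y) (h' : cs.RightWeakLE y z) :
    cs.RightWeakLE x z := fun t ht => h' t (h t ht)

variable [Finite W]

/-- The exchange situation for a cover. -/
lemma BruhatCover.eq_simple_mul {x y : W} (h : cs.BruhatCover x y) {i : B}
    (hx : ¬ cs.IsLeftDescent x i) (hy : cs.IsLeftDescent y i) : y = cs.simple i * x := by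
  obtain ⟨h1, t, ht, rfl⟩ := h
  have h2 := (cs.length_lt_mul_iff ht (w := x)).1 (by lia)
  by_contra hne
  have h3 : 0 ≤ cs.rep (cs.simple i * x) (cs.root t) := by
    refine (cs.rep_root_nonneg_or_nonpos ht _).resolve_right fun h' => hne ?_
    rw [rep_mul_apply] at h'
    have := cs.conj_eq_simple ht
      (cs.eq_sroot_of_rep_simple_nonpos h2 (by rw [bil_rep, cs.bil_root_self ht]) h')
    rw [← this]; simp
  have h4 := cs.length_lt_mul_of_rep_nonneg ht h3
  have h5 := (cs.not_isLeftDescent_iff).1 hx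
  have h6 := (cs.isLeftDescent_iff).1 hy
  rw [mul_assoc] at h4
  lia

/-- If `x ≤ y` and `s_i x < x`, `s_i y < y`, then `s_i x ≤ s_i y`; if `s_i x > x`, `s_i y < y`, then
`x ≤ s_i y`. -/
lemma BruhatLE.lift_down {x y : W} (h : cs.BruhatLE x y) {i : B} (hy : cs.IsLeftDescent y i) :
    (cs.IsLeftDescent x i → cs.BruhatLE (cs.simple i * x) (cs.simple i * y)) ∧
    (¬ cs.IsLeftDescent x i → cs.BruhatLE x (cs.simple i * y)) := by
  induction h with
  | refl => exact ⟨fun _ => Relation.ReflTransGen.refl, fun h => absurd hy h⟩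
  | @tail y z h hc ih =>
    by_cases hd : cs.IsLeftDescent y i
    · have hcov : cs.BruhatCover (cs.simple i * y) (cs.simple i * z) := by
        obtain ⟨h1, t, ht, rfl⟩ := hc
        refine ⟨?_, t, ht, by rw [mul_assoc]⟩
        have h5 := (cs.isLeftDescent_iff).1 hd
        have h6 := (cs.isLeftDescent_iff).1 hy
        lia
      exact ⟨fun hx => ((ih hd).1 hx).tail hcov, fun hx => ((ih hd).2 hx).tail hcov⟩
    · have := BruhatCover.eq_simple_mul cs hc hd hy
      rw [this, simple_mul_simple_cancel_left]
      refine ⟨fun hx => ?_, fun _ => h⟩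
      have hx' := (cs.isLeftDescent_iff_not_isLeftDescent_mul).1 hx
      have := bruhatCover_simple_mul cs hx'
      rw [simple_mul_simple_cancel_left] at this
      exact Relation.ReflTransGen.head this h

/-- If `x ≤ y` then `max(x, s_i x) ≤ max(y, s_i y)`. -/
lemma BruhatLE.lift_up {x y : W} (h : cs.BruhatLE x y) {i : B} (hx : ¬ cs.IsLeftDescent x i) :
    (cs.IsLeftDescent y i → cs.BruhatLE (cs.simple i * x) y) ∧
    (¬ cs.IsLeftDescent y i → cs.BruhatLE (cs.simple i * x) (cs.simple i * y)) := by
  induction h with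
  | refl => exact ⟨fun h => absurd h hx, fun _ => Relation.ReflTransGen.refl⟩
  | @tail y z h hc ih =>
    by_cases hd : cs.IsLeftDescent y i
    · have hz : cs.BruhatLE (cs.simple i * x) z := (ih.1 hd).tail hc
      exact ⟨fun _ => hz, fun h' => hz.tail (bruhatCover_simple_mul cs h')⟩
    · by_cases hdz : cs.IsLeftDescent z i
      · have := BruhatCover.eq_simple_mul cs hc hd hdz
        exact ⟨fun _ => this ▸ ih.2 hd, fun h' => absurd hdz h'⟩
      · have hcov : cs.BruhatCover (cs.simple i * y) (cs.simple i * z) := by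
          obtain ⟨h1, t, ht, rfl⟩ := hc
          refine ⟨?_, t, ht, by rw [mul_assoc]⟩
          have h5 := (cs.not_isLeftDescent_iff).1 hd
          have h6 := (cs.not_isLeftDescent_iff).1 hdz
          lia
        exact ⟨fun h' => absurd h' hdz, fun _ => (ih.2 hd).tail hcov⟩

lemma BruhatLE.lift_down_right {x y : W} (h : cs.BruhatLE x y) {i : B}
    (hy : cs.IsRightDescent y i) :
    (cs.IsRightDescent x i → cs.BruhatLE (x * cs.simple i) (y * cs.simple i)) ∧
    (¬ cs.IsRightDescent x i → cs.BruhatLE x (y * cs.simple i)) := by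
  have hinv := BruhatLE.lift_down cs (BruhatLE.inv cs h) ((cs.isLeftDescent_inv_iff).2 hy)
  rw [isLeftDescent_inv_iff] at hinv
  refine ⟨fun hx => ?_, fun hx => ?_⟩
  · simpa using BruhatLE.inv cs (hinv.1 hx)
  · simpa using BruhatLE.inv cs (hinv.2 hx)

/-! ### The right weak order -/

lemma isLeftInversion_simple_mul {x t : W} (ht : cs.IsReflection t) {i : B} (hne : t ≠ cs.simple i) :
    cs.IsLeftInversion (cs.simple i * x) t ↔
      cs.IsLeftInversion x (cs.simple i * t * cs.simple i) := by
  have ht' : cs.IsReflection (cs.simple i * t * cs.simple i) := by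
    simpa using ht.conj (cs.simple i)
  rw [cs.isLeftInversion_iff_rep ht, cs.isLeftInversion_iff_rep ht', cs.root_conj_simple ht hne,
    mul_inv_rev, inv_simple, rep_mul_apply]

lemma RightWeakLE.simple_mul_up {x y : W} {i : B} (h : cs.RightWeakLE x y)
    (hy : ¬ cs.IsLeftDescent y i) : cs.RightWeakLE (cs.simple i * x) (cs.simple i * y) := by
  intro t ht
  by_cases hne : t = cs.simple i
  · subst hne
    rw [isLeftInversion_simple_iff_isLeftDescent]
    have := (cs.isLeftDescent_iff_not_isLeftDescent_mul (w := cs.simple i * y) (i := i)).2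
    simpa [hy] using this
  · have hr := ht.1
    rw [cs.isLeftInversion_simple_mul hr hne] at ht ⊢
    exact h _ ht

lemma RightWeakLE.simple_mul_down {x y : W} {i : B} (h : cs.RightWeakLE x y)
    (hx : cs.IsLeftDescent x i) : cs.RightWeakLE (cs.simple i * x) (cs.simple i * y) := by
  intro t ht
  by_cases hne : t = cs.simple i
  · subst hne
    rw [isLeftInversion_simple_iff_isLeftDescent] at ht
    exact absurd ht ((cs.isLeftDescent_iff_not_isLeftDescent_mul).1 hx)
  · have hr := ht.1
    rw [cs.isLeftInversion_simple_mul hr hne] at ht ⊢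
    exact h _ ht

lemma RightWeakLE.length_add {x y : W} (h : cs.RightWeakLE x y) :
    cs.length x + cs.length (x⁻¹ * y) = cs.length y := by
  induction hn : cs.length x generalizing x y with
  | zero => rw [cs.length_eq_zero_iff] at hn; subst hn; simp
  | succ n ih =>
    have hne : x ≠ 1 := by rintro rfl; simp at hn
    obtain ⟨i, hi⟩ := cs.exists_leftDescent_of_ne_one hne
    have h1 := (cs.isLeftDescent_iff).1 hi
    have hy : cs.IsLeftDescent y i := by
      rw [← isLeftInversion_simple_iff_isLeftDescent] at hi ⊢; exact h _ hi
    have h2 := (cs.isLeftDescent_iff).1 hy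
    have h3 := ih (h.simple_mul_down cs hi) (by lia)
    rw [mul_inv_rev, inv_simple, mul_assoc, simple_mul_simple_cancel_left] at h3
    lia

lemma rightWeakLE_mul_simple {x : W} {i : B} (h : ¬ cs.IsRightDescent x i) :
    cs.RightWeakLE x (x * cs.simple i) := by
  intro t ht
  have hr := ht.1
  rw [cs.isLeftInversion_iff_rep hr] at ht ⊢
  by_contra hcon
  rw [cs.rep_root_nonpos_iff hr, not_not, mul_inv_rev, inv_simple, rep_mul_apply] at hcon
  have h1 : cs.rep (cs.simple i) (-cs.rep x⁻¹ (cs.root t)) ≤ 0 := by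
    rw [map_neg]; exact neg_nonpos.2 hcon
  have h2 := cs.eq_sroot_of_rep_simple_nonpos (neg_nonneg.2 ht)
    (by simp [bil_rep, cs.bil_root_self hr]) h1
  rw [not_isRightDescent_iff_rep, ← h2, map_neg, rep_apply_inv_self] at h
  exact cs.root_ne_zero hr (le_antisymm (neg_nonneg.1 h) (cs.root_nonneg hr))

lemma rightWeakLE_of_length_add {x z : W} (h : cs.length (x * z) = cs.length x + cs.length z) :
    cs.RightWeakLE x (x * z) := by
  induction hn : cs.length z generalizing z with
  | zero => rw [cs.length_eq_zero_iff] at hn; subst hn; simpa using RightWeakLE.refl cs x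
  | succ n ih =>
    have hne : z ≠ 1 := by rintro rfl; simp at hn
    obtain ⟨i, hi⟩ := cs.exists_rightDescent_of_ne_one hne
    have h1 := (cs.isRightDescent_iff).1 hi
    have h2 := cs.length_mul_le x (z * cs.simple i)
    have h3 := cs.length_mul_simple (x * z) i
    rw [mul_assoc] at h3
    refine (ih (z := z * cs.simple i) (by lia) (by lia)).trans cs ?_
    have := cs.rightWeakLE_mul_simple (x := x * (z * cs.simple i)) (i := i)
      ((cs.not_isRightDescent_iff).2 (by rw [mul_assoc, mul_assoc]; simp only [simple_mul_simple_self, mul_one]; lia))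
    rw [mul_assoc, mul_assoc] at this
    simpa using this

/-- Below `y`, a strictly smaller element is below some lower cover of `y`. -/
lemma RightWeakLE.exists_descent {x y : W} (h : cs.RightWeakLE x y) (hne : x ≠ y) :
    ∃ i, cs.IsRightDescent y i ∧ cs.RightWeakLE x (y * cs.simple i) := by
  have h0 := h.length_add cs
  have hz : x⁻¹ * y ≠ 1 := fun h' => hne (inv_mul_eq_one.1 h')
  obtain ⟨i, hi⟩ := cs.exists_rightDescent_of_ne_one hz
  have h1 := (cs.isRightDescent_iff).1 hi
  have h2 := cs.length_mul_le x (x⁻¹ * y * cs.simple i)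
  have h3 : x * (x⁻¹ * y * cs.simple i) = y * cs.simple i := by simp [mul_assoc]
  rw [h3] at h2
  have h4 := cs.length_mul_simple y i
  refine ⟨i, (cs.isRightDescent_iff).2 (by lia), ?_⟩
  rw [← h3]
  exact cs.rightWeakLE_of_length_add (by rw [h3]; lia)

lemma RightWeakLE.antisymm {x y : W} (h : cs.RightWeakLE x y) (h' : cs.RightWeakLE y x) : x = y := by
  have h1 := h.length_add cs
  have h2 := h'.length_add cs
  exact inv_mul_eq_one.1 ((cs.length_eq_zero_iff).1 (by lia))

end CoxeterSystem

/-! ### Commutation equivalence -/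

section Commutation

variable {G H : Type*} [Group G] [Group H]

lemma CommutationMove.symm {l l' : List G} (h : CommutationMove l l') : CommutationMove l' l := by
  obtain ⟨l₁, l₂, x, y, h⟩ := h
  exact ⟨l₁, l₂, y, x, h.symm⟩

lemma CommutationEquiv.refl (l : List G) : CommutationEquiv l l := Relation.EqvGen.refl _

lemma CommutationEquiv.symm {l l' : List G} (h : CommutationEquiv l l') : CommutationEquiv l' l :=
  Relation.EqvGen.symm _ _ h

lemma CommutationEquiv.trans {l₁ l₂ l₃ : List G} (h₁₂ : CommutationEquiv l₁ l₂)
    (h₂₃ : CommutationEquiv l₂ l₃) : CommutationEquiv l₁ l₃ :=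
  Relation.EqvGen.trans _ _ _ h₁₂ h₂₃

/-- A property preserved by commutation moves is invariant under commutation equivalence. -/
lemma CommutationEquiv.iff_of_move {p : List G → Prop}
    (hp : ∀ l l', CommutationMove l l' → p l → p l') {l l' : List G} (h : CommutationEquiv l l') :
    p l ↔ p l' := by
  induction h with
  | rel _ _ h => exact ⟨hp _ _ h, hp _ _ h.symm⟩
  | refl _ => rfl
  | symm _ _ _ ih => exact ih.symm
  | trans _ _ _ _ _ ih ih' => exact ih.trans ih'

lemma CommutationEquiv.map_of_move {f : List G → List H}
    (hf : ∀ l l', CommutationMove l l' → CommutationMove (f l) (f l')) {l l' : List G}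
    (h : CommutationEquiv l l') : CommutationEquiv (f l) (f l') := by
  induction h with
  | rel _ _ h => exact .rel _ _ (hf _ _ h)
  | refl _ => exact .refl _
  | symm _ _ _ ih => exact ih.symm
  | trans _ _ _ _ _ ih ih' => exact ih.trans ih'

lemma CommutationEquiv.cons (x : G) {l l' : List G} (h : CommutationEquiv l l') :
    CommutationEquiv (x :: l) (x :: l') :=
  h.map_of_move (f := (x :: ·)) fun _ _ h => by
    obtain ⟨l₁, l₂, y, z, hyz⟩ := h
    exact ⟨x :: l₁, l₂, y, z, hyz⟩

lemma CommutationEquiv.map (f : G →* H) {l l' : List G} (h : CommutationEquiv l l') :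
    CommutationEquiv (l.map f) (l'.map f) :=
  h.map_of_move (f := List.map f) fun _ _ h => by
    obtain ⟨l₁, l₂, y, z, hyz⟩ := h
    simp only [List.map_append, List.map_cons]
    exact ⟨_, _, _, _, by rw [← map_mul, hyz, map_mul]⟩

lemma CommutationEquiv.perm {l l' : List G} (h : CommutationEquiv l l') : l.Perm l' := by
  induction h with
  | rel _ _ h =>
    obtain ⟨l₁, l₂, x, y, h⟩ := h
    exact (List.Perm.swap y x l₂).append_left l₁
  | refl _ => exact .refl _
  | symm _ _ _ ih => exact ih.symm
  | trans _ _ _ _ _ ih ih' => exact ih.trans ih'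

lemma commutationEquiv_move_front {l₁ l₂ : List G} {x : G} (h : ∀ y ∈ l₁, y * x = x * y) :
    CommutationEquiv (l₁ ++ x :: l₂) (x :: (l₁ ++ l₂)) := by
  induction l₁ with
  | nil => exact .refl _
  | cons y l₁ ih =>
    refine ((ih fun z hz => h z (List.mem_cons_of_mem _ hz)).cons y).trans (.rel _ _ ?_)
    exact ⟨[], l₁ ++ l₂, y, x, h y List.mem_cons_self⟩

lemma commutationEquiv_move_back {l₁ l₂ : List G} {x : G} (h : ∀ y ∈ l₂, y * x = x * y) :
    CommutationEquiv (l₁ ++ x :: l₂) (l₁ ++ l₂ ++ [x]) := by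
  induction l₁ with
  | nil => simpa using (commutationEquiv_move_front (l₂ := []) h).symm
  | cons y l₁ ih => exact ih.cons y

lemma CommutationEquiv.prod_eq {l l' : List G} (h : CommutationEquiv l l') : l.prod = l'.prod :=
  (h.iff_of_move (p := fun k => k.prod = l'.prod) fun _ _ ⟨l₁, l₂, x, y, hxy⟩ hk => by
    rw [← hk]; simp only [List.prod_append, List.prod_cons]
    rw [← mul_assoc y, ← hxy, mul_assoc]).2 rfl

end Commutation

namespace CoxeterSystem

open CoxeterMatrix

variable {B W : Type*} [Group W] {M : CoxeterMatrix B} (cs : CoxeterSystem M W)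

/-! ### Reflection factorizations -/

/-- The word `t₁ ⋯ tₖ` ascends from `u`: the lengths of `u, u t₁, u t₁ t₂, …` increase. -/
def Ascends : W → List W → Prop
  | _, [] => True
  | u, t :: l => cs.length u < cs.length (u * t) ∧ Ascends (u * t) l

/-- The positive roots of the letters have pairwise nonnegative inner products. -/
def Acute (l : List W) : Prop :=
  l.Pairwise fun t₁ t₂ => 0 ≤ M.bil (cs.root t₁) (cs.root t₂)

/-- `l` is a word of reflections for the product of `γ`, of the same length as `γ`. -/
structure IsFactorization (γ : List B) (l : List W) : Prop where
  refl : ∀ t ∈ l, cs.IsReflection t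
  prod_eq : l.prod = cs.wordProd γ
  length_eq : l.length = γ.length

/-- `l` is an acute factorization of the product of `γ` ascending from `u`. -/
structure IsAcuteFactorization (γ : List B) (u : W) (l : List W) : Prop extends
    cs.IsFactorization γ l where
  acute : cs.Acute l
  ascends : cs.Ascends u l

lemma ascends_append (u : W) (l l' : List W) :
    cs.Ascends u (l ++ l') ↔ cs.Ascends u l ∧ cs.Ascends (u * l.prod) l' := by
  induction l generalizing u with
  | nil => simp [Ascends]
  | cons t l ih => simp [Ascends, ih, and_assoc, mul_assoc]

lemma Ascends.length_le {u : W} {l : List W} (h : cs.Ascends u l) :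
    cs.length u + l.length ≤ cs.length (u * l.prod) := by
  induction l generalizing u with
  | nil => simp
  | cons t l ih =>
    have h1 := h.1
    have := ih h.2
    rw [mul_assoc] at this
    simp only [List.length_cons, List.prod_cons]
    lia

lemma IsFactorization.commutationEquiv {γ : List B} {l l' : List W} (h : cs.IsFactorization γ l)
    (hl : CommutationEquiv l l') : cs.IsFactorization γ l' :=
  ⟨fun t ht => h.refl t (hl.perm.mem_iff.2 ht), by rw [← hl.prod_eq, h.prod_eq],
    by rw [← hl.perm.length_eq, h.length_eq]⟩

lemma Acute.perm {l l' : List W} (h : cs.Acute l) (hl : l.Perm l') : cs.Acute l' :=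
  hl.pairwise h fun {x y} hxy => by rwa [M.bil_comm]

lemma rep_wordProd_eq_self {γ : List B} {z : B →₀ ℝ} (h : ∀ j ∈ γ, M.bil (M.sroot j) z = 0) :
    cs.rep (cs.wordProd γ) z = z := by
  induction γ with
  | nil => simp
  | cons i γ ih =>
    rw [wordProd_cons, rep_mul_apply, ih fun j hj => h j (List.mem_cons_of_mem _ hj),
      rep_simple_apply, h i List.mem_cons_self]
    simp

lemma finrank_supported {γ : List B} (hγ : γ.Nodup) :
    Module.finrank ℝ (Finsupp.supported ℝ ℝ {j | j ∈ γ}) = γ.length := by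
  classical
  rw [LinearEquiv.finrank_eq (Finsupp.supportedEquivFinsupp {j | j ∈ γ})]
  have : Fintype {j | j ∈ γ} := (List.finite_toSet γ).fintype
  rw [Module.finrank_finsupp_self, ← Set.toFinset_card]
  rw [← List.toFinset_card_of_nodup hγ]
  congr 1; ext; simp

lemma finrank_span_image_le {V α : Type*} [AddCommGroup V] [Module ℝ V] (f : α → V) (l : List α) :
    Module.finrank ℝ (Submodule.span ℝ (f '' {t | t ∈ l})) ≤ l.length := by
  classical
  have : f '' {t | t ∈ l} = ((l.map f).toFinset : Set V) := by ext; simp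
  rw [this]
  exact (finrank_span_finset_le_card _).trans ((List.toFinset_card_le _).trans (by simp))

variable [Finite W]

/-- Distinct commuting reflections have orthogonal roots, so neither changes the sign that governs
the step of the other. -/
lemma Ascends.commutationEquiv {l l' : List W} (hr : ∀ t ∈ l, cs.IsReflection t) {u : W}
    (h : cs.Ascends u l) (hl : CommutationEquiv l l') : cs.Ascends u l' := by
  have key := hl.iff_of_move
    (p := fun k => (∀ t ∈ k, cs.IsReflection t) ∧ cs.Ascends u k) ?_
  · exact (key.1 ⟨hr, h⟩).2
  rintro _ _ ⟨l₁, l₂, x, y, hxy⟩ ⟨hr, h⟩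
  refine ⟨fun t ht => hr t ?_, ?_⟩
  · simp only [List.mem_append, List.mem_cons] at ht ⊢; tauto
  rcases eq_or_ne x y with rfl | hne
  · exact h
  have hx := hr x (by simp)
  have hy := hr y (by simp)
  rw [ascends_append] at h ⊢
  refine ⟨h.1, ?_⟩
  obtain ⟨-, h1, h2, h3⟩ := h
  set v := u * l₁.prod
  have hb := (cs.mul_comm_iff_bil_eq_zero hx hy hne).1 hxy
  rw [cs.length_lt_mul_iff hx] at h1
  rw [cs.length_lt_mul_iff hy, rep_mul_apply, cs.rep_reflection_apply hx, hb, zero_smul,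
    sub_zero] at h2
  refine ⟨(cs.length_lt_mul_iff hy).2 h2, ?_, ?_⟩
  · rw [cs.length_lt_mul_iff hx, rep_mul_apply, cs.rep_reflection_apply hy, M.bil_comm, hb,
      zero_smul, sub_zero]
    exact h1
  · rwa [mul_assoc, ← hxy, ← mul_assoc]

lemma IsAcuteFactorization.commutationEquiv {γ : List B} {u : W} {l l' : List W}
    (h : cs.IsAcuteFactorization γ u l) (hl : CommutationEquiv l l') :
    cs.IsAcuteFactorization γ u l' :=
  ⟨h.toIsFactorization.commutationEquiv cs hl, h.acute.perm cs hl.perm,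
    h.ascends.commutationEquiv cs h.refl hl⟩

/-! ### Roots of a factorization span the roots of the word -/

/-- The image of 1 - c contains every vector supported on the word. The last letter s contributes
α_s: its fundamental weight ϖ is fixed by the other letters, so α_s - ϖ is sent to -ϖ. -/
lemma exists_sub_rep_eq {γ : List B} (hγ : γ.Nodup) {x : B →₀ ℝ} (hx : ∀ j, j ∉ γ → x j = 0) :
    ∃ z, z - cs.rep (cs.wordProd γ) z = x := by
  induction γ using List.reverseRecOn generalizing x with
  | nil => exact ⟨0, by simpa using (Finsupp.ext fun j => (hx j (by simp)).symm)⟩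
  | append_singleton γ s ih =>
    have hs : s ∉ γ := by
      rw [List.nodup_append] at hγ
      intro h; exact hγ.2.2 s h s (by simp) rfl
    obtain ⟨ϖ, hϖ⟩ := cs.exists_fundamental_weight s
    obtain ⟨z₀, hz₀⟩ := ih (hγ.sublist (by simp)) (x := x - x s • M.sroot s) (by
      intro j hj
      rcases eq_or_ne s j with rfl | hne
      · simp [M.sroot_apply_self]
      · simp [M.sroot_apply_of_ne hne, hx j (by simp [hj, hne.symm])])
    have h1 : cs.rep (cs.wordProd γ) ϖ = ϖ := cs.rep_wordProd_eq_self fun j hj => by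
      rw [hϖ, M.sroot_apply_of_ne]; rintro rfl; exact hs hj
    set k := M.bil (M.sroot s) z₀
    -- The reflected `z₀` contributes (1 - γ)z₀ - k α_s; the second term adds the missing multiple
    -- of α_s.
    refine ⟨cs.rep (cs.simple s) z₀ + (x s + k) • (M.sroot s - ϖ), ?_⟩
    have h2 : cs.rep (cs.simple s) (cs.rep (cs.simple s) z₀) = z₀ := by
      rw [← rep_mul_apply]; simp
    have h3 : cs.rep (cs.simple s) (M.sroot s - ϖ) = -ϖ := by
      rw [map_sub, rep_simple_sroot, rep_simple_apply, hϖ, M.sroot_apply_self]; module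
    rw [wordProd_append, wordProd_singleton, rep_mul_apply, map_add, map_smul, h2, h3, map_add,
      map_smul, map_neg, h1, cs.rep_simple_apply s z₀]
    change z₀ - k • M.sroot s + _ - _ = _
    have h4 : x = z₀ - cs.rep (cs.wordProd γ) z₀ + x s • M.sroot s := by rw [hz₀]; module
    conv_rhs => rw [h4]
    module

lemma sub_rep_prod_mem_span {l : List W} (hl : ∀ t ∈ l, cs.IsReflection t) (z : B →₀ ℝ) :
    z - cs.rep l.prod z ∈ Submodule.span ℝ (cs.root '' {t | t ∈ l}) := by
  induction l with
  | nil => simp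
  | cons t l ih =>
    have h1 := ih fun t' ht' => hl t' (List.mem_cons_of_mem _ ht')
    have h2 : Submodule.span ℝ (cs.root '' {t' | t' ∈ l}) ≤
        Submodule.span ℝ (cs.root '' {t' | t' ∈ t :: l}) :=
      Submodule.span_mono (Set.image_mono fun t' ht' => List.mem_cons_of_mem _ ht')
    rw [List.prod_cons, rep_mul_apply, cs.rep_reflection_apply (hl t List.mem_cons_self)]
    have h3 : z - (cs.rep l.prod z - M.bil (cs.root t) (cs.rep l.prod z) • cs.root t) =
      (z - cs.rep l.prod z) + M.bil (cs.root t) (cs.rep l.prod z) • cs.root t := by module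
    rw [h3]
    exact add_mem (h2 h1) (Submodule.smul_mem _ _
      (Submodule.subset_span ⟨t, List.mem_cons_self, rfl⟩))

/-- The image of 1 - c contains the vectors supported on the word, and by telescoping it lies in the
span of the roots of any factorization. -/
lemma supported_le_span {γ : List B} (hγ : γ.Nodup) {l : List W} (hl : ∀ t ∈ l, cs.IsReflection t)
    (h : l.prod = cs.wordProd γ) :
    Finsupp.supported ℝ ℝ {j | j ∈ γ} ≤ Submodule.span ℝ (cs.root '' {t | t ∈ l}) := by
  intro x hx
  obtain ⟨z, hz⟩ := cs.exists_sub_rep_eq hγ (x := x) fun j hj => by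
    rw [Finsupp.mem_supported'] at hx; exact hx j hj
  rw [← hz, ← h]
  exact cs.sub_rep_prod_mem_span hl z

/-- A word of reflections for the product of a word without repetition is at least as long. -/
lemma length_le_of_prod_eq {γ : List B} (hγ : γ.Nodup) {l : List W}
    (hl : ∀ t ∈ l, cs.IsReflection t) (h : l.prod = cs.wordProd γ) : γ.length ≤ l.length := by
  have := cs.finite_index
  rw [← finrank_supported hγ]
  exact (Submodule.finrank_mono (cs.supported_le_span hγ hl h)).trans
    (finrank_span_image_le _ _)

/-- At minimal length the inclusion is an equality by dimension. The roots of a factorization are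
then a basis: letters are distinct, and no root has a coordinate outside the word. -/
lemma IsFactorization.span_eq {γ : List B} (hγ : γ.Nodup) {l : List W}
    (h : cs.IsFactorization γ l) :
    Finsupp.supported ℝ ℝ {j | j ∈ γ} = Submodule.span ℝ (cs.root '' {t | t ∈ l}) := by
  have := cs.finite_index
  apply Submodule.eq_of_le_of_finrank_le (cs.supported_le_span hγ h.refl h.prod_eq)
  rw [finrank_supported hγ, ← h.length_eq]
  exact finrank_span_image_le _ _

lemma IsFactorization.root_apply_eq_zero {γ : List B} (hγ : γ.Nodup) {l : List W}
    (h : cs.IsFactorization γ l) {t : W} (ht : t ∈ l) {j : B} (hj : j ∉ γ) : cs.root t j = 0 := by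
  have : cs.root t ∈ Finsupp.supported ℝ ℝ {j | j ∈ γ} := by
    rw [h.span_eq cs hγ]; exact Submodule.subset_span ⟨t, ht, rfl⟩
  exact (Finsupp.mem_supported' ℝ _).1 this j hj

lemma IsFactorization.nodup {γ : List B} (hγ : γ.Nodup) {l : List W}
    (h : cs.IsFactorization γ l) : l.Nodup := by
  classical
  have := cs.finite_index
  have h1 := finrank_supported (γ := γ) hγ
  rw [h.span_eq cs hγ, ← h.length_eq] at h1
  have h2 : cs.root '' {t | t ∈ l} = cs.root '' {t | t ∈ l.dedup} := by simp
  rw [h2] at h1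
  have h3 := finrank_span_image_le cs.root l.dedup
  rw [h1] at h3
  rw [← List.dedup_eq_self]
  exact (List.dedup_sublist l).eq_of_length_le h3

end CoxeterSystem

namespace CoxeterSystem

open CoxeterMatrix

variable {B W : Type*} [Group W] {M : CoxeterMatrix B} (cs : CoxeterSystem M W)

/-! ### Conjugation of factorizations by a simple reflection -/

/-- Conjugation by a simple reflection. -/
def sconj (s : B) : W →* W := (MulAut.conj (cs.simple s)).toMonoidHom

lemma sconj_apply (s : B) (t : W) : cs.sconj s t = cs.simple s * t * cs.simple s := by
  simp [sconj]

@[simp] lemma sconj_sconj (s : B) (t : W) : cs.sconj s (cs.sconj s t) = t := by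
  simp [sconj_apply, mul_assoc]

@[simp] lemma map_sconj_map_sconj (s : B) (l : List W) :
    (l.map (cs.sconj s)).map (cs.sconj s) = l := by
  rw [List.map_map]
  conv_rhs => rw [← List.map_id l]
  congr 1; ext; simp

@[simp] lemma sconj_simple (s : B) : cs.sconj s (cs.simple s) = cs.simple s := by
  simp [sconj_apply]

lemma prod_map_sconj (s : B) (l : List W) : (l.map (cs.sconj s)).prod = cs.sconj s l.prod :=
  (map_list_prod _ _).symm

lemma isReflection_sconj (s : B) {t : W} (ht : cs.IsReflection t) :
    cs.IsReflection (cs.sconj s t) := by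
  rw [sconj_apply]; simpa using ht.conj (cs.simple s)

lemma isReflection_map_sconj (s : B) {l : List W} (hl : ∀ t ∈ l, cs.IsReflection t) :
    ∀ t ∈ l.map (cs.sconj s), cs.IsReflection t := by
  intro t ht
  obtain ⟨t', ht', rfl⟩ := List.mem_map.1 ht
  exact cs.isReflection_sconj s (hl t' ht')

lemma simple_mem_map_sconj (s : B) {l : List W} :
    cs.simple s ∈ l.map (cs.sconj s) ↔ cs.simple s ∈ l := by
  constructor
  · intro h
    obtain ⟨t, ht, h⟩ := List.mem_map.1 h
    have : t = cs.simple s := by rw [← cs.sconj_sconj s t, h, sconj_simple]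
    rwa [← this]
  · intro h; exact List.mem_map.2 ⟨_, h, cs.sconj_simple s⟩

lemma IsFactorization.sconj_rotate {γ : List B} {s : B} {l : List W}
    (h : cs.IsFactorization (γ ++ [s]) l) :
    cs.IsFactorization (s :: γ) (l.map (cs.sconj s)) :=
  ⟨cs.isReflection_map_sconj s h.refl, by
    rw [prod_map_sconj, h.prod_eq, sconj_apply, wordProd_append, wordProd_singleton, wordProd_cons]
    simp [mul_assoc], by simp [h.length_eq]⟩

lemma IsFactorization.sconj_rotate_back {γ : List B} {s : B} {l : List W}
    (h : cs.IsFactorization (s :: γ) l) :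
    cs.IsFactorization (γ ++ [s]) (l.map (cs.sconj s)) :=
  ⟨cs.isReflection_map_sconj s h.refl, by
    rw [prod_map_sconj, h.prod_eq, sconj_apply, wordProd_append, wordProd_cons, wordProd_singleton]
    simp, by simp [h.length_eq]⟩

/-- Removing a simple reflection from a factorization: the last letter of the word. -/
lemma IsFactorization.remove_last {γ : List B} {s : B} {l₁ l₂ : List W}
    (h : cs.IsFactorization (γ ++ [s]) (l₁ ++ cs.simple s :: l₂)) :
    cs.IsFactorization γ (l₁ ++ l₂.map (cs.sconj s)) := by
  refine ⟨fun t ht => ?_, ?_, ?_⟩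
  · rcases List.mem_append.1 ht with ht | ht
    · exact h.refl t (by simp [ht])
    · exact cs.isReflection_map_sconj s (fun t ht => h.refl t (by simp [ht])) t ht
  · have := h.prod_eq
    rw [wordProd_append, wordProd_singleton, List.prod_append, List.prod_cons] at this
    rw [List.prod_append, prod_map_sconj, sconj_apply, ← mul_assoc, this]
    simp
  · have := h.length_eq
    simp at this ⊢
    lia

lemma IsFactorization.remove_first {γ : List B} {s : B} {l₁ l₂ : List W}
    (h : cs.IsFactorization (s :: γ) (l₁ ++ cs.simple s :: l₂)) :
    cs.IsFactorization γ (l₁.map (cs.sconj s) ++ l₂) := by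
  refine ⟨fun t ht => ?_, ?_, ?_⟩
  · rcases List.mem_append.1 ht with ht | ht
    · exact cs.isReflection_map_sconj s (fun t ht => h.refl t (by simp [ht])) t ht
    · exact h.refl t (by simp [ht])
  · have := h.prod_eq
    rw [wordProd_cons, List.prod_append, List.prod_cons] at this
    rw [List.prod_append, prod_map_sconj, sconj_apply, mul_assoc, mul_assoc, this]
    simp
  · have := h.length_eq
    simp at this ⊢
    lia

lemma IsFactorization.cons_sconj {γ : List B} {s : B} {l : List W} (h : cs.IsFactorization γ l) :
    cs.IsFactorization (γ ++ [s]) (cs.simple s :: l.map (cs.sconj s)) := by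
  refine ⟨fun t ht => ?_, ?_, by simp [h.length_eq]⟩
  · rcases List.mem_cons.1 ht with rfl | ht
    · exact cs.isReflection_simple s
    · exact cs.isReflection_map_sconj s h.refl t ht
  · rw [List.prod_cons, prod_map_sconj, sconj_apply, h.prod_eq, wordProd_append, wordProd_singleton]
    simp [mul_assoc]

lemma nodup_append_singleton_iff {γ : List B} {s : B} :
    (γ ++ [s]).Nodup ↔ γ.Nodup ∧ s ∉ γ := by
  simp only [List.nodup_append, List.nodup_cons, List.not_mem_nil, not_false_eq_true,
    List.nodup_nil, and_self, List.mem_singleton, true_and]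
  constructor
  · rintro ⟨h1, h2⟩; exact ⟨h1, fun h => h2 s h s rfl rfl⟩
  · rintro ⟨h1, h2⟩; exact ⟨h1, by rintro a ha b rfl rfl; exact h2 ha⟩

lemma length_of_append {γ : List B} {s : B} {u : W}
    (hu : cs.length (u * cs.wordProd (γ ++ [s])) = cs.length u + (γ ++ [s]).length) :
    cs.length (u * cs.wordProd γ) = cs.length u + γ.length := by
  simp only [wordProd_append, wordProd_singleton, List.length_append, List.length_singleton,
    ← mul_assoc] at hu
  have h1 := cs.length_mul_le u (cs.wordProd γ)
  have h2 := cs.length_wordProd_le γ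
  have h3 := cs.length_mul_simple (u * cs.wordProd γ) s
  lia

lemma length_of_rotate {γ : List B} {s : B} {u : W}
    (hu : cs.length (u * cs.wordProd (γ ++ [s])) = cs.length u + (γ ++ [s]).length)
    (hd : cs.IsRightDescent u s) :
    cs.length (u * cs.simple s * cs.wordProd (s :: γ)) =
      cs.length (u * cs.simple s) + (s :: γ).length := by
  have h1 := cs.length_of_append hu
  have h2 := (cs.isRightDescent_iff).1 hd
  rw [wordProd_cons, mul_assoc, simple_mul_simple_cancel_left, h1, List.length_cons]
  lia

lemma IsAcuteFactorization.length_eq_add {γ : List B} {u : W} {l : List W}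
    (h : cs.IsAcuteFactorization γ u l) :
    cs.length (u * cs.wordProd γ) = cs.length u + γ.length := by
  have h1 := h.ascends.length_le cs
  rw [h.prod_eq, h.length_eq] at h1
  have h2 := cs.length_mul_le u (cs.wordProd γ)
  have h3 := cs.length_wordProd_le γ
  lia

variable [Finite W]

/-- For t ≠ s the positive root of sts is s β_t, so the signs of (us)(s β_t) and u β_t are the same
at each step. -/
lemma ascends_map_sconj {s : B} {l : List W} (hl : ∀ t ∈ l, cs.IsReflection t)
    (hs : cs.simple s ∉ l) {u : W} :
    cs.Ascends (u * cs.simple s) (l.map (cs.sconj s)) ↔ cs.Ascends u l := by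
  induction l generalizing u with
  | nil => simp [Ascends]
  | cons t l ih =>
    have ht := hl t List.mem_cons_self
    have hne : t ≠ cs.simple s := fun h => hs (by simp [h])
    have h1 : u * cs.simple s * cs.sconj s t = u * t * cs.simple s := by simp [sconj_apply, mul_assoc]
    simp only [List.map_cons, Ascends]
    refine and_congr ?_ ?_
    · rw [cs.length_lt_mul_iff (cs.isReflection_sconj s ht), cs.length_lt_mul_iff ht, sconj_apply,
        cs.root_conj_simple ht hne, rep_mul_apply, ← cs.rep_mul_apply (cs.simple s)]
      simp
    · rw [h1]
      exact ih (fun t ht => hl t (List.mem_cons_of_mem _ ht)) fun h => hs (List.mem_cons_of_mem _ h)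

lemma acute_map_sconj {s : B} {l : List W} (hl : ∀ t ∈ l, cs.IsReflection t)
    (hs : cs.simple s ∉ l) : cs.Acute (l.map (cs.sconj s)) ↔ cs.Acute l := by
  rw [Acute, Acute, List.pairwise_map]
  refine List.Pairwise.iff_of_mem fun {t t'} ht ht' => ?_
  rw [sconj_apply, sconj_apply, cs.root_conj_simple (hl t ht) fun h => hs (h ▸ ht),
    cs.root_conj_simple (hl t' ht') fun h => hs (h ▸ ht'), bil_rep]

/-! ### The letter `s` in an ascending factorization -/

/-- Telescoping writes z - t₁⋯t_k z as the sum of B(β_i, z) t₁⋯t_{i-1} β_i, up to the order in which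
the reflections are peeled off; ascent from u says that u makes each t₁⋯t_{i-1} β_i nonnegative. -/
lemma Ascends.rep_sub_nonpos {u : W} {l : List W} (hl : ∀ t ∈ l, cs.IsReflection t)
    (h : cs.Ascends u l) {z : B →₀ ℝ} (hz : ∀ t ∈ l, M.bil (cs.root t) z ≤ 0) :
    cs.rep u (z - cs.rep l.prod z) ≤ 0 := by
  induction l generalizing u with
  | nil => simp
  | cons t l ih =>
    have ht := hl t List.mem_cons_self
    have h1 := ih (fun t ht => hl t (List.mem_cons_of_mem _ ht)) h.2
      fun t ht => hz t (List.mem_cons_of_mem _ ht)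
    have h2 := (cs.length_lt_mul_iff ht).1 h.1
    have h3 : cs.rep u (z - cs.rep (t :: l).prod z) =
        M.bil (cs.root t) z • cs.rep u (cs.root t) + cs.rep (u * t) (z - cs.rep l.prod z) := by
      rw [List.prod_cons, rep_mul_apply, rep_mul_apply, map_sub (cs.rep t),
        cs.rep_reflection_apply ht z]
      simp only [map_sub, map_smul]; abel
    rw [h3]
    exact add_nonpos (smul_nonpos_of_nonpos_of_nonneg (hz t List.mem_cons_self) h2) h1

/-- Test with z = α_s - ϖ_s, for which z - cz = α_s. If s is not a letter, each s β_t stays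
positive, which says B(β_t, α_s) ≤ B(β_t, ϖ_s), that is B(β_t, z) ≤ 0. The telescoped sum then gives
u α_s ≤ 0. -/
lemma IsFactorization.simple_mem {γ : List B} {s : B} (hγ : (γ ++ [s]).Nodup) {l : List W}
    (h : cs.IsFactorization (γ ++ [s]) l) {u : W} (ha : cs.Ascends u l)
    (hu : ¬ cs.IsRightDescent u s) : cs.simple s ∈ l := by
  by_contra hs
  have hsγ : s ∉ γ := by
    rw [List.nodup_append] at hγ
    intro h; exact hγ.2.2 s h s (by simp) rfl
  obtain ⟨ϖ, hϖ⟩ := cs.exists_fundamental_weight s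
  have h1 : cs.rep (cs.wordProd γ) ϖ = ϖ := cs.rep_wordProd_eq_self fun j hj => by
    rw [hϖ, M.sroot_apply_of_ne]; rintro rfl; exact hsγ hj
  have h3 : cs.rep (cs.simple s) (M.sroot s - ϖ) = -ϖ := by
    rw [map_sub, rep_simple_sroot, rep_simple_apply, hϖ, M.sroot_apply_self]; module
  have h4 := ha.rep_sub_nonpos cs h.refl (z := M.sroot s - ϖ) fun t ht => by
    have h5 := cs.rep_simple_root_nonneg (h.refl t ht) (i := s) (fun h => hs (h ▸ ht)) s
    rw [rep_simple_apply_self, M.bil_comm] at h5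
    simp only [Finsupp.coe_zero, Pi.zero_apply] at h5
    rw [map_sub, hϖ]; linarith
  rw [h.prod_eq, wordProd_append, wordProd_singleton, rep_mul_apply, h3, map_neg, h1] at h4
  apply hu
  rw [isRightDescent_iff_rep]
  simpa using h4

/-- A positive root without s-coordinate pairs nonpositively with α_s, so acuteness leaves only
orthogonality. -/
lemma bil_sroot_eq_zero_of_acute {s : B} {t : W} (ht : cs.IsReflection t)
    (h0 : cs.root t s = 0) (h : 0 ≤ M.bil (M.sroot s) (cs.root t)) :
    t * cs.simple s = cs.simple s * t := by
  have hne : t ≠ cs.simple s := by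
    rintro rfl; rw [root_simple, M.sroot_apply_self] at h0; norm_num at h0
  rw [cs.mul_comm_iff_bil_eq_zero ht (cs.isReflection_simple s) hne, root_simple, M.bil_comm]
  exact le_antisymm (M.bil_sroot_nonpos (cs.root_nonneg ht) h0) h

/-- In an acute factorization the last letter of the word can be moved to the front. -/
lemma IsFactorization.move_front {γ : List B} {s : B} (hγ : (γ ++ [s]).Nodup) {l : List W}
    (h : cs.IsFactorization (γ ++ [s]) l) (hac : cs.Acute l) (hs : cs.simple s ∈ l) :
    ∃ l', cs.IsFactorization γ l' ∧ CommutationEquiv l (cs.simple s :: l'.map (cs.sconj s)) := by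
  obtain ⟨l₁, l₂, rfl⟩ := List.append_of_mem hs
  rw [nodup_append_singleton_iff] at hγ
  have h1 := h.remove_last cs
  -- Deleting s leaves a factorization of `γ` that still contains `l₁`, so the roots of `l₁` have no
  -- s-coordinate.
  have hcomm : ∀ t ∈ l₁, t * cs.simple s = cs.simple s * t := by
    intro t ht
    refine cs.bil_sroot_eq_zero_of_acute (h.refl t (by simp [ht]))
      (h1.root_apply_eq_zero cs hγ.1 (by simp [ht]) hγ.2) ?_
    rw [M.bil_comm, ← cs.root_simple s]
    exact (List.pairwise_append.1 hac).2.2 t ht _ (by simp)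
  refine ⟨_, h1, ?_⟩
  have : (l₁ ++ l₂.map (cs.sconj s)).map (cs.sconj s) = l₁ ++ l₂ := by
    rw [List.map_append, map_sconj_map_sconj]
    congr 1
    conv_rhs => rw [← List.map_id l₁]
    refine List.map_congr_left fun t ht => ?_
    rw [sconj_apply, ← hcomm t ht]; simp
  rw [this]
  exact commutationEquiv_move_front hcomm

lemma IsFactorization.move_back {γ : List B} {s : B} (hγ : (s :: γ).Nodup) {l : List W}
    (h : cs.IsFactorization (s :: γ) l) (hac : cs.Acute l) (hs : cs.simple s ∈ l) :
    ∃ l', CommutationEquiv l (l' ++ [cs.simple s]) := by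
  obtain ⟨l₁, l₂, rfl⟩ := List.append_of_mem hs
  rw [List.nodup_cons] at hγ
  have h1 := h.remove_first cs
  have hcomm : ∀ t ∈ l₂, t * cs.simple s = cs.simple s * t := by
    intro t ht
    refine cs.bil_sroot_eq_zero_of_acute (h.refl t (by simp [ht]))
      (h1.root_apply_eq_zero cs hγ.2 (by simp [ht]) hγ.1) ?_
    rw [← cs.root_simple s]
    exact (List.pairwise_cons.1 (List.pairwise_append.1 hac).2.1).1 t ht
  exact ⟨_, commutationEquiv_move_back hcomm⟩

lemma simple_not_mem_of_isFactorization {γ : List B} {s : B} (hγ : γ.Nodup) (hs : s ∉ γ)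
    {l : List W} (h : cs.IsFactorization γ l) : cs.simple s ∉ l := by
  intro hm
  have := h.root_apply_eq_zero cs hγ hm hs
  rw [root_simple, M.sroot_apply_self] at this
  norm_num at this

/-- Case `u α_s > 0`: peeling off the last letter. -/
lemma IsAcuteFactorization.peel {γ : List B} {s : B} (hγ : (γ ++ [s]).Nodup) {u : W} {l : List W}
    (h : cs.IsAcuteFactorization (γ ++ [s]) u l) (hu : ¬ cs.IsRightDescent u s) :
    ∃ l', cs.IsAcuteFactorization γ u l' ∧
      CommutationEquiv l (cs.simple s :: l'.map (cs.sconj s)) := by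
  obtain ⟨l', h1, h2⟩ := h.move_front cs hγ h.acute (h.simple_mem cs hγ h.ascends hu)
  have h3 := h.commutationEquiv cs h2
  rw [nodup_append_singleton_iff] at hγ
  have hs := cs.simple_not_mem_of_isFactorization hγ.1 hγ.2 h1
  refine ⟨l', ⟨h1, ?_, ?_⟩, h2⟩
  · exact (cs.acute_map_sconj h1.refl hs).1 (List.pairwise_cons.1 h3.acute).2
  · exact (cs.ascends_map_sconj h1.refl hs).1 h3.ascends.2

/-- The new front letter keeps the word acute because B(α_s, s β) = -B(α_s, β), which is nonnegative
for a positive root β supported away from s. -/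
lemma IsAcuteFactorization.unpeel {γ : List B} {s : B} (hγ : (γ ++ [s]).Nodup) {u : W} {l : List W}
    (h : cs.IsAcuteFactorization γ u l) (hu : ¬ cs.IsRightDescent u s) :
    cs.IsAcuteFactorization (γ ++ [s]) u (cs.simple s :: l.map (cs.sconj s)) := by
  rw [nodup_append_singleton_iff] at hγ
  have hs := cs.simple_not_mem_of_isFactorization hγ.1 hγ.2 h.toIsFactorization
  refine ⟨h.toIsFactorization.cons_sconj cs, List.pairwise_cons.2 ⟨fun t ht => ?_, ?_⟩, ?_, ?_⟩
  · obtain ⟨t, htl, rfl⟩ := List.mem_map.1 ht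
    clear ht
    rename' htl => ht
    have hr := h.refl t ht
    rw [sconj_apply, cs.root_conj_simple hr fun h => hs (h ▸ ht), root_simple,
      ← cs.bil_rep (cs.simple s), rep_simple_sroot, ← rep_mul_apply]
    have := M.bil_sroot_nonpos (cs.root_nonneg hr)
      (h.root_apply_eq_zero cs hγ.1 ht hγ.2)
    simpa using this
  · exact (cs.acute_map_sconj h.refl hs).2 h.acute
  · have := (cs.not_isRightDescent_iff).1 hu; lia
  · exact (cs.ascends_map_sconj h.refl hs).2 h.ascends

/-- If s were a letter it could be commuted to the front, and the first step, from u to us, would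
descend. -/
lemma IsAcuteFactorization.simple_not_mem {γ : List B} {s : B} (hγ : (γ ++ [s]).Nodup) {u : W}
    {l : List W} (h : cs.IsAcuteFactorization (γ ++ [s]) u l) (hu : cs.IsRightDescent u s) :
    cs.simple s ∉ l := by
  intro hm
  obtain ⟨l', -, h2⟩ := h.move_front cs hγ h.acute hm
  have h3 := (h.commutationEquiv cs h2).ascends.1
  rw [IsRightDescent] at hu
  lia

/-- Case `u α_s < 0`: rotating the word. -/
lemma IsAcuteFactorization.rotate {γ : List B} {s : B} (hγ : (γ ++ [s]).Nodup) {u : W} {l : List W}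
    (h : cs.IsAcuteFactorization (γ ++ [s]) u l) (hu : cs.IsRightDescent u s) :
    cs.IsAcuteFactorization (s :: γ) (u * cs.simple s) (l.map (cs.sconj s)) := by
  have hs := h.simple_not_mem cs hγ hu
  exact ⟨h.toIsFactorization.sconj_rotate cs, (cs.acute_map_sconj h.refl hs).2 h.acute,
    (cs.ascends_map_sconj h.refl hs).2 h.ascends⟩

/-- The point is that s is not a letter: commuted to the back, it would make the last step go up
from uγs to uγ, against the length hypothesis on uγs. -/
lemma IsAcuteFactorization.unrotate {γ : List B} {s : B} (hγ : (γ ++ [s]).Nodup) {u : W}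
    {l : List W} (h : cs.IsAcuteFactorization (s :: γ) (u * cs.simple s) l)
    (hu : cs.length (u * cs.wordProd (γ ++ [s])) = cs.length u + (γ ++ [s]).length) :
    cs.IsAcuteFactorization (γ ++ [s]) u (l.map (cs.sconj s)) := by
  have hγ' : (s :: γ).Nodup := by
    rw [nodup_append_singleton_iff] at hγ; exact List.nodup_cons.2 ⟨hγ.2, hγ.1⟩
  have hs : cs.simple s ∉ l := by
    intro hm
    obtain ⟨l', h2⟩ := h.move_back cs hγ' h.acute hm
    have h3 := h.commutationEquiv cs h2
    have h4 := h3.prod_eq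
    rw [List.prod_append, List.prod_singleton, wordProd_cons] at h4
    have h5 := ((cs.ascends_append _ _ _).1 h3.ascends).2.1
    have h6 : l'.prod = cs.simple s * cs.wordProd γ * cs.simple s := by rw [← h4]; simp
    rw [h6] at h5
    simp only [wordProd_append, wordProd_singleton, List.length_append, List.length_singleton] at hu
    simp only [mul_assoc, simple_mul_simple_cancel_left, simple_mul_simple_self, mul_one] at h5 hu
    have h7 := cs.length_mul_le u (cs.wordProd γ)
    have h8 := cs.length_wordProd_le γ
    lia
  have hs' : cs.simple s ∉ l.map (cs.sconj s) := by rwa [simple_mem_map_sconj]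
  have hr := cs.isReflection_map_sconj s h.refl
  refine ⟨h.toIsFactorization.sconj_rotate_back cs, (cs.acute_map_sconj h.refl hs).2 h.acute, ?_⟩
  rw [← cs.ascends_map_sconj hr hs', map_sconj_map_sconj]
  exact h.ascends

/-- Peeling shortens the word and rotating shortens u, so |γ| + ℓ(u) drops in either case. Both
moves can be undone. -/
theorem exists_isAcuteFactorization {γ : List B} (hγ : γ.Nodup) {u : W}
    (hu : cs.length (u * cs.wordProd γ) = cs.length u + γ.length) :
    ∃ l, cs.IsAcuteFactorization γ u l := by
  induction hn : γ.length + cs.length u generalizing γ u with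
  | zero =>
    obtain rfl : γ = [] := List.length_eq_zero_iff.1 (by lia)
    exact ⟨[], ⟨⟨by simp, by simp, rfl⟩, List.Pairwise.nil, trivial⟩⟩
  | succ n ih =>
    rcases List.eq_nil_or_concat γ with rfl | ⟨γ, s, rfl⟩
    · exact ⟨[], ⟨⟨by simp, by simp, rfl⟩, List.Pairwise.nil, trivial⟩⟩
    rw [List.concat_eq_append] at *
    simp only [List.length_append, List.length_singleton] at hn
    by_cases hd : cs.IsRightDescent u s
    · have h2 := (cs.isRightDescent_iff).1 hd
      have hγ' : (s :: γ).Nodup := by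
        rw [nodup_append_singleton_iff] at hγ; exact List.nodup_cons.2 ⟨hγ.2, hγ.1⟩
      obtain ⟨l, hl⟩ := ih hγ' (cs.length_of_rotate hu hd) (by simp only [List.length_cons]; lia)
      exact ⟨_, hl.unrotate cs hγ hu⟩
    · obtain ⟨l, hl⟩ := ih (nodup_append_singleton_iff.1 hγ).1 (cs.length_of_append hu) (by lia)
      exact ⟨_, hl.unpeel cs hγ hd⟩

/-- The descent status of s dictates whether to peel or to rotate, so both factorizations follow the
same recursion, down to the empty word. -/
theorem IsAcuteFactorization.unique {γ : List B} (hγ : γ.Nodup) {u : W} {l l' : List W}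
    (h : cs.IsAcuteFactorization γ u l) (h' : cs.IsAcuteFactorization γ u l') :
    CommutationEquiv l l' := by
  induction hn : γ.length + cs.length u generalizing γ u l l' with
  | zero =>
    obtain rfl : γ = [] := List.length_eq_zero_iff.1 (by lia)
    rw [List.length_eq_zero_iff.1 h.length_eq, List.length_eq_zero_iff.1 h'.length_eq]
    exact .refl _
  | succ n ih =>
    rcases List.eq_nil_or_concat γ with rfl | ⟨γ, s, rfl⟩
    · rw [List.length_eq_zero_iff.1 h.length_eq, List.length_eq_zero_iff.1 h'.length_eq]
      exact .refl _
    rw [List.concat_eq_append] at *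
    simp only [List.length_append, List.length_singleton] at hn
    by_cases hd : cs.IsRightDescent u s
    · have h2 := (cs.isRightDescent_iff).1 hd
      have hγ' : (s :: γ).Nodup := by
        rw [nodup_append_singleton_iff] at hγ; exact List.nodup_cons.2 ⟨hγ.2, hγ.1⟩
      have := (ih hγ' (h.rotate cs hγ hd) (h'.rotate cs hγ hd)
        (by simp only [List.length_cons]; lia)).map (cs.sconj s)
      rwa [map_sconj_map_sconj, map_sconj_map_sconj] at this
    · obtain ⟨k, hk, hlk⟩ := h.peel cs hγ hd
      obtain ⟨k', hk', hlk'⟩ := h'.peel cs hγ hd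
      have := ih (nodup_append_singleton_iff.1 hγ).1 hk hk' (by lia)
      exact hlk.trans (((this.map (cs.sconj s)).cons _).trans hlk'.symm)

end CoxeterSystem

namespace CoxeterSystem

open CoxeterMatrix

variable {B W : Type*} [Group W] {M : CoxeterMatrix B} (cs : CoxeterSystem M W)

/-! ### Classes of elements with a common acute factorization -/

/-- Sortability, defined by recursion on the word. -/
inductive RecSortable : List B → W → Prop
  | nil : RecSortable [] 1
  | take {s : B} {γ : List B} {w : W} (h : cs.IsLeftDescent w s)
      (h' : RecSortable (γ ++ [s]) (cs.simple s * w)) : RecSortable (s :: γ) w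
  | skip {s : B} {γ : List B} {w : W} (h : ¬ cs.IsLeftDescent w s)
      (h' : RecSortable γ w) : RecSortable (s :: γ) w

/-- `u` and `u'` have a common acute factorization. -/
def SameClass (γ : List B) (u u' : W) : Prop :=
  ∃ l, cs.IsAcuteFactorization γ u l ∧ cs.IsAcuteFactorization γ u' l

lemma SameClass.symm {γ : List B} {u u' : W} (h : cs.SameClass γ u u') : cs.SameClass γ u' u := by
  obtain ⟨l, h, h'⟩ := h; exact ⟨l, h', h⟩

lemma Ascends.bruhatLE {x : W} {l : List W} (hr : ∀ t ∈ l, cs.IsReflection t)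
    (h : cs.Ascends x l) (hl : cs.length (x * l.prod) = cs.length x + l.length) :
    cs.BruhatLE x (x * l.prod) := by
  induction l generalizing x with
  | nil => rw [List.prod_nil, mul_one]; exact Relation.ReflTransGen.refl
  | cons t l ih =>
    have h1 := h.1
    have h2 := h.2.length_le
    rw [List.prod_cons, ← mul_assoc] at hl ⊢
    simp only [List.length_cons] at hl
    have h3 : cs.length (x * t) = cs.length x + 1 := by lia
    exact Relation.ReflTransGen.head ⟨h3, t, hr t List.mem_cons_self, rfl⟩
      (ih (fun t ht => hr t (List.mem_cons_of_mem _ ht)) h.2 (by lia))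

variable [Finite W]

lemma SameClass.trans {γ : List B} (hγ : γ.Nodup) {u u' u'' : W} (h : cs.SameClass γ u u')
    (h' : cs.SameClass γ u' u'') : cs.SameClass γ u u'' := by
  obtain ⟨l, h1, h2⟩ := h
  obtain ⟨l', h3, h4⟩ := h'
  exact ⟨l, h1, h4.commutationEquiv cs (h3.unique cs hγ h2)⟩

/-- Here u is the length-additive product of um and m⁻¹, so any loss of length in m⁻¹c would already
show in uc. -/
lemma RightWeakLE.length_eq_add {c m u : W} {n : ℕ} (hc : cs.length c ≤ n)
    (hu : cs.length (u * c) = cs.length u + n) (h : cs.RightWeakLE m u⁻¹) :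
    cs.length (m⁻¹ * c) = cs.length m⁻¹ + n := by
  have h1 := h.length_add cs
  have h2 := cs.length_mul_le (m⁻¹ * u⁻¹)⁻¹ (m⁻¹ * c)
  have h3 : (m⁻¹ * u⁻¹)⁻¹ * (m⁻¹ * c) = u * c := by simp [mul_assoc]
  have h4 := cs.length_mul_le m⁻¹ c
  rw [h3, length_inv] at h2
  rw [length_inv] at *
  lia

/-- Every class contains a recursively sortable element below each of its members. -/
theorem exists_recSortable {γ : List B} (hγ : γ.Nodup) {u : W}
    (hu : cs.length (u * cs.wordProd γ) = cs.length u + γ.length) :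
    ∃ m, cs.RecSortable γ.reverse m ∧ cs.RightWeakLE m u⁻¹ ∧ cs.SameClass γ u m⁻¹ := by
  have hnil : ∀ u : W, ∃ m, cs.RecSortable ([] : List B).reverse m ∧ cs.RightWeakLE m u⁻¹ ∧
      cs.SameClass [] u m⁻¹ := by
    refine fun u => ⟨1, .nil, ?_, [], ?_, ?_⟩
    · intro t ht
      have := ht.2
      simp at this
    all_goals exact ⟨⟨by simp, by simp, rfl⟩, List.Pairwise.nil, trivial⟩
  induction hn : γ.length + cs.length u generalizing γ u with
  | zero =>
    obtain rfl : γ = [] := List.length_eq_zero_iff.1 (by lia)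
    exact hnil u
  | succ n ih =>
    rcases List.eq_nil_or_concat γ with rfl | ⟨γ, s, rfl⟩
    · exact hnil u
    rw [List.concat_eq_append] at *
    simp only [List.length_append, List.length_singleton] at hn
    rw [List.reverse_append, List.reverse_singleton, List.singleton_append]
    -- Inversion turns right descents of u into left descents of u⁻¹; rotating then matches `take`
    -- and peeling matches `skip`.
    by_cases hd : cs.IsRightDescent u s
    · have h2 := (cs.isRightDescent_iff).1 hd
      have hγ' : (s :: γ).Nodup := by
        rw [nodup_append_singleton_iff] at hγ; exact List.nodup_cons.2 ⟨hγ.2, hγ.1⟩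
      obtain ⟨m, hm, hmu, l, hl, hl'⟩ := ih hγ' (cs.length_of_rotate hu hd)
        (by simp only [List.length_cons]; lia)
      rw [mul_inv_rev, inv_simple] at hmu
      have hdu : ¬ cs.IsLeftDescent (cs.simple s * u⁻¹) s := by
        rw [← isLeftDescent_iff_not_isLeftDescent_mul, isLeftDescent_inv_iff]; exact hd
      have hdm : ¬ cs.IsLeftDescent m s := by
        intro h
        rw [← isLeftInversion_simple_iff_isLeftDescent] at h hdu
        exact hdu (hmu _ h)
      have hle : cs.RightWeakLE (cs.simple s * m) u⁻¹ := by
        simpa using hmu.simple_mul_up cs hdu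
      refine ⟨cs.simple s * m, .take ?_ ?_, hle, l.map (cs.sconj s), hl.unrotate cs hγ hu,
        IsAcuteFactorization.unrotate cs hγ ?_ ?_⟩
      · rw [isLeftDescent_iff_not_isLeftDescent_mul]; simpa using hdm
      · simpa using hm
      · simpa using hl'
      · exact hle.length_eq_add cs (cs.length_wordProd_le _) hu
    · obtain ⟨m, hm, hmu, l, hl, hl'⟩ := ih (nodup_append_singleton_iff.1 hγ).1
        (cs.length_of_append hu) (by lia)
      have hdm : ¬ cs.IsLeftDescent m s := by
        intro h
        rw [← isLeftDescent_inv_iff, ← isLeftInversion_simple_iff_isLeftDescent] at hd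
        rw [← isLeftInversion_simple_iff_isLeftDescent] at h
        exact hd (hmu _ h)
      exact ⟨m, .skip hdm hm, hmu, _, hl.unpeel cs hγ hd,
        hl'.unpeel cs hγ (by rwa [isRightDescent_inv_iff])⟩

lemma IsAcuteFactorization.peel_cons {γ : List B} {s : B} (hγ : (γ ++ [s]).Nodup) {u : W}
    {l : List W} (h : cs.IsAcuteFactorization (γ ++ [s]) u (cs.simple s :: l.map (cs.sconj s)))
    (hl : cs.IsFactorization γ l) : cs.IsAcuteFactorization γ u l := by
  rw [nodup_append_singleton_iff] at hγ
  have hs := cs.simple_not_mem_of_isFactorization hγ.1 hγ.2 hl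
  exact ⟨hl, (cs.acute_map_sconj hl.refl hs).1 (List.pairwise_cons.1 h.acute).2,
    (cs.ascends_map_sconj hl.refl hs).1 h.ascends.2⟩

/-- How a common acute factorization behaves under removal or rotation of the last letter. -/
lemma SameClass.cases_last {γ : List B} {s : B} (hγ : (γ ++ [s]).Nodup) {u u' : W}
    (h : cs.SameClass (γ ++ [s]) u u') :
    (cs.IsRightDescent u s ∧ cs.IsRightDescent u' s ∧
      cs.SameClass (s :: γ) (u * cs.simple s) (u' * cs.simple s)) ∨
    (¬ cs.IsRightDescent u s ∧ ¬ cs.IsRightDescent u' s ∧ cs.SameClass γ u u') := by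
  obtain ⟨l, h1, h2⟩ := h
  by_cases hd : cs.IsRightDescent u s <;> by_cases hd' : cs.IsRightDescent u' s
  · exact Or.inl ⟨hd, hd', _, h1.rotate cs hγ hd, h2.rotate cs hγ hd'⟩
  · exact absurd (h2.simple_mem cs hγ h2.ascends hd') (h1.simple_not_mem cs hγ hd)
  · exact absurd (h1.simple_mem cs hγ h1.ascends hd) (h2.simple_not_mem cs hγ hd')
  · obtain ⟨k, hk, hlk⟩ := h1.peel cs hγ hd
    exact Or.inr ⟨hd, hd', k, hk, (h2.commutationEquiv cs hlk).peel_cons cs hγ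
      hk.toIsFactorization⟩

/-- A class contains at most one recursively sortable element. -/
theorem RecSortable.eq_of_sameClass {γ : List B} (hγ : γ.Nodup) {w w' : W}
    (hw : cs.RecSortable γ.reverse w) (hw' : cs.RecSortable γ.reverse w')
    (h : cs.SameClass γ w⁻¹ w'⁻¹) : w = w' := by
  generalize hδ : γ.reverse = δ at hw hw'
  induction hw generalizing γ w' with
  | nil => cases hw'; rfl
  | @take s δ w hs hw ih =>
    obtain rfl : γ = δ.reverse ++ [s] := by rw [← List.reverse_reverse γ, hδ]; simp
    rcases h.cases_last cs hγ with ⟨h1, h2, h3⟩ | ⟨h1, h2, h3⟩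
    · rw [isRightDescent_inv_iff] at h1 h2
      cases hw' with
      | skip h' => exact absurd h2 h'
      | take h' hw' =>
        have hγ' : (s :: δ.reverse).Nodup := by
          rw [nodup_append_singleton_iff] at hγ; exact List.nodup_cons.2 ⟨hγ.2, hγ.1⟩
        exact mul_left_cancel (ih hγ' (by simpa using h3) (by simp) hw')
    · rw [isRightDescent_inv_iff] at h1; exact absurd hs h1
  | @skip s δ w hs hw ih =>
    obtain rfl : γ = δ.reverse ++ [s] := by rw [← List.reverse_reverse γ, hδ]; simp
    rcases h.cases_last cs hγ with ⟨h1, h2, h3⟩ | ⟨h1, h2, h3⟩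
    · rw [isRightDescent_inv_iff] at h1; exact absurd h1 hs
    · rw [isRightDescent_inv_iff] at h1 h2
      cases hw' with
      | take h' => exact absurd h' h2
      | skip h' hw' =>
        exact ih (nodup_append_singleton_iff.1 hγ).1 h3 (by simp) hw'

/-- Classes are convex in the weak order. -/
lemma ascends_convex {m w u p : W} (hmw : cs.RightWeakLE m w) (hwu : cs.RightWeakLE w u⁻¹)
    {l : List W} (hl : ∀ t ∈ l, cs.IsReflection t) (h1 : cs.Ascends (m⁻¹ * p) l)
    (h2 : cs.Ascends (u * p) l) : cs.Ascends (w⁻¹ * p) l := by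
  induction l generalizing p with
  | nil => trivial
  | cons t l ih =>
    have ht := hl t List.mem_cons_self
    have ih' := ih (p := p * t) (fun t ht => hl t (List.mem_cons_of_mem _ ht))
      (by simpa [mul_assoc] using h1.2) (by simpa [mul_assoc] using h2.2)
    refine ⟨?_, by simpa [mul_assoc] using ih'⟩
    have h3 := h1.1
    have h4 := h2.1
    rw [cs.length_lt_mul_iff ht, rep_mul_apply] at h3 h4 ⊢
    have hr := ht.conj p
    rcases cs.rep_root_nonneg_or_nonpos ht p with h5 | h5
    · rw [← cs.root_conj ht h5] at h4 ⊢
      by_contra hcon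
      rw [← cs.rep_root_nonpos_iff hr, ← cs.isLeftInversion_iff_rep hr] at hcon
      have := hwu _ hcon
      rw [cs.isLeftInversion_iff_rep hr, inv_inv, cs.rep_root_nonpos_iff hr] at this
      exact this h4
    · have h6 := cs.root_conj_neg ht h5
      have h7 : cs.rep p (cs.root t) = -cs.root (p * t * p⁻¹) := by rw [h6, neg_neg]
      rw [h7, map_neg, neg_nonneg] at h3 ⊢
      rw [← cs.isLeftInversion_iff_rep hr] at h3 ⊢
      exact hmw _ h3

lemma SameClass.convex {γ : List B} {m w u : W} (hmw : cs.RightWeakLE m w)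
    (hwu : cs.RightWeakLE w u⁻¹) (h : cs.SameClass γ u m⁻¹) : cs.SameClass γ w⁻¹ m⁻¹ := by
  obtain ⟨l, h1, h2⟩ := h
  refine ⟨l, ⟨h1.toIsFactorization, h1.acute, ?_⟩, h2⟩
  simpa using cs.ascends_convex (p := 1) hmw hwu h1.refl (by simpa using h2.ascends)
    (by simpa using h1.ascends)

/-! ### Comparison across a wall -/

/-- Compare the chain from x with its translate by q. Steps of the translate ascend as long as q is
not a left descent of the lower chain. If q first becomes one at x', exchange makes x' the translate
of its predecessor, and qx climbs to x' and on to the endpoint. -/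
lemma Ascends.cross_up {x : W} {q : B} {l : List W} (hl : ∀ t ∈ l, cs.IsReflection t)
    (hx : ¬ cs.IsLeftDescent x q) (h : cs.Ascends x l)
    (hlen : cs.length (x * l.prod) = cs.length x + l.length) :
    cs.Ascends (cs.simple q * x) l ∨ cs.BruhatLE (cs.simple q * x) (x * l.prod) := by
  induction l generalizing x with
  | nil => exact Or.inl trivial
  | cons t l ih =>
    have ht := hl t List.mem_cons_self
    have hl' : ∀ t ∈ l, cs.IsReflection t := fun t ht => hl t (List.mem_cons_of_mem _ ht)
    have h1 := h.1
    have h2 := h.2.length_le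
    rw [List.prod_cons, ← mul_assoc] at hlen ⊢
    simp only [List.length_cons] at hlen
    have hcov : cs.BruhatCover x (x * t) := ⟨by lia, t, ht, rfl⟩
    by_cases hd : cs.IsLeftDescent (x * t) q
    · right
      rw [← BruhatCover.eq_simple_mul cs hcov hx hd]
      exact h.2.bruhatLE cs hl' (by lia)
    · have h3 := (cs.not_isLeftDescent_iff).1 hx
      have h4 := (cs.not_isLeftDescent_iff).1 hd
      rcases ih hl' hd h.2 (by lia) with h5 | h5
      · left
        refine ⟨?_, by rwa [mul_assoc]⟩
        rw [mul_assoc]; lia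
      · right
        refine Relation.ReflTransGen.head ⟨?_, t, ht, rfl⟩ (by rwa [mul_assoc])
        rw [mul_assoc]; lia

/-- Now the translated chain is known to ascend. If the lower chain acquires the descent q, the
corresponding translated element loses it, while the translated endpoint has it. The lifting
property then puts the translated element below the untranslated endpoint. -/
lemma Ascends.cross_down {x : W} {q : B} {l : List W} (hl : ∀ t ∈ l, cs.IsReflection t)
    (hx : ¬ cs.IsLeftDescent x q) (h : cs.Ascends (cs.simple q * x) l)
    (hlen : cs.length (cs.simple q * x * l.prod) = cs.length (cs.simple q * x) + l.length)
    (hxl : ¬ cs.IsLeftDescent (x * l.prod) q) :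
    cs.Ascends x l ∨ cs.BruhatLE (cs.simple q * x) (x * l.prod) := by
  induction l generalizing x with
  | nil => exact Or.inl trivial
  | cons t l ih =>
    have ht := hl t List.mem_cons_self
    have hl' : ∀ t ∈ l, cs.IsReflection t := fun t ht => hl t (List.mem_cons_of_mem _ ht)
    have h1 := h.1
    have h2 := h.2.length_le
    rw [List.prod_cons, ← mul_assoc] at hlen hxl ⊢
    simp only [List.length_cons] at hlen
    have hcov : cs.BruhatCover (cs.simple q * x) (cs.simple q * x * t) := ⟨by lia, t, ht, rfl⟩
    have h3 := (cs.not_isLeftDescent_iff).1 hx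
    by_cases hd : cs.IsLeftDescent (x * t) q
    · right
      have hle := h.2.bruhatLE cs hl' (by lia)
      have hdesc : cs.IsLeftDescent (cs.simple q * (x * t * l.prod)) q := by
        rw [isLeftDescent_iff_not_isLeftDescent_mul]; simpa using hxl
      have hn : ¬ cs.IsLeftDescent (cs.simple q * x * t) q := by
        rw [mul_assoc, ← isLeftDescent_iff_not_isLeftDescent_mul]; exact hd
      have he : cs.simple q * x * t * l.prod = cs.simple q * (x * t * l.prod) := by
        simp only [mul_assoc]
      rw [he] at hle
      have := (BruhatLE.lift_down cs hle hdesc).2 hn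
      rw [simple_mul_simple_cancel_left] at this
      exact Relation.ReflTransGen.head hcov this
    · have h4 := (cs.not_isLeftDescent_iff).1 hd
      rw [mul_assoc] at h1
      have h6 := h.2
      rw [mul_assoc (cs.simple q)] at h6 hlen
      rcases ih hl' hd h6 (by rw [mul_assoc] at hcov; have := hcov.1; lia) hxl with h5 | h5
      · left
        exact ⟨by lia, h5⟩
      · right
        exact Relation.ReflTransGen.head hcov (by rwa [mul_assoc])

/-- Adjacent elements separated by a wall of the Bruhat interval lie in different classes. -/
theorem not_sameClass_of_bruhatLE {γ : List B} (hγ : γ.Nodup) {u : W} {q : B}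
    (hq : ¬ cs.IsLeftDescent u q)
    (hle : cs.BruhatLE (cs.simple q * u) (u * cs.wordProd γ)) :
    ¬ cs.SameClass γ u (cs.simple q * u) := by
  induction hn : γ.length + cs.length u generalizing γ u with
  | zero =>
    obtain rfl : γ = [] := List.length_eq_zero_iff.1 (by lia)
    have := BruhatLE.length_le cs hle
    have h1 := (cs.not_isLeftDescent_iff).1 hq
    simp at this; lia
  | succ n ih =>
    rcases List.eq_nil_or_concat γ with rfl | ⟨γ, s, rfl⟩
    · have := BruhatLE.length_le cs hle
      have h1 := (cs.not_isLeftDescent_iff).1 hq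
      simp at this; lia
    rw [List.concat_eq_append] at *
    simp only [List.length_append, List.length_singleton] at hn
    intro h
    obtain ⟨l, hl, hl'⟩ := id h
    have hu := hl.length_eq_add cs
    have hu₀ := cs.length_of_append hu
    have hdesc : cs.IsRightDescent (u * cs.wordProd (γ ++ [s])) s := by
      rw [IsRightDescent, hu, wordProd_append, wordProd_singleton]
      simp only [← mul_assoc, simple_mul_simple_cancel_right, List.length_append,
        List.length_singleton]
      lia
    have he : u * cs.wordProd (γ ++ [s]) * cs.simple s = u * cs.wordProd γ := by
      rw [wordProd_append, wordProd_singleton]; simp [← mul_assoc]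
    -- The Bruhat relation follows the same recursion as the class: right lifting at s yields the
    -- relation for us and sγ when rotating, and for u and γ when peeling. It fails for the empty
    -- word on length grounds.
    have hlift := BruhatLE.lift_down_right cs hle hdesc
    rw [he] at hlift
    have h1 := (cs.not_isLeftDescent_iff).1 hq
    rcases h.cases_last cs hγ with ⟨h2, h3, h4⟩ | ⟨h2, h3, h4⟩
    · have hγ' : (s :: γ).Nodup := by
        rw [nodup_append_singleton_iff] at hγ; exact List.nodup_cons.2 ⟨hγ.2, hγ.1⟩
      have h5 := (cs.isRightDescent_iff).1 h2
      have h6 := (cs.isRightDescent_iff).1 h3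
      refine ih hγ' (u := u * cs.simple s) ?_ ?_ (by simp only [List.length_cons]; lia) ?_
      · rw [not_isLeftDescent_iff, ← mul_assoc]; lia
      · have := hlift.1 h3
        simpa [wordProd_cons, mul_assoc] using this
      · rwa [← mul_assoc]
    · exact ih (nodup_append_singleton_iff.1 hγ).1 hq (hlift.2 h3) (by lia) h4

/-- The Bruhat relation is the only obstruction to carrying an acute factorization of u across the
wall. -/
lemma sameClass_of_not_bruhatLE {γ : List B} (hγ : γ.Nodup) {u : W} {q : B}
    (hq : ¬ cs.IsLeftDescent u q)
    (hu : cs.length (u * cs.wordProd γ) = cs.length u + γ.length)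
    (hle : ¬ cs.BruhatLE (cs.simple q * u) (u * cs.wordProd γ)) :
    cs.SameClass γ u (cs.simple q * u) := by
  obtain ⟨l, hl⟩ := cs.exists_isAcuteFactorization hγ hu
  refine ⟨l, hl, hl.toIsFactorization, hl.acute, ?_⟩
  refine (hl.ascends.cross_up cs hl.refl hq ?_).resolve_right ?_
  · rw [hl.prod_eq, hl.length_eq, hu]
  · rwa [hl.prod_eq]

/-- One shared acute factorization excludes the Bruhat relation, and that relation is the only way
in which an arbitrary ascending factorization can fail to cross, upwards or downwards. -/
lemma SameClass.ascends_iff_simple_mul {γ : List B} (hγ : γ.Nodup) {u : W} {q : B}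
    (hq : ¬ cs.IsLeftDescent u q) (h : cs.SameClass γ u (cs.simple q * u)) {l : List W}
    (hl : cs.IsFactorization γ l) : cs.Ascends u l ↔ cs.Ascends (cs.simple q * u) l := by
  have hle : ¬ cs.BruhatLE (cs.simple q * u) (u * cs.wordProd γ) := fun h' =>
    cs.not_sameClass_of_bruhatLE hγ hq h' h
  obtain ⟨k, hk, hk'⟩ := h
  have hu := hk.length_eq_add cs
  have hu' := hk'.length_eq_add cs
  constructor
  · intro ha
    refine (ha.cross_up cs hl.refl hq ?_).resolve_right ?_
    · rw [hl.prod_eq, hl.length_eq, hu]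
    · rwa [hl.prod_eq]
  · intro ha
    refine (ha.cross_down cs hl.refl hq ?_ ?_).resolve_right ?_
    · rw [hl.prod_eq, hl.length_eq, hu']
    · rw [hl.prod_eq, not_isLeftDescent_iff, ← mul_assoc, hu, hu']
      have := (cs.not_isLeftDescent_iff).1 hq
      lia
    · rwa [hl.prod_eq]

/-- Walk from u⁻¹ down to m along weak order covers; convexity keeps every intermediate element in
the class. -/
lemma SameClass.ascends_iff_of_rightWeakLE {γ : List B} (hγ : γ.Nodup) {u m : W}
    (hm : cs.RightWeakLE m u⁻¹) (h : cs.SameClass γ u m⁻¹) {l : List W}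
    (hl : cs.IsFactorization γ l) : cs.Ascends u l ↔ cs.Ascends m⁻¹ l := by
  induction hn : cs.length u using Nat.strong_induction_on generalizing u with
  | _ n ih =>
  subst hn
  by_cases hne : m = u⁻¹
  · rw [hne, inv_inv]
  obtain ⟨i, hi, hmi⟩ := hm.exists_descent cs hne
  rw [isRightDescent_inv_iff] at hi
  have he : (u⁻¹ * cs.simple i)⁻¹ = cs.simple i * u := by simp
  have hc := h.convex cs hmi (by
    have := (cs.isRightDescent_inv_iff).2 hi
    rw [isRightDescent_iff_not_isRightDescent_mul] at this
    simpa using cs.rightWeakLE_mul_simple this)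
  rw [he] at hc
  have hi' := (cs.isLeftDescent_iff_not_isLeftDescent_mul).1 hi
  rw [← ih _ hi (by simpa using hmi) hc rfl]
  have := (SameClass.ascends_iff_simple_mul cs hγ hi'
    (by simpa using hc.trans cs hγ (h.symm cs)) hl)
  simpa using this.symm

/-- Elements of a class have the same ascending factorizations. -/
theorem SameClass.ascends_iff {γ : List B} (hγ : γ.Nodup) {u u' : W} (h : cs.SameClass γ u u')
    {l : List W} (hl : cs.IsFactorization γ l) : cs.Ascends u l ↔ cs.Ascends u' l := by
  obtain ⟨k, hk, hk'⟩ := id h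
  obtain ⟨m, hm, hmu, hc⟩ := cs.exists_recSortable hγ (hk.length_eq_add cs)
  obtain ⟨m', hm', hmu', hc'⟩ := cs.exists_recSortable hγ (hk'.length_eq_add cs)
  have he : m = m' := hm.eq_of_sameClass cs hγ hm'
    (((hc.symm cs).trans cs hγ h).trans cs hγ hc')
  subst he
  rw [hc.ascends_iff_of_rightWeakLE cs hγ hmu hl, hc'.ascends_iff_of_rightWeakLE cs hγ hmu' hl]

end CoxeterSystem

namespace CoxeterSystem

open CoxeterMatrix

variable {B W : Type*} [Group W] {M : CoxeterMatrix B} (cs : CoxeterSystem M W)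

/-! ### Rank two intervals of the weak order -/

lemma reverse_alternatingWord (a b : B) (n : ℕ) :
    (alternatingWord a b n).reverse =
      if Even n then alternatingWord b a n else alternatingWord a b n := by
  induction n generalizing a b with
  | zero => simp [alternatingWord]
  | succ n ih =>
    rw [alternatingWord_succ, List.concat_eq_append, List.reverse_append, ih]
    by_cases h : Even n
    · have h' : ¬ Even (n + 1) := by simpa [Nat.even_add_one] using h
      simp only [h, h', if_true, if_false]
      rw [← List.concat_eq_append, ← alternatingWord_succ, alternatingWord_succ', if_pos h]
      simp
    · have h' : Even (n + 1) := by simpa [Nat.even_add_one] using h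
      simp only [h, h', if_true, if_false]
      rw [alternatingWord_succ' b a, if_neg h]
      simp

variable [Finite W]

lemma length_mul_alternatingWord {x : W} {a b : B} (hab : a ≠ b) (ha : ¬ cs.IsRightDescent x a)
    (hb : ¬ cs.IsRightDescent x b) {n : ℕ} (hn : n ≤ M a b) :
    cs.length (x * cs.wordProd (alternatingWord a b n)) = cs.length x + n := by
  induction n generalizing a b with
  | zero => simp [alternatingWord]
  | succ n ih =>
    have hn' : n < M b a := by rw [M.symmetric b a]; exact hn
    have h1 := ih hab.symm hb ha hn'.le
    obtain ⟨p, q, hp, hq, h⟩ := cs.rep_alternatingWord_sroot hab.symm hn'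
    have h2 : ¬ cs.IsRightDescent (x * cs.wordProd (alternatingWord b a n)) b := by
      rw [not_isRightDescent_iff_rep, rep_mul_apply, h, map_add, map_smul, map_smul]
      rw [not_isRightDescent_iff_rep] at ha hb
      exact add_nonneg (smul_nonneg hp hb) (smul_nonneg hq ha)
    rw [alternatingWord_succ, wordProd_concat, ← mul_assoc, (cs.not_isRightDescent_iff).1 h2, h1]
    ring

lemma length_alternatingWord_mul {y : W} {a b : B} (hab : a ≠ b) (ha : ¬ cs.IsLeftDescent y a)
    (hb : ¬ cs.IsLeftDescent y b) {n : ℕ} (hn : n ≤ M a b) :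
    cs.length (cs.wordProd (alternatingWord a b n) * y) = cs.length y + n := by
  rw [← isRightDescent_inv_iff] at ha hb
  rw [← length_inv, mul_inv_rev, ← wordProd_reverse, reverse_alternatingWord, ← cs.length_inv y]
  split_ifs
  · exact cs.length_mul_alternatingWord hab.symm hb ha (by rwa [M.symmetric b a])
  · exact cs.length_mul_alternatingWord hab ha hb hn

/-- An element with two left descents is the longest element of a dihedral parabolic subgroup
times an element without these descents. -/
lemma exists_eq_alternatingWord_mul {u : W} {a b : B} (hab : a ≠ b) (ha : cs.IsLeftDescent u a)
    (hb : cs.IsLeftDescent u b) :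
    ∃ y, u = cs.wordProd (alternatingWord a b (M a b)) * y ∧
      ¬ cs.IsLeftDescent y a ∧ ¬ cs.IsLeftDescent y b := by
  obtain ⟨x, n, i, j, hij, hu, hl, hxa, hxb⟩ := cs.exists_eq_mul_alternatingWord a b u⁻¹
  have hne : i ≠ j := by rcases hij with ⟨rfl, rfl⟩ | ⟨rfl, rfl⟩; exacts [hab, hab.symm]
  have hM : M i j = M a b := by
    rcases hij with ⟨rfl, rfl⟩ | ⟨rfl, rfl⟩; exacts [rfl, M.symmetric _ _]
  have hxi : ¬ cs.IsRightDescent x i := by rcases hij with ⟨rfl, rfl⟩ | ⟨rfl, rfl⟩ <;> assumption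
  have hxj : ¬ cs.IsRightDescent x j := by rcases hij with ⟨rfl, rfl⟩ | ⟨rfl, rfl⟩ <;> assumption
  have hui : cs.IsRightDescent u⁻¹ i := by
    rw [isRightDescent_inv_iff]; rcases hij with ⟨rfl, rfl⟩ | ⟨rfl, rfl⟩ <;> assumption
  have hn : n = M i j := by
    rcases lt_trichotomy n (M i j) with h | h | h
    · exfalso
      obtain ⟨p, q, hp, hq, h⟩ := cs.rep_alternatingWord_sroot hne h
      have : ¬ cs.IsRightDescent u⁻¹ i := by
        rw [not_isRightDescent_iff_rep, hu, rep_mul_apply, h, map_add, map_smul, map_smul]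
        rw [not_isRightDescent_iff_rep] at hxi hxj
        exact add_nonneg (smul_nonneg hp hxi) (smul_nonneg hq hxj)
      exact this hui
    · exact h
    · exfalso
      have h1 := cs.not_isReduced_alternatingWord i j (cs.coxeterMatrix_ne_zero i j) h
      have h2 := cs.length_wordProd_le (alternatingWord i j n)
      rw [IsReduced, length_alternatingWord] at h1
      rw [length_alternatingWord] at h2
      have h3 := cs.length_mul_le x (cs.wordProd (alternatingWord i j n))
      rw [← hu] at h3
      lia
  refine ⟨x⁻¹, ?_, by rwa [isLeftDescent_inv_iff], by rwa [isLeftDescent_inv_iff]⟩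
  have hbraid : cs.wordProd (alternatingWord a b (M a b)) =
      cs.wordProd (alternatingWord b a (M a b)) := by
    have := cs.wordProd_braidWord_eq a b
    rwa [braidWord, braidWord, M.symmetric b a] at this
  have h1 : u = (cs.wordProd (alternatingWord i j n))⁻¹ * x⁻¹ := by
    rw [← mul_inv_rev, ← hu, inv_inv]
  rw [h1, ← wordProd_reverse, reverse_alternatingWord, hn, hM]
  congr 1
  rcases hij with ⟨rfl, rfl⟩ | ⟨rfl, rfl⟩ <;> split_ifs <;> first | rfl | exact hbraid.symm

/-- If the top edge of one side of a polygon stays in a class, so do all but the top edges of the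
other side. -/
theorem sameClass_polygon {γ : List B} (hγ : γ.Nodup) {y : W} {a b : B} (hab : a ≠ b)
    (ha : ¬ cs.IsLeftDescent y a) (hb : ¬ cs.IsLeftDescent y b) {n : ℕ} (hn : n + 1 = M a b)
    (htop : cs.SameClass γ (cs.wordProd (alternatingWord b a n) * y)
      (cs.wordProd (alternatingWord b a (n + 1)) * y)) :
    cs.SameClass γ (cs.wordProd (alternatingWord a b n) * y) y := by
  have hba : n + 1 = M b a := by rw [M.symmetric b a]; exact hn
  set h : ℕ → W := fun k => cs.wordProd (alternatingWord a b k) with hh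
  set g : ℕ → W := fun k => cs.wordProd (alternatingWord b a k) with hg
  set z := y * cs.wordProd γ with hz
  have hhy : ∀ k ≤ n + 1, cs.length (h k * y) = cs.length y + k := fun k hk =>
    cs.length_alternatingWord_mul hab ha hb (hn ▸ hk)
  have hgy : ∀ k ≤ n + 1, cs.length (g k * y) = cs.length y + k := fun k hk =>
    cs.length_alternatingWord_mul hab.symm hb ha (hba ▸ hk)
  have hbraid : h (n + 1) = g (n + 1) := by
    have := cs.wordProd_braidWord_eq a b
    rwa [braidWord, braidWord, ← hn, ← hba] at this
  have hcγ := cs.length_wordProd_le γ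
  have htoplen : cs.length (g (n + 1) * z) = cs.length y + (n + 1) + γ.length := by
    obtain ⟨l, -, hl⟩ := htop
    have := hl.length_eq_add cs
    rw [hz, ← mul_assoc, this, hgy _ le_rfl]
  have hglen : ∀ k, cs.length (g k) ≤ k := fun k => by
    simpa using cs.length_wordProd_le (alternatingWord b a k)
  have hhlen : ∀ k, cs.length (h k) ≤ k := fun k => by
    simpa using cs.length_wordProd_le (alternatingWord a b k)
  have hzlen : cs.length z = cs.length y + γ.length := by
    have h1 := cs.length_mul_le (g (n + 1)) z
    have h2 := cs.length_mul_le y (cs.wordProd γ)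
    have := hglen (n + 1)
    lia
  have hg1 : ∀ k, g (k + 1) = h k * cs.simple a := fun k => by
    simp only [hg, hh, alternatingWord_succ, wordProd_concat]
  have hh1 : ∀ k, h (k + 1) = g k * cs.simple b := fun k => by
    simp only [hg, hh, alternatingWord_succ, wordProd_concat]
  -- The product at the top of the polygon already has the largest length possible, so `z` must have
  -- neither left descent and spans a full polygon of its own, parallel to that of `y`.
  have hza : ¬ cs.IsLeftDescent z a := by
    intro hd
    have h1 := cs.length_mul_le (h n) (cs.simple a * z)
    rw [← mul_assoc, ← hg1, htoplen] at h1
    rw [IsLeftDescent] at hd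
    have := hhlen n
    lia
  have hzb : ¬ cs.IsLeftDescent z b := by
    intro hd
    have h1 := cs.length_mul_le (g n) (cs.simple b * z)
    rw [← mul_assoc, ← hh1, hbraid, htoplen] at h1
    rw [IsLeftDescent] at hd
    have := hglen n
    lia
  have hhz : ∀ k ≤ n + 1, cs.length (h k * z) = cs.length z + k := fun k hk =>
    cs.length_alternatingWord_mul hab hza hzb (hn ▸ hk)
  have hgz : ∀ k ≤ n + 1, cs.length (g k * z) = cs.length z + k := fun k hk =>
    cs.length_alternatingWord_mul hab.symm hzb hza (hba ▸ hk)
  let e : ℕ → B := fun k => if Even k then b else a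
  have hhs : ∀ k, h (k + 1) = cs.simple (e k) * h k := fun k => by
    simp only [hh, alternatingWord_succ', wordProd_cons, e]
  have hgs : ∀ k, g (k + 1) = cs.simple (e (k + 1)) * g k := fun k => by
    simp only [hg, alternatingWord_succ', wordProd_cons, e, Nat.even_add_one]
    congr 2; split_ifs <;> rfl
  have hhe : ∀ k ≤ n, ¬ cs.IsLeftDescent (h k * y) (e k) := fun k hk => by
    rw [not_isLeftDescent_iff, ← mul_assoc, ← hhs, hhy _ (by lia), hhy _ (by lia)]; ring
  have hge : ∀ k ≤ n, ¬ cs.IsLeftDescent (g k * z) (e (k + 1)) := fun k hk => by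
    rw [not_isLeftDescent_iff, ← mul_assoc, ← hgs, hgz _ (by lia), hgz _ (by lia)]; ring
  have hge' : ∀ k ≤ n, cs.IsLeftDescent (g (k + 1) * z) (e (k + 1)) := fun k hk => by
    rw [hgs, mul_assoc, isLeftDescent_iff_not_isLeftDescent_mul, simple_mul_simple_cancel_left]
    exact hge k hk
  -- no element `h (k + 1) y` lies below `g k z`
  have hQ : ∀ k ≤ n, ¬ cs.BruhatLE (h (k + 1) * y) (g k * z) := by
    intro k hk
    -- Downward induction on k: the relation at k lifts to the relation at k + 1, and at k = n it
    -- contradicts the hypothesis on the top edge.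
    induction hd : n - k generalizing k with
    | zero =>
      obtain rfl : k = n := by lia
      intro hle
      have hgn : ¬ cs.IsLeftDescent (g k * y) (e (k + 1)) := by
        rw [not_isLeftDescent_iff, ← mul_assoc, ← hgs, hgy _ (by lia), hgy _ (by lia)]; ring
      refine cs.not_sameClass_of_bruhatLE hγ hgn ?_ ?_
      · rw [← mul_assoc, ← hgs, ← hbraid, mul_assoc (g k)]; exact hle
      · rw [← mul_assoc, ← hgs]; exact htop
    | succ d ih =>
      intro hle
      apply ih (k + 1) (by lia) (by lia)
      have := (BruhatLE.lift_up cs hle (hhe (k + 1) (by lia))).2 (hge k (by lia))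
      rwa [← mul_assoc, ← hhs, ← mul_assoc, ← hgs] at this
  -- Since h k z lies below g (k + 1) z, a relation here would place h (k + 1) y below g (k + 1) z;
  -- lifting by the next letter contradicts `hQ` at k + 1. At k = 0 it is `hQ` itself.
  have hP : ∀ k < n, ¬ cs.BruhatLE (h (k + 1) * y) (h k * z) := by
    intro k hk hle
    rcases Nat.eq_zero_or_pos k with rfl | hk0
    · exact hQ 0 (by lia) hle
    have hcov : cs.BruhatCover (h k * z) (g (k + 1) * z) := by
      refine ⟨by rw [hgz _ (by lia), hhz _ (by lia)]; ring, z⁻¹ * cs.simple a * z, ?_, ?_⟩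
      · simpa using (cs.isReflection_simple a).conj z⁻¹
      · rw [hg1]; simp [mul_assoc]
    have hle' : cs.BruhatLE (h (k + 1) * y) (g (k + 1) * z) := hle.tail hcov
    have := (BruhatLE.lift_up cs hle' (hhe (k + 1) hk)).1 (hge' k (by lia))
    rw [← mul_assoc, ← hhs] at this
    exact hQ (k + 1) hk this
  have hS : ∀ k ≤ n, cs.SameClass γ (h k * y) y := by
    intro k hk
    induction k with
    | zero =>
      have : h 0 * y = y := by simp [hh, alternatingWord]
      rw [this]
      obtain ⟨l, hl⟩ := cs.exists_isAcuteFactorization hγ hzlen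
      exact ⟨l, hl, hl⟩
    | succ k ih =>
      have h1 := cs.sameClass_of_not_bruhatLE hγ (hhe k (by lia))
        (by rw [mul_assoc, hhz _ (by lia), hhy _ (by lia), hzlen]; ring)
        (by rw [← mul_assoc, ← hhs, mul_assoc]; exact hP k hk)
      rw [← mul_assoc, ← hhs] at h1
      exact (h1.symm cs).trans cs hγ (ih (by lia))
  exact hS n le_rfl

/-- The sortable element of a class is the largest sortable element below each member. -/
theorem RecSortable.le_of_le {γ : List B} (hγ : γ.Nodup) {u m w : W}
    (hm : cs.RecSortable γ.reverse m) (hmu : cs.RightWeakLE m u⁻¹) (hc : cs.SameClass γ u m⁻¹)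
    (hw : cs.RecSortable γ.reverse w) (hwu : cs.RightWeakLE w u⁻¹) : cs.RightWeakLE w m := by
  induction hn : cs.length u using Nat.strong_induction_on generalizing u m with
  | _ n ih =>
  subst hn
  by_cases hne : m = u⁻¹
  · rwa [hne]
  by_cases hne' : w = u⁻¹
  · have : w = m := hw.eq_of_sameClass cs hγ hm (by rw [hne']; simpa using hc)
    rw [this]; exact RightWeakLE.refl cs m
  have hinv : ∀ i, (u⁻¹ * cs.simple i) = (cs.simple i * u)⁻¹ := fun i => by simp
  have hdown : ∀ i, cs.IsLeftDescent u i → cs.RightWeakLE (cs.simple i * u)⁻¹ u⁻¹ := fun i hi => by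
    rw [← isRightDescent_inv_iff, isRightDescent_iff_not_isRightDescent_mul] at hi
    rw [← hinv]
    simpa using cs.rightWeakLE_mul_simple hi
  obtain ⟨i, hi, hmi⟩ := hmu.exists_descent cs hne
  obtain ⟨j, hj, hwj⟩ := hwu.exists_descent cs hne'
  rw [isRightDescent_inv_iff] at hi hj
  rw [hinv] at hmi hwj
  have hci : cs.SameClass γ (cs.simple i * u) m⁻¹ := by
    simpa using hc.convex cs hmi (hdown i hi)
  rcases eq_or_ne i j with rfl | hij
  · exact ih _ hi hm hmi hci hwj rfl
  obtain ⟨l, hl, -⟩ := id hc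
  have hu := hl.length_eq_add cs
  have huj : cs.length (cs.simple j * u * cs.wordProd γ) =
      cs.length (cs.simple j * u) + γ.length := by
    simpa using (hdown j hj).length_eq_add cs (cs.length_wordProd_le _) hu
  obtain ⟨m', hm', hmu', hc'⟩ := cs.exists_recSortable hγ huj
  have hwm' := ih _ hj hm' hmu' hc' hwj rfl
  -- The case i ≠ j: u is the top of a polygon with bottom `y`. The edge at s_i u stays in a class,
  -- so s_j u and `y` share a class. Their common sortable element dominates w and lies below y⁻¹,
  -- hence below (s_i u)⁻¹, where the induction hypothesis compares w with m.
  obtain ⟨y, hy, hys⟩ : ∃ y, cs.SameClass γ (cs.simple j * u) y ∧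
      cs.RightWeakLE y⁻¹ (cs.simple i * u)⁻¹ := by
    obtain ⟨k, hk⟩ : ∃ k, k + 1 = M i j :=
      ⟨M i j - 1, by have := cs.coxeterMatrix_ne_zero i j; lia⟩
    have hk' : k + 1 = M j i := by rw [M.symmetric j i, hk]
    -- choose the names so that `s_i u` is on the side of `a`
    obtain ⟨a, b, hab, hai⟩ : ∃ a b, ((a = i ∧ b = j) ∨ (a = j ∧ b = i)) ∧
        (if Even k then a else b) = i := by
      by_cases hev : Even k
      · exact ⟨i, j, Or.inl ⟨rfl, rfl⟩, by simp [hev]⟩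
      · exact ⟨j, i, Or.inr ⟨rfl, rfl⟩, by simp [hev]⟩
    have hbj : (if Even k then b else a) = j := by
      rcases hab with ⟨rfl, rfl⟩ | ⟨rfl, rfl⟩ <;> split_ifs at hai ⊢ <;> simp_all
    have hne : a ≠ b := by rcases hab with ⟨rfl, rfl⟩ | ⟨rfl, rfl⟩; exacts [hij, hij.symm]
    have hM : k + 1 = M a b := by rcases hab with ⟨rfl, rfl⟩ | ⟨rfl, rfl⟩ <;> assumption
    have hMb : k + 1 = M b a := by rcases hab with ⟨rfl, rfl⟩ | ⟨rfl, rfl⟩ <;> assumption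
    have hua : cs.IsLeftDescent u a := by rcases hab with ⟨rfl, rfl⟩ | ⟨rfl, rfl⟩ <;> assumption
    have hub : cs.IsLeftDescent u b := by rcases hab with ⟨rfl, rfl⟩ | ⟨rfl, rfl⟩ <;> assumption
    obtain ⟨y, hu', hya, hyb⟩ := cs.exists_eq_alternatingWord_mul hne hua hub
    have hbraid : cs.wordProd (alternatingWord a b (k + 1)) =
        cs.wordProd (alternatingWord b a (k + 1)) := by
      have := cs.wordProd_braidWord_eq a b
      rwa [braidWord, braidWord, ← hM, ← hMb] at this
    rw [← hM] at hu'
    have hsi : cs.simple i * u = cs.wordProd (alternatingWord b a k) * y := by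
      rw [hu', hbraid, alternatingWord_succ', wordProd_cons, hai]; simp [mul_assoc]
    have hsj : cs.simple j * u = cs.wordProd (alternatingWord a b k) * y := by
      rw [hu', alternatingWord_succ', wordProd_cons, hbj]; simp [mul_assoc]
    refine ⟨y, ?_, ?_⟩
    · rw [hsj]
      refine cs.sameClass_polygon hγ hne hya hyb hM ?_
      rw [← hsi, ← hbraid, ← hu']
      exact hci.trans cs hγ (hc.symm cs)
    · rw [hsi, mul_inv_rev]
      apply cs.rightWeakLE_of_length_add
      rw [← mul_inv_rev, length_inv, length_inv, length_inv,
        cs.length_alternatingWord_mul hne.symm hyb hya (by lia)]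
      have := cs.length_alternatingWord_mul (y := 1) hne.symm (n := k)
        (cs.not_isLeftDescent_one _) (cs.not_isLeftDescent_one _) (by lia)
      simp only [mul_one, length_one] at this
      lia
  obtain ⟨l', -, hl'⟩ := id hy
  obtain ⟨m₀, hm₀, hmu₀, hc₀⟩ := cs.exists_recSortable hγ (hl'.length_eq_add cs)
  have he : m' = m₀ := hm'.eq_of_sameClass cs hγ hm₀
    (((hc'.symm cs).trans cs hγ hy).trans cs hγ hc₀)
  subst he
  exact ih _ hi hm hmi hci ((hwm'.trans cs hmu₀).trans cs hys) rfl

end CoxeterSystem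

namespace CoxeterMatrix

variable {B : Type*} (M : CoxeterMatrix B)

/-! ### The Euler form of a word -/

/-- The Euler form of a word: `E(α_i, α_j)` is `1` if `i = j`, the inner product if `i` precedes `j`
in the word, and `0` otherwise. -/
noncomputable def eform : List B → (B →₀ ℝ) → (B →₀ ℝ) → ℝ
  | [], _, _ => 0
  | s :: γ, y, x => y s * (x s + (γ.map fun j => x j * M.gram s j).sum) + eform γ y x

lemma eform_congr {γ : List B} {x x' y y' : B →₀ ℝ} (hx : ∀ j ∈ γ, x j = x' j)
    (hy : ∀ j ∈ γ, y j = y' j) : M.eform γ y x = M.eform γ y' x' := by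
  induction γ with
  | nil => rfl
  | cons s γ ih =>
    rw [eform, eform, ih (fun j hj => hx j (List.mem_cons_of_mem _ hj))
      (fun j hj => hy j (List.mem_cons_of_mem _ hj)), hx s List.mem_cons_self,
      hy s List.mem_cons_self]
    congr 4
    exact List.map_congr_left fun j hj => by rw [hx j (List.mem_cons_of_mem _ hj)]

lemma eform_append_singleton (γ : List B) (s : B) (y x : B →₀ ℝ) :
    M.eform (γ ++ [s]) y x =
      M.eform γ y x + (y s + (γ.map fun j => y j * M.gram j s).sum) * x s := by
  induction γ with
  | nil => simp [eform]
  | cons i γ ih =>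
    simp only [List.cons_append, eform, ih, List.map_append, List.map_cons, List.map_nil,
      List.sum_append, List.sum_cons, List.sum_nil]
    ring

lemma bil_sroot_eq_list_sum {γ : List B} (hγ : γ.Nodup) {x : B →₀ ℝ}
    (hx : ∀ j, j ∉ γ → x j = 0) (i : B) :
    M.bil (M.sroot i) x = (γ.map fun j => x j * M.gram i j).sum := by
  classical
  rw [bil_sroot_left, ← List.sum_toFinset _ hγ]
  refine Finsupp.sum_of_support_subset _ ?_ _ (by simp)
  intro j hj
  rw [List.mem_toFinset]
  by_contra h
  simp [hx j h] at hj

lemma list_sum_eq_of_nodup_cons {γ : List B} {s : B} (hγ : (s :: γ).Nodup) {x : B →₀ ℝ}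
    (hx : ∀ j, j ∉ s :: γ → x j = 0) :
    (γ.map fun j => x j * M.gram s j).sum = M.bil (M.sroot s) x - 2 * x s := by
  rw [M.bil_sroot_eq_list_sum hγ hx s, List.map_cons, List.sum_cons, gram_self]; ring

lemma eform_sroot_right {γ : List B} {s : B} (hγ : (s :: γ).Nodup) (y : B →₀ ℝ) :
    M.eform (s :: γ) y (M.sroot s) = y s := by
  have h : ∀ j ∈ γ, M.sroot s j = (0 : B →₀ ℝ) j := fun j hj => by
    rw [M.sroot_apply_of_ne]; rfl
    rintro rfl; exact (List.nodup_cons.1 hγ).1 hj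
  have h0 : ∀ (δ : List B) (y : B →₀ ℝ), M.eform δ y 0 = 0 := by
    intro δ y
    induction δ with
    | nil => rfl
    | cons i δ ih => simp [eform, ih]
  rw [eform, M.eform_congr h (fun _ _ => rfl) (y' := y), h0, M.sroot_apply_self,
    List.map_congr_left (g := fun _ => 0) fun j hj => by rw [h j hj]; simp]
  simp

lemma eform_add_eform {γ : List B} (hγ : γ.Nodup) {x y : B →₀ ℝ}
    (hx : ∀ j, j ∉ γ → x j = 0) (hy : ∀ j, j ∉ γ → y j = 0) :
    M.eform γ y x + M.eform γ x y = M.bil y x := by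
  induction γ generalizing x y with
  | nil =>
    have : x = 0 := Finsupp.ext fun j => hx j (by simp)
    simp [eform, this]
  | cons s γ ih =>
    obtain ⟨hs, hγ'⟩ := List.nodup_cons.1 hγ
    have key : ∀ v : B →₀ ℝ, (∀ j, j ∉ s :: γ → v j = 0) →
        (∀ j, j ∉ γ → (v - v s • M.sroot s) j = 0) ∧ ∀ j ∈ γ, v j = (v - v s • M.sroot s) j := by
      intro v hv
      refine ⟨fun j hj => ?_, fun j hj => ?_⟩
      · rcases eq_or_ne s j with rfl | hne
        · simp [M.sroot_apply_self]
        · simp [M.sroot_apply_of_ne hne, hv j (by simp [hj, hne.symm])]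
      · have hne : s ≠ j := by rintro rfl; exact hs hj
        simp [M.sroot_apply_of_ne hne]
    have h1 := ih hγ' (key x hx).1 (key y hy).1
    rw [eform, eform, M.eform_congr (key x hx).2 (key y hy).2,
      M.eform_congr (key y hy).2 (key x hx).2, M.list_sum_eq_of_nodup_cons hγ hx,
      M.list_sum_eq_of_nodup_cons hγ hy]
    simp only [map_sub, map_smul, LinearMap.sub_apply, LinearMap.smul_apply, bil_sroot_sroot,
      gram_self, smul_eq_mul, M.bil_comm y (M.sroot s)] at h1
    linarith

end CoxeterMatrix

/-! ### The Euler form and reflection factorizations -/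

namespace CoxeterSystem

open CoxeterMatrix

variable {B W : Type*} [Group W] {M : CoxeterMatrix B} (cs : CoxeterSystem M W)

/-- Moving s from the front to the back reverses its order relative to all other letters, and the
simple reflection compensates for this, as reflection functors do for quivers. -/
lemma eform_rotate {γ : List B} {s : B} (hγ : (s :: γ).Nodup) {x y : B →₀ ℝ}
    (hx : ∀ j, j ∉ s :: γ → x j = 0) (hy : ∀ j, j ∉ s :: γ → y j = 0) :
    M.eform (γ ++ [s]) (cs.rep (cs.simple s) y) (cs.rep (cs.simple s) x) = M.eform (s :: γ) y x := by
  have hs := (List.nodup_cons.1 hγ).1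
  have key : ∀ v : B →₀ ℝ, ∀ j ∈ γ, cs.rep (cs.simple s) v j = v j := fun v j hj =>
    cs.rep_simple_apply_of_ne s (by rintro rfl; exact hs hj) v
  rw [eform_append_singleton, M.eform_congr (key x) (key y), eform,
    M.list_sum_eq_of_nodup_cons hγ hx, rep_simple_apply_self, rep_simple_apply_self]
  have : (γ.map fun j => cs.rep (cs.simple s) y j * M.gram j s).sum =
      M.bil (M.sroot s) y - 2 * y s := by
    rw [← M.list_sum_eq_of_nodup_cons hγ hy]
    congr 1
    exact List.map_congr_left fun j hj => by rw [key y j hj, M.gram_comm]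
  rw [this]
  ring

lemma sub_rep_wordProd_apply {γ : List B} (z : B →₀ ℝ) {j : B} (hj : j ∉ γ) :
    (z - cs.rep (cs.wordProd γ) z) j = 0 := by
  induction γ with
  | nil => simp
  | cons s γ ih =>
    have hne : s ≠ j := fun h => hj (by simp [h])
    have := ih fun h => hj (List.mem_cons_of_mem _ h)
    rw [wordProd_cons, rep_mul_apply, Finsupp.sub_apply, cs.rep_simple_apply_of_ne s hne]
    exact this

/-- This identity ties E to the group element: pairing with a vector of the image of 1 - c is
computed by B. The last letter s is split off; y is divided into its part off s and its
s-coordinate, and only the latter meets the new term k α_s on the diagonal. -/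
lemma eform_sub_rep {γ : List B} (hγ : γ.Nodup) {y : B →₀ ℝ} (hy : ∀ j, j ∉ γ → y j = 0)
    (z : B →₀ ℝ) : M.eform γ y (z - cs.rep (cs.wordProd γ) z) = M.bil y z := by
  induction γ using List.reverseRecOn generalizing y z with
  | nil =>
    have : y = 0 := Finsupp.ext fun j => hy j (by simp)
    simp [eform, this]
  | append_singleton γ s ih =>
    obtain ⟨hγ', hs⟩ := nodup_append_singleton_iff.1 hγ
    have hne : ∀ j ∈ γ, s ≠ j := fun j hj => by rintro rfl; exact hs hj
    set y₀ := y - y s • M.sroot s with hy₀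
    have hy₀' : ∀ j, j ∉ γ → y₀ j = 0 := by
      intro j hj
      rcases eq_or_ne s j with rfl | hne
      · simp [hy₀, M.sroot_apply_self]
      · simp [hy₀, M.sroot_apply_of_ne hne, hy j (by simp [hj, hne.symm])]
    have hyy₀ : ∀ j ∈ γ, y j = y₀ j := fun j hj => by
      simp [hy₀, M.sroot_apply_of_ne (hne j hj)]
    set z' := cs.rep (cs.simple s) z with hz'
    set x₀ := z' - cs.rep (cs.wordProd γ) z' with hx₀
    set k := M.bil (M.sroot s) z with hk
    have hzz' : z' = z - k • M.sroot s := cs.rep_simple_apply s z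
    have h1 : z - cs.rep (cs.wordProd (γ ++ [s])) z = x₀ + k • M.sroot s := by
      rw [wordProd_append, wordProd_singleton, rep_mul_apply, ← hz', hx₀]
      rw [eq_sub_iff_add_eq] at hzz'
      rw [← hzz']; abel
    have h2 : x₀ s = 0 := cs.sub_rep_wordProd_apply z' hs
    have h3 := ih hγ' hy₀' z'
    have h4 : (γ.map fun j => y j * M.gram j s).sum = M.bil (M.sroot s) y₀ := by
      rw [M.bil_sroot_eq_list_sum hγ' hy₀' s]
      congr 1
      exact List.map_congr_left fun j hj => by rw [hyy₀ j hj, M.gram_comm]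
    rw [h1, eform_append_singleton,
      M.eform_congr (x' := x₀) (fun j hj => by simp [M.sroot_apply_of_ne (hne j hj)]) hyy₀, h3, h4]
    have h5 : y = y₀ + y s • M.sroot s := by rw [hy₀]; module
    have h6 : M.bil y z = M.bil y₀ z + y s * k := by
      conv_lhs => rw [h5]
      simp [hk]
    have h7 : M.bil y₀ z' = M.bil y₀ z - k * M.bil (M.sroot s) y₀ := by
      rw [hzz', map_sub, map_smul, smul_eq_mul, M.bil_comm y₀ (M.sroot s)]
    rw [h6, h7]
    simp only [Finsupp.coe_add, Finsupp.coe_smul, Pi.add_apply, Pi.smul_apply, h2,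
      M.sroot_apply_self, smul_eq_mul]
    ring

variable [Finite W]

lemma IsFactorization.root_not_mem_span {γ : List B} (hγ : γ.Nodup) {k l₂ : List W} {t : W}
    (h : cs.IsFactorization γ (k ++ t :: l₂)) :
    cs.root t ∉ Submodule.span ℝ (cs.root '' {t' | t' ∈ k}) := by
  intro hmem
  have := cs.finite_index
  have h1 := finrank_supported (γ := γ) hγ
  rw [h.span_eq cs hγ, ← h.length_eq] at h1
  have h2 : Submodule.span ℝ (cs.root '' {t' | t' ∈ k ++ t :: l₂}) ≤
      Submodule.span ℝ (cs.root '' {t' | t' ∈ k ++ l₂}) := by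
    rw [Submodule.span_le]
    rintro _ ⟨t', ht', rfl⟩
    rcases List.mem_append.1 ht' with h' | h'
    · exact Submodule.subset_span ⟨t', List.mem_append_left _ h', rfl⟩
    rcases List.mem_cons.1 h' with rfl | h'
    · exact Submodule.span_mono (Set.image_mono fun x hx => List.mem_append_left _ hx) hmem
    · exact Submodule.subset_span ⟨t', List.mem_append_right _ h', rfl⟩
  have h3 := (Submodule.finrank_mono h2).trans (finrank_span_image_le cs.root (k ++ l₂))
  rw [h1] at h3
  simp at h3

/-- The last letter t contributes B(β_t, z) β_t, while all else lies in the span of the preceding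
roots. Independence forces the coefficient to vanish, so t fixes z and can be dropped. -/
lemma IsFactorization.bil_eq_zero_of_sub_rep_mem {γ : List B} (hγ : γ.Nodup) {k l₂ l₃ : List W}
    (h : cs.IsFactorization γ (k ++ l₂ ++ l₃)) {z : B →₀ ℝ}
    (hz : z - cs.rep (k ++ l₂).prod z ∈ Submodule.span ℝ (cs.root '' {t | t ∈ k})) :
    ∀ t ∈ l₂, M.bil (cs.root t) z = 0 := by
  induction l₂ using List.reverseRecOn generalizing l₃ with
  | nil => simp
  | append_singleton l t ih =>
    have ht : cs.IsReflection t := h.refl t (by simp)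
    have hkl : ∀ t' ∈ k ++ l, cs.IsReflection t' := fun t' ht' => h.refl t' (by
      simp only [List.mem_append] at ht' ⊢; tauto)
    have hns := (IsFactorization.root_not_mem_span cs hγ (k := k ++ l) (t := t) (l₂ := l₃)
      (by simpa using h))
    have h1 : z - cs.rep (k ++ (l ++ [t])).prod z =
        (cs.rep t z - cs.rep (k ++ l).prod (cs.rep t z)) +
          M.bil (cs.root t) z • cs.root t := by
      rw [← List.append_assoc, List.prod_append, List.prod_singleton, rep_mul_apply,
        cs.rep_reflection_apply ht z]
      abel
    have hmono : Submodule.span ℝ (cs.root '' {t | t ∈ k}) ≤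
        Submodule.span ℝ (cs.root '' {t | t ∈ k ++ l}) :=
      Submodule.span_mono (Set.image_mono fun x hx => List.mem_append_left _ hx)
    have h2 : M.bil (cs.root t) z • cs.root t ∈
        Submodule.span ℝ (cs.root '' {t | t ∈ k ++ l}) := by
      have h3 := Submodule.sub_mem _ (hmono hz) (cs.sub_rep_prod_mem_span hkl (cs.rep t z))
      rwa [h1, add_sub_cancel_left] at h3
    have h0 : M.bil (cs.root t) z = 0 := by
      by_contra hne
      exact hns ((Submodule.smul_mem_iff _ hne).1 h2)
    have hfix : cs.rep t z = z := by rw [cs.rep_reflection_apply ht, h0]; simp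
    rw [h1, hfix, h0, zero_smul, add_zero] at hz
    have hih := ih (l₃ := t :: l₃) (by simpa using h) hz
    intro t' ht'
    rcases List.mem_append.1 ht' with hl | hl
    · exact hih t' hl
    · rw [List.mem_singleton.1 hl, h0]

/-- The roots of a factorization form an exceptional sequence for the Euler form. -/
lemma IsFactorization.pairwise_eform {γ : List B} (hγ : γ.Nodup) {l : List W}
    (h : cs.IsFactorization γ l) :
    l.Pairwise fun t t' => M.eform γ (cs.root t') (cs.root t) = 0 := by
  suffices H : ∀ l₁ l₂ : List W, l = l₁ ++ l₂ →
      l₂.Pairwise fun t t' => M.eform γ (cs.root t') (cs.root t) = 0 from H [] l rfl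
  intro l₁ l₂ hl
  induction l₂ generalizing l₁ with
  | nil => exact List.Pairwise.nil
  | cons t l₂ ih =>
    refine List.pairwise_cons.2 ⟨fun t' ht' => ?_, ih (l₁ ++ [t]) (by simp [hl])⟩
    have hsupp : ∀ t'' ∈ l, ∀ j, j ∉ γ → cs.root t'' j = 0 := fun t'' ht'' j hj =>
      h.root_apply_eq_zero cs hγ ht'' hj
    -- With (1 - c)z = β_t, the Euler pairing becomes B(β_t', z). Since (1 - c)z lies in the span of
    -- the roots up to t, the form vanishes on every later letter.
    obtain ⟨z, hz⟩ := cs.exists_sub_rep_eq hγ (hsupp t (by simp [hl]))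
    rw [← hz, cs.eform_sub_rep hγ (hsupp t' (by simp [hl, ht']))]
    have hl' : l = (l₁ ++ [t]) ++ l₂ ++ [] := by simp [hl]
    refine IsFactorization.bil_eq_zero_of_sub_rep_mem cs hγ (hl' ▸ h) ?_ t' ht'
    have : ((l₁ ++ [t]) ++ l₂).prod = cs.wordProd γ := by rw [← h.prod_eq, hl]; simp
    rw [this, hz]
    exact Submodule.subset_span ⟨t, by simp, rfl⟩

end CoxeterSystem

namespace CoxeterSystem

open CoxeterMatrix

variable {B W : Type*} [Group W] {M : CoxeterMatrix B} (cs : CoxeterSystem M W)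

/-! ### Sorting words -/

lemma getElem?_rotate (γ : List B) (s : B) (n : ℕ) :
    (s :: γ)[(n + 1) % (s :: γ).length]? = (γ ++ [s])[n % (γ ++ [s]).length]? := by
  have h1 : (γ ++ [s]).length = γ.length + 1 := by simp
  rw [List.length_cons, h1]
  have hlt := Nat.mod_lt n (Nat.succ_pos γ.length)
  rcases eq_or_ne (n % (γ.length + 1)) γ.length with h | h
  · have h2 : (n + 1) % (γ.length + 1) = 0 := by rw [Nat.add_mod, h]; simp
    rw [h2, h]; simp
  · have h2 : (n + 1) % (γ.length + 1) = n % (γ.length + 1) + 1 := by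
      rw [Nat.add_mod_eq_ite, if_neg]
      all_goals
        rcases Nat.eq_zero_or_pos γ.length with h0 | h0
        · simp [h0] at h; lia
        · rw [Nat.mod_eq_of_lt (show 1 < γ.length + 1 by lia)]
          try lia
    rw [h2, List.getElem?_cons_succ, List.getElem?_append_left (by lia)]

lemma eq_map_succ_or_of_pairwise_lt {p : List ℕ} (hp : p.Pairwise (· < ·)) :
    ∃ p' : List ℕ, p = p'.map Nat.succ ∨ p = 0 :: p'.map Nat.succ := by
  have key : ∀ q : List ℕ, (∀ n ∈ q, 0 < n) → ∃ p' : List ℕ, q = p'.map Nat.succ := by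
    intro q hq
    refine ⟨q.map Nat.pred, ?_⟩
    rw [List.map_map]
    exact (List.map_id q).symm.trans (List.map_congr_left fun n hn =>
      (Nat.succ_pred_eq_of_pos (hq n hn)).symm)
  cases p with
  | nil => exact ⟨[], .inl rfl⟩
  | cons n q =>
    have h := (List.pairwise_cons.1 hp).1
    obtain ⟨p', hp'⟩ := key q fun m hm => lt_of_le_of_lt (Nat.zero_le n) (h m hm)
    cases n with
    | zero => exact ⟨p', .inr (by rw [hp'])⟩
    | succ n => exact ⟨n :: p', .inl (by rw [hp']; rfl)⟩

lemma lex_map_succ_iff {p q : List ℕ} :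
    List.Lex (· < ·) (p.map Nat.succ) (q.map Nat.succ) ↔ List.Lex (· < ·) p q := by
  induction p generalizing q with
  | nil => cases q <;> simp
  | cons a p ih =>
    cases q with
    | nil => simp
    | cons b q => 
      have ih' : p.map Nat.succ < q.map Nat.succ ↔ p < q := ih
      simp [List.cons_lt_cons_iff, ih']

lemma pairwise_lt_map_succ_iff {p : List ℕ} :
    (p.map Nat.succ).Pairwise (· < ·) ↔ p.Pairwise (· < ·) := by
  simp [List.pairwise_map]

lemma isReducedSubword_map_succ_iff {γ : List B} {s : B} {w : W} {p : List ℕ} {ω : List B} :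
    cs.IsReducedSubword (s :: γ) w (p.map Nat.succ) ω ↔ cs.IsReducedSubword (γ ++ [s]) w p ω := by
  have h : (p.map Nat.succ).map (fun n => (s :: γ)[n % (s :: γ).length]?) =
      p.map (fun n => (γ ++ [s])[n % (γ ++ [s]).length]?) := by
    rw [List.map_map]
    exact List.map_congr_left fun n _ => getElem?_rotate γ s n
  rw [IsReducedSubword, IsReducedSubword, pairwise_lt_map_succ_iff, h]

lemma isReducedWordFor_cons_iff {s : B} {ω : List B} {w : W} :
    cs.IsReducedWordFor (s :: ω) w ↔
      cs.IsLeftDescent w s ∧ cs.IsReducedWordFor ω (cs.simple s * w) := by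
  constructor
  · rintro ⟨h, rfl⟩
    have h' : cs.IsReduced ω := h.drop 1
    rw [wordProd_cons]
    refine ⟨?_, h', by simp⟩
    have h1 : cs.length (cs.wordProd (s :: ω)) = ω.length + 1 := h
    have h2 : cs.length (cs.wordProd ω) = ω.length := h'
    rw [IsLeftDescent, simple_mul_simple_cancel_left, ← wordProd_cons]
    lia
  · rintro ⟨h1, h2, h3⟩
    have h4 : cs.wordProd (s :: ω) = w := by rw [wordProd_cons, h3]; simp
    refine ⟨?_, h4⟩
    have h5 := (cs.isLeftDescent_iff).1 h1
    have h6 : cs.length (cs.wordProd ω) = ω.length := h2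
    rw [h3] at h6
    rw [IsReduced, h4, List.length_cons]
    lia

lemma isReducedSubword_zero_cons_iff {γ : List B} {s : B} {w : W} {p : List ℕ} {Ω : List B} :
    cs.IsReducedSubword (s :: γ) w (0 :: p.map Nat.succ) Ω ↔ cs.IsLeftDescent w s ∧
      ∃ ω, Ω = s :: ω ∧ cs.IsReducedSubword (γ ++ [s]) (cs.simple s * w) p ω := by
  constructor
  · rintro ⟨h1, h2, h3⟩
    cases Ω with
    | nil => simp at h2
    | cons i ω =>
      rw [List.map_cons, List.map_cons] at h2
      obtain ⟨h4, h5⟩ := List.cons_eq_cons.1 h2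
      obtain rfl : s = i := by simpa using h4
      obtain ⟨h6, h7⟩ := (cs.isReducedWordFor_cons_iff).1 h3
      refine ⟨h6, ω, rfl, (cs.isReducedSubword_map_succ_iff).1 ⟨?_, h5, h7⟩⟩
      exact (List.pairwise_cons.1 h1).2
  · rintro ⟨h, ω, rfl, h'⟩
    obtain ⟨h1, h2, h3⟩ := (cs.isReducedSubword_map_succ_iff).2 h'
    refine ⟨List.pairwise_cons.2 ⟨by simp, h1⟩, ?_, (cs.isReducedWordFor_cons_iff).2 ⟨h, h3⟩⟩
    rw [List.map_cons, List.map_cons, h2]; simp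

/-- A reduced word can start with s exactly when s is a left descent, and the lexicographically
first one then must use position 0; the rest is a sorting word for the rotated word. -/
lemma IsSortingWord.cons_of_isLeftDescent {γ : List B} {s : B} {w : W} {p : List ℕ} {ω : List B}
    (hs : cs.IsLeftDescent w s) (h : cs.IsSortingWord (γ ++ [s]) (cs.simple s * w) p ω) :
    cs.IsSortingWord (s :: γ) w (0 :: p.map Nat.succ) (s :: ω) := by
  refine ⟨(cs.isReducedSubword_zero_cons_iff).2 ⟨hs, ω, rfl, h.1⟩, fun P Ω hP hlex => ?_⟩
  obtain ⟨p', rfl | rfl⟩ := eq_map_succ_or_of_pairwise_lt hP.1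
  · cases p' with
    | nil =>
      obtain ⟨-, h2, -, h3⟩ := hP
      obtain rfl : Ω = [] := by simpa using h2.symm
      rw [wordProd_nil] at h3
      subst h3
      exact cs.not_isLeftDescent_one s hs
    | cons n p' => simp [List.cons_lt_cons_iff] at hlex
  · obtain ⟨-, ω', rfl, hp'⟩ := (cs.isReducedSubword_zero_cons_iff).1 hP
    refine h.2 p' ω' hp' (lex_map_succ_iff.1 ?_)
    simpa [List.cons_lt_cons_iff] using hlex

lemma IsSortingWord.of_not_isLeftDescent {γ : List B} {s : B} {w : W} {p : List ℕ} {ω : List B}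
    (hs : ¬ cs.IsLeftDescent w s) (h : cs.IsSortingWord (γ ++ [s]) w p ω) :
    cs.IsSortingWord (s :: γ) w (p.map Nat.succ) ω := by
  refine ⟨(cs.isReducedSubword_map_succ_iff).2 h.1, fun P Ω hP hlex => ?_⟩
  obtain ⟨p', rfl | rfl⟩ := eq_map_succ_or_of_pairwise_lt hP.1
  · exact h.2 p' Ω ((cs.isReducedSubword_map_succ_iff).1 hP) (lex_map_succ_iff.1 hlex)
  · exact hs ((cs.isReducedSubword_zero_cons_iff).1 hP).1

lemma isSortingWord_one (γ : List B) : cs.IsSortingWord γ 1 [] [] :=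
  ⟨⟨List.Pairwise.nil, rfl, by simp [IsReducedWordFor, IsReduced]⟩, fun _ _ _ => by simp⟩

lemma IsSortingWord.unique {γ : List B} {w : W} {p p' : List ℕ} {ω ω' : List B}
    (h : cs.IsSortingWord γ w p ω) (hs : cs.IsSortingWord γ w p' ω') : p = p' ∧ ω = ω' := by
  have hp : p = p' := by
    rcases lt_trichotomy p p' with hlt | rfl | hlt
    · exact absurd hlt (hs.2 p ω h.1)
    · rfl
    · exact absurd hlt (h.2 p' ω' hs.1)
  subst hp
  exact ⟨rfl, List.map_injective_iff.2 (Option.some_injective B) (h.1.2.1.symm.trans hs.1.2.1)⟩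

/-- Induction along the letters of the infinite word `γγγ⋯`. -/
theorem sorting_induction {P : List B → W → Prop} (one : ∀ γ, P γ 1)
    (take : ∀ s γ w, (s :: γ).Nodup → (∀ i, i ∈ s :: γ) → cs.IsLeftDescent w s →
      P (γ ++ [s]) (cs.simple s * w) → P (s :: γ) w)
    (pass : ∀ s γ w, (s :: γ).Nodup → (∀ i, i ∈ s :: γ) → ¬ cs.IsLeftDescent w s →
      P (γ ++ [s]) w → P (s :: γ) w)
    {γ : List B} (hγ : γ.Nodup) (hfull : ∀ i, i ∈ γ) (w : W) : P γ w := by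
  induction hn : cs.length w using Nat.strong_induction_on generalizing γ w with
  | _ n ih =>
  by_cases hw : w = 1
  · rw [hw]; exact one γ
  obtain ⟨i, hi⟩ := cs.exists_leftDescent_of_ne_one hw
  obtain ⟨l₁, l₂, rfl⟩ := List.append_of_mem (hfull i)
  have step : ∀ s γ, (s :: γ).Nodup → (∀ i, i ∈ s :: γ) → cs.IsLeftDescent w s →
      P (s :: γ) w := fun s γ h1 h2 hs =>
    take s γ w h1 h2 hs (ih _ (hn ▸ hs) ((List.perm_append_singleton s γ).nodup_iff.2 h1)
      (fun j => (List.perm_append_singleton s γ).mem_iff.2 (h2 j)) _ rfl)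
  clear ih
  -- The length need not drop while nondescents are passed over; the prefix before the known descent
  -- `i` gets shorter instead.
  induction l₁ generalizing l₂ with
  | nil => exact step i l₂ hγ hfull hi
  | cons s l₁ ih =>
    by_cases hs : cs.IsLeftDescent w s
    · exact step s _ hγ hfull hs
    · have hperm := List.perm_append_singleton s (l₁ ++ i :: l₂)
      refine pass s _ w hγ hfull hs ?_
      have := ih (l₂ ++ [s]) (by simpa using hperm.nodup_iff.2 hγ)
        (fun j => by simpa using hperm.mem_iff.2 (hfull j))
      simpa using this

lemma exists_isSortingWord {γ : List B} (hγ : γ.Nodup) (hfull : ∀ i, i ∈ γ) (w : W) :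
    ∃ p ω, cs.IsSortingWord γ w p ω := by
  refine cs.sorting_induction (P := fun γ w => ∃ p ω, cs.IsSortingWord γ w p ω)
    (fun γ => ⟨[], [], cs.isSortingWord_one γ⟩) ?_ ?_ hγ hfull w
  · rintro s γ w - - hs ⟨p, ω, h⟩
    exact ⟨_, _, h.cons_of_isLeftDescent cs hs⟩
  · rintro s γ w - - hs ⟨p, ω, h⟩
    exact ⟨_, _, h.of_not_isLeftDescent cs hs⟩

lemma isSortingWord_cons_iff_of_isLeftDescent {γ : List B} {s : B} (hγ : (s :: γ).Nodup)
    (hfull : ∀ i, i ∈ s :: γ) {w : W} (hs : cs.IsLeftDescent w s) {P : List ℕ} {Ω : List B} :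
    cs.IsSortingWord (s :: γ) w P Ω ↔ ∃ p ω, P = 0 :: p.map Nat.succ ∧ Ω = s :: ω ∧
      cs.IsSortingWord (γ ++ [s]) (cs.simple s * w) p ω := by
  have hperm := List.perm_append_singleton s γ
  constructor
  · intro h
    obtain ⟨p, ω, h'⟩ := cs.exists_isSortingWord (hperm.nodup_iff.2 hγ)
      (fun i => hperm.mem_iff.2 (hfull i)) (cs.simple s * w)
    obtain ⟨h1, h2⟩ := h.unique cs (h'.cons_of_isLeftDescent cs hs)
    exact ⟨p, ω, h1, h2, h'⟩
  · rintro ⟨p, ω, rfl, rfl, h⟩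
    exact h.cons_of_isLeftDescent cs hs

lemma isSortingWord_cons_iff_of_not_isLeftDescent {γ : List B} {s : B} (hγ : (s :: γ).Nodup)
    (hfull : ∀ i, i ∈ s :: γ) {w : W} (hs : ¬ cs.IsLeftDescent w s) {P : List ℕ} {Ω : List B} :
    cs.IsSortingWord (s :: γ) w P Ω ↔ ∃ p, P = p.map Nat.succ ∧
      cs.IsSortingWord (γ ++ [s]) w p Ω := by
  have hperm := List.perm_append_singleton s γ
  constructor
  · intro h
    obtain ⟨p, ω, h'⟩ := cs.exists_isSortingWord (hperm.nodup_iff.2 hγ)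
      (fun i => hperm.mem_iff.2 (hfull i)) w
    obtain ⟨h1, rfl⟩ := h.unique cs (h'.of_not_isLeftDescent cs hs)
    exact ⟨p, h1, h'⟩
  · rintro ⟨p, rfl, h⟩
    exact h.of_not_isLeftDescent cs hs

end CoxeterSystem

namespace CoxeterSystem

open CoxeterMatrix

variable {B W : Type*} [Group W] {M : CoxeterMatrix B} (cs : CoxeterSystem M W)

/-! ### Sortable elements -/

/-- As the letters of γ are distinct, a letter in a given copy is the same as a position, and nested
copies mean closure of the positions under subtracting |γ|. The empty word has no letters at all. -/
lemma lettersInCopy_antitone_iff {γ : List B} (hγ : γ.Nodup) (p : List ℕ) :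
    Antitone (lettersInCopy γ p) ↔ ∀ n, n + γ.length ∈ p → n ∈ p := by
  rcases Nat.eq_zero_or_pos γ.length with h0 | hpos
  · obtain rfl := List.length_eq_zero_iff.1 h0
    simp only [List.length_nil, add_zero, imp_self, implies_true, iff_true]
    rintro a b - i ⟨n, -, -, hn⟩
    simp at hn
  constructor
  · intro h n hn
    have hlt := Nat.mod_lt n hpos
    have hg : γ[n % γ.length]? = some γ[n % γ.length] := List.getElem?_eq_getElem hlt
    obtain ⟨m, hm, hm1, hm2⟩ := h (Nat.le_succ (n / γ.length))
      (show γ[n % γ.length] ∈ _ from ⟨n + γ.length, hn, by simp [Nat.add_div_right _ hpos],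
        by simp [hg]⟩)
    have hlt' := Nat.mod_lt m hpos
    rw [List.getElem?_eq_getElem hlt', Option.some_inj, hγ.getElem_inj_iff] at hm2
    have : m = n := by rw [← Nat.div_add_mod m γ.length, hm1, hm2, Nat.div_add_mod]
    exact this ▸ hm
  · intro h
    refine antitone_nat_of_succ_le fun k => ?_
    rintro i ⟨n, hn, hk, hi⟩
    have hle : γ.length ≤ n := by
      by_contra hlt
      rw [Nat.div_eq_of_lt (by lia)] at hk
      lia
    refine ⟨n - γ.length, h _ (by rwa [Nat.sub_add_cancel hle]), ?_, ?_⟩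
    · rw [← Nat.sub_add_cancel hle, Nat.add_div_right _ hpos] at hk
      lia
    · rw [← Nat.sub_add_cancel hle, Nat.add_mod_right] at hi
      exact hi

lemma RecSortable.one (γ : List B) : cs.RecSortable γ 1 := by
  induction γ with
  | nil => exact .nil
  | cons s γ ih => exact .skip (cs.not_isLeftDescent_one s) ih

lemma RecSortable.exists_word {γ : List B} {w : W} (h : cs.RecSortable γ w) :
    ∃ ω : List B, (∀ i ∈ ω, i ∈ γ) ∧ cs.wordProd ω = w := by
  induction h with
  | nil => exact ⟨[], by simp⟩
  | @take s γ w hs _ ih =>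
    obtain ⟨ω, h1, h2⟩ := ih
    refine ⟨s :: ω, ?_, by rw [wordProd_cons, h2]; simp⟩
    intro i hi
    rcases List.mem_cons.1 hi with rfl | hi
    · simp
    · simpa [or_comm] using h1 i hi
  | @skip s γ w hs _ ih =>
    obtain ⟨ω, h1, h2⟩ := ih
    exact ⟨ω, fun i hi => List.mem_cons_of_mem _ (h1 i hi), h2⟩

lemma recSortable_cons_iff_of_isLeftDescent {γ : List B} {s : B} {w : W}
    (hs : cs.IsLeftDescent w s) :
    cs.RecSortable (s :: γ) w ↔ cs.RecSortable (γ ++ [s]) (cs.simple s * w) := by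
  refine ⟨fun h => ?_, .take hs⟩
  cases h with
  | take _ h => exact h
  | skip h _ => exact absurd hs h

lemma recSortable_cons_iff_of_not_isLeftDescent {γ : List B} {s : B} {w : W}
    (hs : ¬ cs.IsLeftDescent w s) : cs.RecSortable (s :: γ) w ↔ cs.RecSortable γ w := by
  refine ⟨fun h => ?_, .skip hs⟩
  cases h with
  | take h _ => exact absurd h hs
  | skip _ h => exact h

lemma filter_append_singleton_eq {γ : List B} {s : B} (hs : s ∉ γ) {A A' : B → Bool}
    (h : ∀ i, A' i ↔ A i ∧ i ≠ s) : (γ ++ [s]).filter A' = γ.filter A := by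
  have h1 : ¬ A' s := fun h' => ((h s).1 h').2 rfl
  rw [List.filter_append, List.filter_cons_of_neg h1, List.filter_nil, List.append_nil]
  refine List.filter_congr fun i hi => Bool.eq_iff_iff.2 ((h i).trans (and_iff_left ?_))
  rintro rfl; exact hs hi

lemma IsReducedSubword.mem_letters_iff {γ : List B} {w : W} {p : List ℕ} {ω : List B}
    (h : cs.IsReducedSubword γ w p ω) {i : B} :
    i ∈ ω ↔ ∃ n ∈ p, γ[n % γ.length]? = some i := by
  have : i ∈ ω ↔ some i ∈ ω.map some := by simp
  rw [this, ← h.2.1, List.mem_map]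

lemma mem_of_periodic {p : List ℕ} {k : ℕ} (h : ∀ n, n + k ∈ p → n ∈ p) {n : ℕ} (hn : n ∈ p) :
    n % k ∈ p := by
  have : ∀ j m, m + j * k ∈ p → m ∈ p := by
    intro j
    induction j with
    | zero => intro m hm; simpa using hm
    | succ j ih => intro m hm; exact ih m (h _ (by rwa [add_mul, one_mul, ← add_assoc] at hm))
  exact this (n / k) _ (by rwa [mul_comm, Nat.mod_add_div])

variable [Finite W]

/-- Without the letter s, the element w⁻¹ cannot alter the s-coordinate 1 of α_s, so it cannot make
α_s negative. -/
lemma RecSortable.mem_of_isLeftDescent {γ : List B} {w : W} (h : cs.RecSortable γ w) {s : B}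
    (hs : cs.IsLeftDescent w s) : s ∈ γ := by
  obtain ⟨ω, h1, rfl⟩ := h.exists_word cs
  by_contra hmem
  have h2 := cs.sub_rep_wordProd_apply (γ := ω.reverse) (M.sroot s) (j := s)
    (fun h => hmem (h1 s (List.mem_reverse.1 h)))
  rw [isLeftDescent_iff_rep, ← wordProd_reverse] at hs
  have h3 := hs s
  rw [Finsupp.sub_apply, M.sroot_apply_self] at h2
  simp only [Finsupp.coe_zero, Pi.zero_apply] at h3
  linarith

-- A sortable element that skips s never uses it again, so its recursion continues with a shorter
-- word, whereas its sorting word still runs through all rotated letters. The predicate `A` of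
-- letters still allowed reconciles the two.
open Classical in
theorem exists_periodic_isSortingWord_iff {γ : List B} (hγ : γ.Nodup) (hfull : ∀ i, i ∈ γ)
    (w : W) (A : B → Prop) :
    (∃ p ω, cs.IsSortingWord γ w p ω ∧ (∀ n, n + γ.length ∈ p → n ∈ p) ∧ ∀ i ∈ ω, A i) ↔
      cs.RecSortable (γ.filter fun i => A i) w := by
  refine cs.sorting_induction (P := fun γ w => ∀ A : B → Prop,
    (∃ p ω, cs.IsSortingWord γ w p ω ∧ (∀ n, n + γ.length ∈ p → n ∈ p) ∧ ∀ i ∈ ω, A i) ↔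
      cs.RecSortable (γ.filter fun i => A i) w) ?_ ?_ ?_ hγ hfull w A
  · intro γ A
    exact ⟨fun _ => .one cs _, fun _ => ⟨[], [], cs.isSortingWord_one γ, by simp, by simp⟩⟩
  · intro s γ w hnd hfull hs ih A
    by_cases hA : A s
    · rw [List.filter_cons_of_pos (by simpa using hA),
        cs.recSortable_cons_iff_of_isLeftDescent hs]
      have h1 : (γ ++ [s]).filter (fun i => decide (A i)) =
          γ.filter (fun i => decide (A i)) ++ [s] := by
        rw [List.filter_append, List.filter_cons_of_pos (by simpa using hA), List.filter_nil]
      rw [← h1, ← ih A]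
      have hlen : (γ ++ [s]).length = (s :: γ).length := by simp
      rw [hlen]
      constructor
      · rintro ⟨P, Ω, hP, h2, h3⟩
        obtain ⟨p, ω, rfl, rfl, h⟩ :=
          (cs.isSortingWord_cons_iff_of_isLeftDescent hnd hfull hs).1 hP
        refine ⟨p, ω, h, fun n hn => ?_, fun i hi => h3 i (List.mem_cons_of_mem _ hi)⟩
        have := h2 (n + 1) (by
          rw [add_right_comm]
          exact List.mem_cons_of_mem _ (List.mem_map.2 ⟨_, hn, rfl⟩))
        simpa using this
      · rintro ⟨p, ω, h, h2, h3⟩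
        refine ⟨_, _, h.cons_of_isLeftDescent cs hs, fun n hn => ?_, fun i hi => ?_⟩
        · cases n with
          | zero => simp
          | succ n =>
            rw [add_right_comm] at hn
            have := h2 n (by simpa using hn)
            simpa using this
        · rcases List.mem_cons.1 hi with rfl | hi
          · exact hA
          · exact h3 i hi
    · refine iff_of_false ?_ ?_
      · rintro ⟨P, Ω, hP, -, h3⟩
        obtain ⟨p, ω, rfl, rfl, h⟩ :=
          (cs.isSortingWord_cons_iff_of_isLeftDescent hnd hfull hs).1 hP
        exact hA (h3 s List.mem_cons_self)
      · intro h
        have := h.mem_of_isLeftDescent cs hs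
        simp [hA] at this
  · intro s γ w hnd hfull hs ih A
    have hsγ := (List.nodup_cons.1 hnd).1
    have h1 : cs.RecSortable ((s :: γ).filter fun i => A i) w ↔
        cs.RecSortable (γ.filter fun i => A i) w := by
      by_cases hA : A s
      · rw [List.filter_cons_of_pos (by simpa using hA),
          cs.recSortable_cons_iff_of_not_isLeftDescent hs]
      · rw [List.filter_cons_of_neg (by simpa using hA)]
    have ihA := ih fun i => A i ∧ i ≠ s
    rw [filter_append_singleton_eq hsγ (A := fun i => decide (A i)) (fun i => by simp)] at ihA
    rw [h1, ← ihA]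
    have hlen : (γ ++ [s]).length = γ.length + 1 := by simp
    constructor
    · rintro ⟨P, Ω, hP, h2, h3⟩
      obtain ⟨p, rfl, h⟩ :=
        (cs.isSortingWord_cons_iff_of_not_isLeftDescent hnd hfull hs).1 hP
      have h4 : ∀ n, n + (γ ++ [s]).length ∈ p → n ∈ p := fun n hn => by
        rw [hlen] at hn
        have := h2 (n + 1) (by
          rw [List.length_cons, add_right_comm]
          exact List.mem_map.2 ⟨_, hn, rfl⟩)
        simpa using this
      refine ⟨p, Ω, h, h4, fun i hi => ⟨h3 i hi, ?_⟩⟩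
      rintro rfl
      obtain ⟨n, hn, hn'⟩ := (h.1.mem_letters_iff cs).1 hi
      -- Any use of the skipped letter descends by periodicity to position |γ| of the rotated word.
      -- This is one period after position 0 of the original word, which is unused.
      have h5 := mem_of_periodic h4 hn
      have h6 : n % (γ ++ [i]).length = γ.length := by
        have hlt := Nat.mod_lt n (show 0 < (γ ++ [i]).length by simp)
        by_contra hne
        rw [List.getElem?_append_left (by lia)] at hn'
        exact hsγ (List.mem_of_getElem? hn')
      rw [h6] at h5
      have := h2 0 (by simpa using h5)
      simp at this
    · rintro ⟨p, ω, h, h2, h3⟩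
      refine ⟨_, _, h.of_not_isLeftDescent cs hs, fun n hn => ?_, fun i hi => (h3 i hi).1⟩
      cases n with
      | zero =>
        exfalso
        have h5 : γ.length ∈ p := by simpa using hn
        refine (h3 s ((h.1.mem_letters_iff cs).2 ⟨_, h5, ?_⟩)).2 rfl
        rw [hlen, Nat.mod_eq_of_lt (Nat.lt_succ_self _)]
        simp
      | succ n =>
        rw [List.length_cons, add_right_comm] at hn
        have := h2 n (by rw [hlen]; simpa using hn)
        simpa using this

/-- For a full word, sortability agrees with recursive sortability. -/
theorem isSortable_iff_recSortable {γ : List B} (hγ : γ.Nodup) (hfull : ∀ i, i ∈ γ) (w : W) :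
    cs.IsSortable γ w ↔ cs.RecSortable γ w := by
  have := cs.exists_periodic_isSortingWord_iff hγ hfull w (fun _ => True)
  simp only [decide_true, List.filter_true, implies_true, and_true] at this
  rw [← this]
  simp only [IsSortable, lettersInCopy_antitone_iff hγ]

end CoxeterSystem

lemma CoxeterMatrix.eform_neg_right {B : Type*} (M : CoxeterMatrix B) (γ : List B)
    (y x : B →₀ ℝ) : M.eform γ y (-x) = - M.eform γ y x := by
  induction γ with
  | nil => simp [eform]
  | cons i γ ih =>
    have h : (γ.map fun j => (-x) j * M.gram i j).sum = -(γ.map fun j => x j * M.gram i j).sum := by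
      rw [← neg_one_mul, ← List.sum_map_mul_left]
      simp
    rw [eform, eform, ih, h]
    simp only [Finsupp.coe_neg, Pi.neg_apply]
    ring

namespace CoxeterSystem

open CoxeterMatrix

variable {B W : Type*} [Group W] {M : CoxeterMatrix B} (cs : CoxeterSystem M W)

/-! ### The inversion sequence of the sorting word of the long element -/

lemma leftInvSeq_cons (s : B) (ω : List B) :
    cs.leftInvSeq (s :: ω) =
      cs.simple s :: (cs.leftInvSeq ω).map fun t => cs.simple s * t * cs.simple s := by
  simp only [leftInvSeq, List.cons.injEq, true_and]
  exact List.map_congr_left fun t _ => by simp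

lemma isReflection_conj_simple {t : W} (ht : cs.IsReflection t) (i : B) :
    cs.IsReflection (cs.simple i * t * cs.simple i) := by
  simpa using ht.conj (cs.simple i)

lemma not_isLeftDescent_simple_mul {w : W} {s : B} (h : cs.IsLeftDescent w s) :
    ¬ cs.IsLeftDescent (cs.simple s * w) s := by
  rw [IsLeftDescent, simple_mul_simple_cancel_left]
  exact not_lt_of_gt h

lemma rep_simple_root_apply_eq_zero {γ : List B} {s : B} {x : B →₀ ℝ}
    (hx : ∀ j, j ∉ s :: γ → x j = 0) : ∀ j, j ∉ s :: γ → cs.rep (cs.simple s) x j = 0 :=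
  fun j hj => by
    rw [cs.rep_simple_apply_of_ne s (by rintro rfl; simp at hj)]; exact hx j hj

variable [Finite W]

lemma mem_leftInvSeq_of_isLeftInversion {ω : List B} {t : W}
    (ht : cs.IsLeftInversion (cs.wordProd ω) t) : t ∈ cs.leftInvSeq ω := by
  induction ω generalizing t with
  | nil => have := ht.2; simp at this
  | cons s ω ih =>
    rw [leftInvSeq_cons]
    by_cases hne : t = cs.simple s
    · simp [hne]
    · rw [wordProd_cons, cs.isLeftInversion_simple_mul ht.1 hne] at ht
      exact List.mem_cons_of_mem _ (List.mem_map.2 ⟨_, ih ht, by simp [mul_assoc]⟩)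

lemma IsReducedWordFor.mem_leftInvSeq_iff {ω : List B} {w t : W} (h : cs.IsReducedWordFor ω w) :
    t ∈ cs.leftInvSeq ω ↔ cs.IsLeftInversion w t := by
  obtain ⟨h, rfl⟩ := h
  exact ⟨cs.isLeftInversion_of_mem_leftInvSeq h, cs.mem_leftInvSeq_of_isLeftInversion⟩

lemma ncard_isLeftInversion (w : W) : {t | cs.IsLeftInversion w t}.ncard = cs.length w := by
  classical
  obtain ⟨ω, h1, rfl⟩ := cs.exists_isReduced w
  have h : {t | cs.IsLeftInversion (cs.wordProd ω) t} = ((cs.leftInvSeq ω).toFinset : Set W) := by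
    ext t
    simp [IsReducedWordFor.mem_leftInvSeq_iff cs ⟨h1, rfl⟩]
  rw [h, Set.ncard_coe_finset, List.toFinset_card_of_nodup h1.nodup_leftInvSeq,
    length_leftInvSeq, h1.eq]

lemma isLongElement_iff {w : W} :
    cs.IsLongElement w ↔ ∀ t, cs.IsReflection t → cs.IsLeftInversion w t := by
  have h0 : {t | cs.IsLeftInversion w t} ⊆ {t | cs.IsReflection t} := fun t ht => ht.1
  have h1 : Nat.card {t : W // cs.IsReflection t} = {t | cs.IsReflection t}.ncard := rfl
  rw [IsLongElement, h1, ← cs.ncard_isLeftInversion]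
  constructor
  · intro h t ht
    have := Set.eq_of_subset_of_ncard_le h0 h.ge (Set.toFinite _)
    exact this.symm.subset ht
  · intro h
    rw [Set.Subset.antisymm h0 h]

/-- An element of maximal length has every simple reflection as a left descent, so its inverse
negates all simple roots and hence all positive roots. -/
lemma exists_isLongElement : ∃ w, cs.IsLongElement w := by
  obtain ⟨w, hw⟩ := Finite.exists_max cs.length
  refine ⟨w, (cs.isLongElement_iff).2 fun t ht => ?_⟩
  have h : ∀ i, cs.rep w⁻¹ (M.sroot i) ≤ 0 := fun i => by
    rw [← isLeftDescent_iff_rep]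
    by_contra h
    have h1 := (cs.not_isLeftDescent_iff).1 h
    have h2 := hw (cs.simple i * w)
    lia
  rw [cs.isLeftInversion_iff_rep ht]
  have h1 : cs.root t = (cs.root t).sum fun i a => a • M.sroot i := by
    conv_lhs => rw [← Finsupp.sum_single (cs.root t)]
    exact Finsupp.sum_congr fun i _ => by simp [sroot]
  rw [h1, map_finsuppSum]
  refine Finset.sum_nonpos fun i _ => ?_
  simp only [map_smul]
  exact smul_nonpos_of_nonneg_of_nonpos (cs.root_nonneg ht i) (h i)

lemma IsLongElement.unique {w w' : W} (h : cs.IsLongElement w) (h' : cs.IsLongElement w') :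
    w = w' :=
  RightWeakLE.antisymm cs (fun t ht => (cs.isLongElement_iff).1 h' t ht.1)
    fun t ht => (cs.isLongElement_iff).1 h t ht.1

/-- The inversions of `w` are supported on `γ`, and the Euler form pairs them nonpositively with the
noninversions supported on `γ`. -/
structure EulerSeparated (γ : List B) (w : W) : Prop where
  apply_eq_zero : ∀ t, cs.IsLeftInversion w t → ∀ j, j ∉ γ → cs.root t j = 0
  eform_nonpos : ∀ t t', cs.IsLeftInversion w t → cs.IsReflection t' →
    (∀ j, j ∉ γ → cs.root t' j = 0) → ¬ cs.IsLeftInversion w t' →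
    M.eform γ (cs.root t) (cs.root t') ≤ 0

/-- Removing s from w and rotating the word preserves separation because E is invariant under
`eform_rotate`. Only the pairing with the new noninversion s is not inherited. -/
lemma EulerSeparated.take {γ : List B} {s : B} (hγ : (s :: γ).Nodup) {w : W}
    (hs : cs.IsLeftDescent w s) (h : cs.EulerSeparated (s :: γ) w) :
    cs.EulerSeparated (γ ++ [s]) (cs.simple s * w) := by
  have hmem : ∀ j, j ∉ s :: γ ↔ j ∉ γ ++ [s] := fun j => by simp [or_comm]
  have hmul : ∀ t, cs.IsLeftInversion (cs.simple s * w) t → t ≠ cs.simple s := by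
    rintro t ht rfl
    exact cs.not_isLeftDescent_simple_mul hs ((cs.isLeftInversion_simple_iff_isLeftDescent _ _).1 ht)
  have hroot : ∀ t, cs.IsReflection t → t ≠ cs.simple s →
      cs.root t = cs.rep (cs.simple s) (cs.root (cs.simple s * t * cs.simple s)) := by
    intro t ht hne
    rw [cs.root_conj_simple ht hne, ← rep_mul_apply]; simp
  have hsupp : ∀ t, cs.IsLeftInversion (cs.simple s * w) t → ∀ j, j ∉ s :: γ → cs.root t j = 0 := by
    intro t ht
    rw [hroot t ht.1 (hmul t ht)]
    exact cs.rep_simple_root_apply_eq_zero (h.apply_eq_zero _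
      ((cs.isLeftInversion_simple_mul ht.1 (hmul t ht)).1 ht))
  refine ⟨fun t ht j hj => hsupp t ht j ((hmem j).2 hj), fun t t' ht ht' hsupp' hn => ?_⟩
  have ht2 := (cs.isLeftInversion_simple_mul ht.1 (hmul t ht)).1 ht
  rw [hroot t ht.1 (hmul t ht)]
  -- For t' = s the pairing is, after rotation, minus the s-coordinate of the positive root of sts.
  by_cases hne : t' = cs.simple s
  · subst hne
    have h1 : cs.root (cs.simple s) = - cs.rep (cs.simple s) (M.sroot s) := by
      rw [root_simple, rep_simple_sroot, neg_neg]
    have h2 := cs.eform_rotate hγ (x := M.sroot s) (fun j hj => M.sroot_apply_of_ne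
      (by rintro rfl; simp at hj)) (h.apply_eq_zero _ ht2)
    rw [h1, M.eform_neg_right, h2, M.eform_sroot_right hγ]
    simpa using cs.root_nonneg ht2.1 s
  · rw [hroot t' ht' hne, cs.eform_rotate hγ ?_ (h.apply_eq_zero _ ht2)]
    · refine h.eform_nonpos _ _ ht2 (cs.isReflection_conj_simple ht' s) ?_ fun h' =>
        hn ((cs.isLeftInversion_simple_mul ht' hne).2 h')
      rw [cs.root_conj_simple ht' hne]
      exact cs.rep_simple_root_apply_eq_zero fun j hj => hsupp' j ((hmem j).1 hj)
    · rw [cs.root_conj_simple ht' hne]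
      exact cs.rep_simple_root_apply_eq_zero fun j hj => hsupp' j ((hmem j).1 hj)

/-- Separation tested on the noninversion s reads E(β_t, α_s) ≤ 0, and this value is the
s-coordinate of a positive root. -/
lemma EulerSeparated.root_apply_eq_zero {γ : List B} {s : B} (hγ : (s :: γ).Nodup) {w : W}
    (hs : ¬ cs.IsLeftDescent w s) (h : cs.EulerSeparated (s :: γ) w) {t : W}
    (ht : cs.IsLeftInversion w t) : cs.root t s = 0 := by
  have h1 := h.eform_nonpos t (cs.simple s) ht (cs.isReflection_simple s)
    (fun j hj => by
      rw [root_simple]; exact M.sroot_apply_of_ne (by rintro rfl; simp at hj))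
    (fun h' => hs ((cs.isLeftInversion_simple_iff_isLeftDescent _ _).1 h'))
  rw [root_simple, M.eform_sroot_right hγ] at h1
  exact le_antisymm h1 (cs.root_nonneg ht.1 s)

lemma EulerSeparated.skip {γ : List B} {s : B} (hγ : (s :: γ).Nodup) {w : W}
    (hs : ¬ cs.IsLeftDescent w s) (h : cs.EulerSeparated (s :: γ) w) : cs.EulerSeparated γ w := by
  refine ⟨fun t ht j hj => ?_, fun t t' ht ht' hsupp hn => ?_⟩
  · rcases eq_or_ne j s with rfl | hne
    · exact h.root_apply_eq_zero cs hγ hs ht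
    · exact h.apply_eq_zero t ht j (by simp [hj, hne])
  · have := h.eform_nonpos t t' ht ht' (fun j hj => hsupp j (by simp at hj; exact hj.2)) hn
    rwa [eform, h.root_apply_eq_zero cs hγ hs ht, zero_mul, zero_add] at this

/-- The recursion of the sorting word is followed, `A` again recording the letters that can still
occur. When s is taken, it heads the inversion sequence, and for a positive root x supported on the
word E(x, α_s) is the s-coordinate of x, while E(α_s, x) adds to it nonpositive terms. Separation is
what ensures that skipped letters play no further role. -/
theorem EulerSeparated.pairwise_leftInvSeq {γ : List B} (hγ : γ.Nodup) (hfull : ∀ i, i ∈ γ)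
    {w : W} (hw : cs.EulerSeparated γ w) {p : List ℕ} {ω : List B}
    (h : cs.IsSortingWord γ w p ω) :
    (cs.leftInvSeq ω).Pairwise fun t t' =>
      M.eform γ (cs.root t) (cs.root t') ≤ M.eform γ (cs.root t') (cs.root t) := by
  classical
  suffices H : ∀ A : B → Bool, cs.EulerSeparated (γ.filter A) w → ∀ p ω,
      cs.IsSortingWord γ w p ω → (cs.leftInvSeq ω).Pairwise fun t t' =>
        M.eform (γ.filter A) (cs.root t) (cs.root t') ≤
          M.eform (γ.filter A) (cs.root t') (cs.root t) by
    simpa using H (fun _ => true) (by simpa using hw) p ω h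
  refine cs.sorting_induction (P := fun γ w => ∀ A : B → Bool,
    cs.EulerSeparated (γ.filter A) w → ∀ p ω,
      cs.IsSortingWord γ w p ω → (cs.leftInvSeq ω).Pairwise fun t t' =>
        M.eform (γ.filter A) (cs.root t) (cs.root t') ≤
          M.eform (γ.filter A) (cs.root t') (cs.root t)) ?_ ?_ ?_ hγ hfull w
  · intro γ A _ p ω h
    obtain ⟨-, rfl⟩ := h.unique cs (cs.isSortingWord_one γ)
    simp
  · intro s γ w hnd hfull hs ih A hsep P Ω hP
    obtain ⟨p, ω, rfl, rfl, h⟩ := (cs.isSortingWord_cons_iff_of_isLeftDescent hnd hfull hs).1 hP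
    by_cases hA : A s
    · rw [List.filter_cons_of_pos hA] at hsep ⊢
      have hnd' : (s :: γ.filter A).Nodup := by
        have := hnd.filter A
        rwa [List.filter_cons_of_pos hA] at this
      have h1 : (γ ++ [s]).filter A = γ.filter A ++ [s] := by
        rw [List.filter_append, List.filter_cons_of_pos hA, List.filter_nil]
      have ih' := ih A (h1 ▸ hsep.take cs hnd' hs) p ω h
      rw [h1] at ih'
      have hsep' := hsep.take cs hnd' hs
      have hinv : ∀ t ∈ cs.leftInvSeq ω, cs.IsLeftInversion (cs.simple s * w) t := fun t ht =>
        (h.1.2.2.mem_leftInvSeq_iff cs).1 ht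
      have hmul : ∀ t ∈ cs.leftInvSeq ω, t ≠ cs.simple s := by
        rintro t ht rfl
        exact cs.not_isLeftDescent_simple_mul hs
          ((cs.isLeftInversion_simple_iff_isLeftDescent _ _).1 (hinv _ ht))
      have hsupp : ∀ t ∈ cs.leftInvSeq ω, ∀ j, j ∉ s :: γ.filter A →
          cs.rep (cs.simple s) (cs.root t) j = 0 := fun t ht =>
        cs.rep_simple_root_apply_eq_zero fun j hj => hsep'.apply_eq_zero t (hinv t ht) j
          (by simpa [or_comm, and_comm] using hj)
      have hinvol : ∀ x : B →₀ ℝ, cs.rep (cs.simple s) (cs.rep (cs.simple s) x) = x := fun x => by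
        rw [← rep_mul_apply]; simp
      rw [leftInvSeq_cons]
      refine List.pairwise_cons.2 ⟨fun t' ht' => ?_, ?_⟩
      · obtain ⟨t, ht, rfl⟩ := List.mem_map.1 ht'
        have hx := hsupp t ht
        rw [root_simple, cs.root_conj_simple (hinv t ht).1 (hmul t ht), M.eform_sroot_right hnd']
        have hpos := cs.rep_simple_root_nonneg (hinv t ht).1 (hmul t ht)
        set x := cs.rep (cs.simple s) (cs.root t)
        have h2 := M.eform_add_eform hnd' (x := M.sroot s) (y := x)
          (fun j hj => M.sroot_apply_of_ne (by rintro rfl; simp at hj)) hx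
        rw [M.eform_sroot_right hnd', M.bil_comm] at h2
        have h3 := M.list_sum_eq_of_nodup_cons hnd' hx
        have h4 : ((γ.filter A).map fun j => x j * M.gram s j).sum ≤ 0 := by
          refine (List.sum_le_card_nsmul _ 0 fun a ha => ?_).trans_eq (smul_zero _)
          obtain ⟨j, hj, rfl⟩ := List.mem_map.1 ha
          refine mul_nonpos_of_nonneg_of_nonpos (hpos j) (M.gram_nonpos ?_)
          rintro rfl
          exact (List.nodup_cons.1 hnd').1 hj
        linarith
      · rw [List.pairwise_map]
        refine ih'.imp_of_mem fun {t t'} ht ht' hle => ?_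
        rw [cs.root_conj_simple (hinv t ht).1 (hmul t ht),
          cs.root_conj_simple (hinv t' ht').1 (hmul t' ht'),
          ← cs.eform_rotate hnd' (hsupp t' ht') (hsupp t ht),
          ← cs.eform_rotate hnd' (hsupp t ht) (hsupp t' ht'), hinvol, hinvol]
        exact hle
    · exfalso
      have := hsep.apply_eq_zero (cs.simple s)
        ((cs.isLeftInversion_simple_iff_isLeftDescent _ _).2 hs) s (by simp [hA])
      rw [root_simple, M.sroot_apply_self] at this
      exact one_ne_zero this
  · intro s γ w hnd hfull hs ih A hsep P Ω hP
    obtain ⟨p, rfl, h⟩ := (cs.isSortingWord_cons_iff_of_not_isLeftDescent hnd hfull hs).1 hP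
    have hsγ := (List.nodup_cons.1 hnd).1
    have ihA := ih (fun i => A i ∧ i ≠ s)
    rw [filter_append_singleton_eq hsγ (A := A) (fun i => by simp)] at ihA
    by_cases hA : A s
    · rw [List.filter_cons_of_pos hA] at hsep ⊢
      have hnd' : (s :: γ.filter A).Nodup := by
        have := hnd.filter A
        rwa [List.filter_cons_of_pos hA] at this
      refine (ihA (hsep.skip cs hnd' hs) p Ω h).imp_of_mem fun {t t'} ht ht' hle => ?_
      have h0 : ∀ t ∈ cs.leftInvSeq Ω, cs.root t s = 0 := fun t ht =>
        hsep.root_apply_eq_zero cs hnd' hs ((h.1.2.2.mem_leftInvSeq_iff cs).1 ht)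
      rwa [eform, eform, h0 t ht, h0 t' ht', zero_mul, zero_add, zero_mul, zero_add]
    · rw [List.filter_cons_of_neg hA] at hsep ⊢
      exact ihA hsep p Ω h

/-- The long element has no noninversions, so separation is vacuous for it. -/
theorem IsLongElement.pairwise_leftInvSeq {γ : List B} (hγ : γ.Nodup) (hfull : ∀ i, i ∈ γ)
    {w : W} (hw : cs.IsLongElement w) {p : List ℕ} {ω : List B} (h : cs.IsSortingWord γ w p ω) :
    (cs.leftInvSeq ω).Pairwise fun t t' =>
      M.eform γ (cs.root t) (cs.root t') ≤ M.eform γ (cs.root t') (cs.root t) :=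
  EulerSeparated.pairwise_leftInvSeq cs hγ hfull
    ⟨fun _ _ j hj => absurd (hfull j) hj,
      fun _ t' _ ht' _ hn => absurd ((cs.isLongElement_iff).1 hw t' ht') hn⟩ h

end CoxeterSystem

/-! ### Order of pairs in lists, and sorting by commutations -/

section ListOrder

variable {α G : Type*} [Group G]

lemma List.pair_sublist_or_of_mem {L : List α} {a b : α} (ha : a ∈ L) (hb : b ∈ L) (hne : a ≠ b) :
    [a, b].Sublist L ∨ [b, a].Sublist L := by
  obtain ⟨l₁, l₂, rfl⟩ := List.append_of_mem ha
  rcases List.mem_append.1 hb with h | h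
  · right
    exact (List.singleton_sublist.2 h).append (List.singleton_sublist.2 (List.mem_cons_self))
  · left
    have h' := (List.mem_cons.1 h).resolve_left hne.symm
    exact ((List.singleton_sublist.2 h').cons_cons a).trans (List.sublist_append_right _ _)

lemma List.rel_of_pair_sublist {R : α → α → Prop} {L : List α} (h : L.Pairwise R) {a b : α}
    (hab : [a, b].Sublist L) : R a b := by
  simpa using h.sublist hab

lemma List.Nodup.idxOf_lt_of_pair_sublist [DecidableEq α] {L : List α} (h : L.Nodup) {a b : α}
    (hab : [a, b].Sublist L) : L.idxOf a < L.idxOf b := by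
  refine List.rel_of_pair_sublist (R := fun a b => L.idxOf a < L.idxOf b) ?_ hab
  rw [List.pairwise_iff_getElem]
  intro i j hi hj hij
  rwa [h.idxOf_getElem, h.idxOf_getElem]

/-- Two noncommuting letters are never exchanged, so a move leaves the subword of their occurrences
unchanged. -/
lemma CommutationEquiv.pair_sublist {L L' : List G} (h : CommutationEquiv L L') {a b : G}
    (hab : a * b ≠ b * a) (hL : [a, b].Sublist L) : [a, b].Sublist L' := by
  classical
  refine (h.iff_of_move (p := fun l => [a, b].Sublist l) ?_).1 hL
  rintro _ _ ⟨l₁, l₂, x, y, hxy⟩ hs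
  have h1 := hs.filter fun z => z = a ∨ z = b
  have h2 : [a, b].filter (fun z => z = a ∨ z = b) = [a, b] := by simp
  rw [h2] at h1
  have h3 : (l₁ ++ x :: y :: l₂).filter (fun z => z = a ∨ z = b) =
      (l₁ ++ y :: x :: l₂).filter (fun z => z = a ∨ z = b) := by
    by_cases hx : x = a ∨ x = b
    · by_cases hy : y = a ∨ y = b
      · have : x = y := by
          rcases hx with rfl | rfl <;> rcases hy with rfl | rfl
          · rfl
          · exact absurd hxy hab
          · exact absurd hxy.symm hab
          · rfl
        rw [this]
      · simp [List.filter_cons, hy]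
    · simp [List.filter_cons, hx]
  rw [h3] at h1
  exact h1.trans List.filter_sublist

lemma commutationEquiv_orderedInsert (f : G → ℕ) {x : G} {l : List G}
    (h : ∀ y ∈ l, f x < f y → x * y = y * x) :
    CommutationEquiv (x :: l) (l.orderedInsert (fun x y => f y ≤ f x) x) := by
  induction l with
  | nil => exact .refl _
  | cons y l ih =>
    rw [List.orderedInsert_cons]
    split_ifs with hxy
    · exact .refl _
    · exact CommutationEquiv.trans (.rel _ _ (.swap [] l x y (h y List.mem_cons_self (not_le.1 hxy))))
        ((ih fun z hz => h z (List.mem_cons_of_mem _ hz)).cons y)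

/-- Insertion sort exchanges only pairs that are out of order, and those commute by hypothesis. -/
lemma exists_commutationEquiv_pairwise (f : G → ℕ) {l : List G}
    (h : l.Pairwise fun x y => f x < f y → x * y = y * x) :
    ∃ l', CommutationEquiv l l' ∧ l'.Pairwise fun x y => f y ≤ f x := by
  have : Std.Total fun x y : G => f y ≤ f x := ⟨fun x y => le_total _ _⟩
  have : IsTrans G fun x y : G => f y ≤ f x := ⟨fun x y z h h' => h'.trans h⟩
  refine ⟨l.insertionSort fun x y => f y ≤ f x, ?_, List.pairwise_insertionSort _ _⟩
  induction l with
  | nil => exact .refl _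
  | cons x l ih =>
    obtain ⟨h1, h2⟩ := List.pairwise_cons.1 h
    rw [List.insertionSort_cons]
    refine CommutationEquiv.trans ((ih h2).cons x) (commutationEquiv_orderedInsert f fun y hy => ?_)
    exact h1 y ((List.perm_insertionSort _ _).mem_iff.1 hy)

end ListOrder

namespace CoxeterSystem

open CoxeterMatrix

variable {B W : Type*} [Group W] {M : CoxeterMatrix B} (cs : CoxeterSystem M W)

variable [Finite W]

/-! ### Decreasing factorizations are acute -/

lemma mem_leftInvSeq_of_isLongElement {w t : W} (hw : cs.IsLongElement w) {ω : List B}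
    (hω : cs.IsReducedWordFor ω w) (ht : cs.IsReflection t) : t ∈ cs.leftInvSeq ω :=
  (hω.mem_leftInvSeq_iff cs).2 ((cs.isLongElement_iff).1 hw t ht)

/-- Let t come before t' with B(β_t, β_t') < 0; they do not commute. If t precedes t' in the
inversion sequence, it does so in every commutation of it, so t ≼ t', against decrease. If t'
precedes t, then 0 = E(β_t', β_t) ≤ E(β_t, β_t') = B < 0. -/
theorem IsFactorization.acute_of_decreasing {γ : List B} (hγ : γ.Nodup) (hfull : ∀ i, i ∈ γ)
    {l : List W} (h : cs.IsFactorization γ l) (hl : l.Pairwise fun t t' => ¬ cs.SortingLE γ t t') :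
    cs.Acute l := by
  obtain ⟨w, hw⟩ := cs.exists_isLongElement
  obtain ⟨p, ω, hω⟩ := cs.exists_isSortingWord hγ hfull w
  have hpw := hw.pairwise_leftInvSeq cs hγ hfull hω
  refine (hl.and (h.pairwise_eform cs hγ)).imp_of_mem fun {t t'} ht ht' => ?_
  rintro ⟨h1, h2⟩
  have hsupp : ∀ x : B →₀ ℝ, ∀ j, j ∉ γ → x j = 0 := fun x j hj => absurd (hfull j) hj
  have hb := M.eform_add_eform hγ (hsupp (cs.root t)) (hsupp (cs.root t'))
  rw [M.bil_comm] at hb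
  by_contra hneg
  rw [not_le] at hneg
  have hne : t ≠ t' := by
    rintro rfl
    rw [cs.bil_root_self (h.refl _ ht)] at hneg
    linarith
  rcases List.pair_sublist_or_of_mem
    (cs.mem_leftInvSeq_of_isLongElement hw hω.1.2.2 (h.refl t ht))
    (cs.mem_leftInvSeq_of_isLongElement hw hω.1.2.2 (h.refl t' ht')) hne with hs | hs
  · refine h1 (.inr ⟨w, p, ω, hw, hω, fun L hL => hL.pair_sublist ?_ hs⟩)
    rw [Ne, cs.mul_comm_iff_bil_eq_zero (h.refl t ht) (h.refl t' ht') hne]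
    exact hneg.ne
  · have := List.rel_of_pair_sublist hpw hs
    linarith

/-- A pair in increasing order of the inversion sequence has B = E(β_t, β_t') ≤ E(β_t', β_t) = 0, so
acuteness makes it commute. The word can thus be sorted into decreasing order by commutations. -/
theorem IsFactorization.exists_decreasing_of_acute {γ : List B} (hγ : γ.Nodup)
    (hfull : ∀ i, i ∈ γ) {l : List W} (h : cs.IsFactorization γ l) (hl : cs.Acute l) :
    ∃ l', CommutationEquiv l l' ∧ l'.Pairwise fun t t' => ¬ cs.SortingLE γ t t' := by
  classical
  obtain ⟨w, hw⟩ := cs.exists_isLongElement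
  obtain ⟨p, ω, hω⟩ := cs.exists_isSortingWord hγ hfull w
  have hpw := hw.pairwise_leftInvSeq cs hγ hfull hω
  have hnd : (cs.leftInvSeq ω).Nodup := hω.1.2.2.1.nodup_leftInvSeq
  have hsupp : ∀ x : B →₀ ℝ, ∀ j, j ∉ γ → x j = 0 := fun x j hj => absurd (hfull j) hj
  obtain ⟨l', h1, h2⟩ := exists_commutationEquiv_pairwise
    (fun t => (cs.leftInvSeq ω).idxOf t) (l := l) <| by
      refine (List.Pairwise.and hl (h.pairwise_eform cs hγ)).imp_of_mem fun {t t'} ht ht' => ?_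
      rintro ⟨h1, h2⟩ hlt
      have hne : t ≠ t' := by rintro rfl; exact lt_irrefl _ hlt
      have hb := M.eform_add_eform hγ (hsupp (cs.root t)) (hsupp (cs.root t'))
      rw [M.bil_comm] at hb
      rcases List.pair_sublist_or_of_mem
        (cs.mem_leftInvSeq_of_isLongElement hw hω.1.2.2 (h.refl t ht))
        (cs.mem_leftInvSeq_of_isLongElement hw hω.1.2.2 (h.refl t' ht')) hne with hs | hs
      · have := List.rel_of_pair_sublist hpw hs
        rw [cs.mul_comm_iff_bil_eq_zero (h.refl t ht) (h.refl t' ht') hne]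
        refine le_antisymm ?_ h1
        linarith
      · exact absurd (hnd.idxOf_lt_of_pair_sublist hs) (not_lt_of_gt hlt)
  refine ⟨l', h1, (List.Pairwise.and h2 (h1.perm.nodup_iff.1 (h.nodup cs hγ))).imp ?_⟩
  rintro t t' ⟨h3, h4⟩ (h5 | ⟨w', p', ω', hw', hω', h5⟩)
  · exact h4 h5
  · obtain rfl := hw.unique cs hw'
    obtain ⟨-, rfl⟩ := hω.unique cs hω'
    exact absurd (hnd.idxOf_lt_of_pair_sublist (h5 _ (.refl _))) (not_lt_of_ge h3)

end CoxeterSystem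

namespace CoxeterSystem

open CoxeterMatrix

variable {B W : Type*} [Group W] {M : CoxeterMatrix B} (cs : CoxeterSystem M W)

/-! ### Chains and their reflection words -/

/-- The list `a, a t₁, a t₁ t₂, …` of partial products. -/
def partialProds : W → List W → List W
  | a, [] => [a]
  | a, t :: l => a :: partialProds (a * t) l

lemma head?_partialProds (a : W) (l : List W) : (partialProds a l).head? = some a := by
  cases l <;> rfl

lemma partialProds_eq_cons (a : W) (l : List W) :
    partialProds a l = a :: (partialProds a l).tail := by
  cases l <;> rfl

lemma getLast?_partialProds (a : W) (l : List W) :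
    (partialProds a l).getLast? = some (a * l.prod) := by
  induction l generalizing a with
  | nil => simp [partialProds]
  | cons t l ih =>
    rw [partialProds, partialProds_eq_cons, List.getLast?_cons_cons, ← partialProds_eq_cons, ih,
      List.prod_cons, mul_assoc]

lemma zipWith_partialProds (a : W) (l : List W) :
    List.zipWith (fun x y => x⁻¹ * y) (partialProds a l) (partialProds a l).tail = l := by
  induction l generalizing a with
  | nil => simp [partialProds]
  | cons t l ih =>
    rw [partialProds, List.tail_cons]
    conv_lhs => rw [partialProds_eq_cons (a * t) l]
    rw [List.zipWith_cons_cons, ← partialProds_eq_cons, ih]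
    simp

lemma map_mul_partialProds (u a : W) (l : List W) :
    (partialProds a l).map (fun x => u * x) = partialProds (u * a) l := by
  induction l generalizing a with
  | nil => rfl
  | cons t l ih => rw [partialProds, List.map_cons, ih, partialProds, mul_assoc]

lemma isChain_partialProds_cons {R : W → W → Prop} (a t : W) (l : List W) :
    (partialProds a (t :: l)).IsChain R ↔ R a (a * t) ∧ (partialProds (a * t) l).IsChain R := by
  rw [partialProds, partialProds_eq_cons (a * t) l, List.isChain_cons_cons]

lemma eq_partialProds_of_isChain {a : W} {e : List W} (h : (a :: e).IsChain cs.AbsoluteCover) :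
    ∃ l : List W, (∀ t ∈ l, cs.IsReflection t) ∧ a :: e = partialProds a l ∧
      cs.reflectionLength (a * l.prod) = cs.reflectionLength a + l.length := by
  induction e generalizing a with
  | nil => exact ⟨[], by simp, rfl, by simp⟩
  | cons b e ih =>
    rw [List.isChain_cons_cons] at h
    obtain ⟨⟨h1, t, ht, rfl⟩, h2⟩ := h
    obtain ⟨l, hl, he, hlen⟩ := ih h2
    refine ⟨t :: l, ?_, by rw [partialProds, he], ?_⟩
    · intro t' ht'
      rcases List.mem_cons.1 ht' with rfl | h'
      · exact ht
      · exact hl t' h'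
    · rw [List.prod_cons, ← mul_assoc, hlen, h1, List.length_cons]; ring

lemma reflectionLength_prod_le {l : List W} (hl : ∀ t ∈ l, cs.IsReflection t) :
    cs.reflectionLength l.prod ≤ l.length :=
  Nat.sInf_le ⟨l, rfl, hl, rfl⟩

lemma exists_reflectionLength_eq {l : List W} (hl : ∀ t ∈ l, cs.IsReflection t) :
    ∃ l' : List W, l'.length = cs.reflectionLength l.prod ∧ (∀ t ∈ l', cs.IsReflection t) ∧
      l'.prod = l.prod :=
  Nat.sInf_mem (s := {n | ∃ l' : List W, l'.length = n ∧ (∀ t ∈ l', cs.IsReflection t) ∧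
    l'.prod = l.prod}) ⟨_, l, rfl, hl, rfl⟩

lemma reflectionLength_one : cs.reflectionLength 1 = 0 := by
  simpa using cs.reflectionLength_prod_le (l := []) (by simp)

lemma ne_one_of_isReflection {t : W} (ht : cs.IsReflection t) : t ≠ 1 := by
  rintro rfl
  have := ht.odd_length
  simp at this

/-- Each step raises the length by at least one, and the total gain equals the number of steps, so
every step is a Bruhat cover. -/
lemma isChain_bruhatLE_partialProds_iff {u : W} {l : List W} (hr : ∀ t ∈ l, cs.IsReflection t)
    (hl : cs.length (u * l.prod) = cs.length u + l.length) :
    (partialProds u l).IsChain cs.BruhatLE ↔ cs.Ascends u l := by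
  have hmem : ∀ {t : W} {l : List W}, (∀ t' ∈ t :: l, cs.IsReflection t') →
      ∀ t' ∈ l, cs.IsReflection t' := fun h t' ht' => h t' (List.mem_cons_of_mem _ ht')
  constructor
  · clear hl
    intro h
    induction l generalizing u with
    | nil => trivial
    | cons t l ih =>
      rw [isChain_partialProds_cons] at h
      refine ⟨h.1.length_lt cs fun h' => ?_, ih (hmem hr) h.2⟩
      exact cs.ne_one_of_isReflection (hr t List.mem_cons_self) (by simpa using h'.symm)
  · intro h
    induction l generalizing u with
    | nil => exact List.isChain_singleton _
    | cons t l ih =>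
      have h1 := h.1
      have h2 := h.2.length_le
      rw [List.prod_cons, ← mul_assoc, List.length_cons] at hl
      rw [isChain_partialProds_cons]
      exact ⟨.single ⟨by lia, t, hr t List.mem_cons_self, rfl⟩, ih (hmem hr) (by lia) h.2⟩

lemma BruhatLE.exists_ascends {x y : W} (h : cs.BruhatLE x y) :
    ∃ l : List W, (∀ t ∈ l, cs.IsReflection t) ∧ cs.Ascends x l ∧ x * l.prod = y ∧
      cs.length y = cs.length x + l.length := by
  induction h using Relation.ReflTransGen.head_induction_on with
  | refl => exact ⟨[], by simp, trivial, by simp, by simp⟩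
  | head h _ ih =>
    obtain ⟨h1, t, ht, rfl⟩ := h
    obtain ⟨l, h2, h3, h4, h5⟩ := ih
    refine ⟨t :: l, ?_, ⟨by lia, h3⟩, by rw [List.prod_cons, ← mul_assoc, h4], ?_⟩
    · intro t' ht'
      rcases List.mem_cons.1 ht' with rfl | h'
      · exact ht
      · exact h2 t' h'
    · rw [h5, h1, List.length_cons]; ring

lemma BruhatLE.antisymm {x y : W} (h : cs.BruhatLE x y) (h' : cs.BruhatLE y x) : x = y := by
  by_contra hne
  have := h.length_lt cs hne
  have := h'.length_le cs
  lia

/-- Labels are prescribed only on covers of the source, so the inverse map must first be shown to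
send covers to covers; an element strictly between would be carried to one strictly between two
elements whose lengths differ by one. -/
lemma ReflectionIsomorphic.symm {u₁ v₁ u₂ v₂ : W} (h : cs.ReflectionIsomorphic u₁ v₁ u₂ v₂) :
    cs.ReflectionIsomorphic u₂ v₂ u₁ v₁ := by
  obtain ⟨φ, h1, h2⟩ := h
  have h1' : ∀ x y, cs.BruhatLE (φ.symm x : W) (φ.symm y) ↔ cs.BruhatLE (x : W) y := fun x y => by
    rw [← h1]; simp
  refine ⟨φ.symm, h1', fun x y hxy => ?_⟩
  have hlt := hxy.1
  have hne : (φ.symm x : W) ≠ φ.symm y := by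
    intro h
    have := φ.symm.injective (Subtype.ext h)
    rw [this] at hlt
    lia
  have hle := (h1' x y).2 (.single hxy)
  have key : cs.BruhatCover (φ.symm x : W) (φ.symm y) := by
    rcases Relation.ReflTransGen.cases_head hle with h | ⟨z, hz, hzy⟩
    · exact absurd h hne
    obtain ⟨z', rfl⟩ : ∃ z' : cs.bruhatInterval u₁ v₁, (z' : W) = z :=
      ⟨⟨z, BruhatLE.trans cs (φ.symm x).2.1 (.single hz),
        BruhatLE.trans cs hzy (φ.symm y).2.2⟩, rfl⟩
    have h3 : cs.BruhatLE (x : W) (φ z') := by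
      simpa using (h1 (φ.symm x) z').2 (.single hz)
    have h4 : cs.BruhatLE (φ z' : W) y := by simpa using (h1 z' (φ.symm y)).2 hzy
    have h5 : (x : W) ≠ φ z' := by
      intro h
      have h6 : φ.symm x = z' := by rw [Equiv.symm_apply_eq]; exact Subtype.ext h
      have := hz.1
      rw [h6] at this
      lia
    have h6 := h3.length_lt cs h5
    have h7 : (φ z' : W) = y := by
      by_contra hne'
      have := h4.length_lt cs hne'
      lia
    have h8 : φ.symm y = z' := by rw [Equiv.symm_apply_eq]; exact Subtype.ext h7.symm
    rwa [h8]
  have := h2 _ _ key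
  simpa using this.symm

/-- The isomorphism sends bottom to bottom and preserves the labels of covers, so it carries a
maximal chain to the chain with the same word. -/
lemma ReflectionIsomorphic.ascends {u₁ v₁ u₂ v₂ : W} (h : cs.ReflectionIsomorphic u₁ v₁ u₂ v₂)
    {l : List W} (hr : ∀ t ∈ l, cs.IsReflection t) (hv : u₁ * l.prod = v₁)
    (hlen : cs.length v₁ = cs.length u₁ + l.length) (hv₂ : cs.BruhatLE u₂ v₂)
    (hl : cs.Ascends u₁ l) : cs.Ascends u₂ l := by
  obtain ⟨φ, h1, h2⟩ := h
  have main : ∀ (k : List W) (x : cs.bruhatInterval u₁ v₁), (∀ t ∈ k, cs.IsReflection t) →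
      (x : W) * k.prod = v₁ → cs.length v₁ = cs.length (x : W) + k.length →
      cs.Ascends (x : W) k → cs.Ascends (φ x : W) k := by
    intro k
    induction k with
    | nil => intros; trivial
    | cons t k ih =>
      intro x hr hv hlen ha
      have ha1 := ha.1
      have ha2 := ha.2.length_le
      rw [List.prod_cons, ← mul_assoc] at hv
      rw [List.length_cons] at hlen
      rw [hv] at ha2
      have hr' : ∀ t' ∈ k, cs.IsReflection t' := fun t' ht' => hr t' (List.mem_cons_of_mem _ ht')
      have hcov : cs.BruhatCover (x : W) (x * t) := ⟨by lia, t, hr t List.mem_cons_self, rfl⟩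
      let y : cs.bruhatInterval u₁ v₁ := ⟨x * t, BruhatLE.trans cs x.2.1 (.single hcov), by
        have := ha.2.bruhatLE cs hr' (by rw [hv]; lia)
        rwa [hv] at this⟩
      have hy := h2 x y hcov
      have hyt : (φ y : W) = φ x * t := by
        have : (x : W)⁻¹ * y = t := by simp [y]
        rw [this] at hy
        rw [hy]; simp
      have hle := (h1 x y).2 (.single hcov)
      have := ih y hr' hv (by simp only [y]; lia) ha.2
      rw [hyt] at this hle
      exact ⟨hle.length_lt cs fun h =>
        cs.ne_one_of_isReflection (hr t List.mem_cons_self) (by simpa using h.symm), this⟩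
  have hv₁ : cs.BruhatLE u₁ v₁ := by
    have := hl.bruhatLE cs hr (by rw [hv, hlen])
    rwa [hv] at this
  let x₁ : cs.bruhatInterval u₁ v₁ := ⟨u₁, .refl, hv₁⟩
  let x₂ : cs.bruhatInterval u₂ v₂ := ⟨u₂, .refl, hv₂⟩
  have hx : (φ x₁ : W) = u₂ := by
    refine BruhatLE.antisymm cs ?_ (φ x₁).2.1
    have := (h1 x₁ (φ.symm x₂)).2 (φ.symm x₂).2.1
    simpa [x₂] using this
  have := main l x₁ hr hv hlen hl
  rwa [hx] at this

/-- Transport of chains of a Bruhat interval by left multiplication, when every word ascending from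
`u₁` ascends from `u₂`. -/
lemma BruhatLE.transport {u₁ u₂ c : W} {n : ℕ} (h₁ : cs.length (u₁ * c) = cs.length u₁ + n)
    (h₂ : cs.length (u₂ * c) = cs.length u₂ + n)
    (H : ∀ l : List W, (∀ t ∈ l, cs.IsReflection t) → l.prod = c → l.length = n →
      cs.Ascends u₁ l → cs.Ascends u₂ l)
    {x y : W} (hx : cs.BruhatLE u₁ x) (hxy : cs.BruhatLE x y) (hy : cs.BruhatLE y (u₁ * c)) :
    cs.BruhatLE u₂ (u₂ * u₁⁻¹ * x) ∧ cs.BruhatLE (u₂ * u₁⁻¹ * x) (u₂ * u₁⁻¹ * y) ∧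
      cs.BruhatLE (u₂ * u₁⁻¹ * y) (u₂ * c) := by
  obtain ⟨l₁, hr₁, ha₁, rfl, hl₁⟩ := hx.exists_ascends cs
  obtain ⟨l₂, hr₂, ha₂, rfl, hl₂⟩ := hxy.exists_ascends cs
  obtain ⟨l₃, hr₃, ha₃, hp, hl₃⟩ := hy.exists_ascends cs
  have hprod : l₁.prod * l₂.prod * l₃.prod = c := by
    apply mul_left_cancel (a := u₁)
    rw [← hp]; simp only [mul_assoc]
  have h := H (l₁ ++ l₂ ++ l₃) (by
    intro t ht
    rcases List.mem_append.1 ht with ht | ht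
    · rcases List.mem_append.1 ht with ht | ht
      · exact hr₁ t ht
      · exact hr₂ t ht
    · exact hr₃ t ht) (by rw [List.prod_append, List.prod_append, hprod])
    (by rw [List.length_append, List.length_append]; lia)
    (by
      rw [ascends_append, ascends_append, List.prod_append, ← mul_assoc]
      exact ⟨⟨ha₁, ha₂⟩, ha₃⟩)
  rw [ascends_append, ascends_append, List.prod_append, ← mul_assoc] at h
  obtain ⟨⟨h1, h2⟩, h3⟩ := h
  have e1 := h1.length_le
  have e2 := h2.length_le
  have e3 := h3.length_le
  have hc : u₂ * l₁.prod * l₂.prod * l₃.prod = u₂ * c := by rw [← hprod]; simp only [mul_assoc]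
  rw [hc] at e3
  have hx' : u₂ * u₁⁻¹ * (u₁ * l₁.prod) = u₂ * l₁.prod := by simp [mul_assoc]
  have hy' : u₂ * u₁⁻¹ * (u₁ * l₁.prod * l₂.prod) = u₂ * l₁.prod * l₂.prod := by simp [mul_assoc]
  rw [hx', hy', ← hc]
  rw [← hc] at e3 h₂
  exact ⟨h1.bruhatLE cs hr₁ (by lia), h2.bruhatLE cs hr₂ (by lia), h3.bruhatLE cs hr₃ (by lia)⟩

/-- Every comparable pair of the interval lies on a maximal chain, whose word ascends from both
bottoms; left multiplication by u₂u₁⁻¹ therefore preserves the order both ways and all labels. -/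
lemma reflectionIsomorphic_of_ascends_iff {u₁ u₂ c : W} {n : ℕ}
    (h₁ : cs.length (u₁ * c) = cs.length u₁ + n) (h₂ : cs.length (u₂ * c) = cs.length u₂ + n)
    (H : ∀ l : List W, (∀ t ∈ l, cs.IsReflection t) → l.prod = c → l.length = n →
      (cs.Ascends u₁ l ↔ cs.Ascends u₂ l)) :
    cs.ReflectionIsomorphic u₁ (u₁ * c) u₂ (u₂ * c) := by
  have t₁ := fun {x y : W} => BruhatLE.transport cs (x := x) (y := y) h₁ h₂
    fun l h h' h'' => (H l h h' h'').1
  have t₂ := fun {x y : W} => BruhatLE.transport cs (x := x) (y := y) h₂ h₁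
    fun l h h' h'' => (H l h h' h'').2
  let φ : cs.bruhatInterval u₁ (u₁ * c) ≃ cs.bruhatInterval u₂ (u₂ * c) :=
    { toFun := fun x => ⟨u₂ * u₁⁻¹ * x, (t₁ x.2.1 .refl x.2.2).1, (t₁ x.2.1 .refl x.2.2).2.2⟩
      invFun := fun x => ⟨u₁ * u₂⁻¹ * x, (t₂ x.2.1 .refl x.2.2).1, (t₂ x.2.1 .refl x.2.2).2.2⟩
      left_inv := fun x => Subtype.ext (by simp [mul_assoc])
      right_inv := fun x => Subtype.ext (by simp [mul_assoc]) }
  refine ⟨φ, fun x y => ⟨fun h => ?_, fun h => (t₁ x.2.1 h y.2.2).2.1⟩, fun x y _ => ?_⟩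
  · simpa [φ, mul_assoc] using (t₂ (φ x).2.1 h (φ y).2.2).2.1
  · simp [φ, mul_assoc]

end CoxeterSystem

namespace CoxeterSystem

open CoxeterMatrix

variable {B W : Type*} [Group W] {M : CoxeterMatrix B} (cs : CoxeterSystem M W)

/-! ### Factorizations and noncrossing chains of a Coxeter element -/

lemma NoncrossingChain.elems_eq {c : W} (π : cs.NoncrossingChain c) :
    π.elems = partialProds 1 π.reflectionWord ∧ (∀ t ∈ π.reflectionWord, cs.IsReflection t) ∧
      π.reflectionWord.prod = c ∧ π.reflectionWord.length = cs.reflectionLength c := by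
  obtain ⟨e, he, hl, hc⟩ := π
  cases e with
  | nil => simp at he
  | cons a e =>
    obtain rfl : a = 1 := by simpa using he
    obtain ⟨l, h1, h2, h3⟩ := cs.eq_partialProds_of_isChain hc
    have h4 : NoncrossingChain.reflectionWord ⟨1 :: e, he, hl, hc⟩ = l := by
      change List.zipWith _ (1 :: e) (1 :: e).tail = l
      rw [h2, zipWith_partialProds]
    have h5 : l.prod = c := by
      rw [h2, getLast?_partialProds] at hl
      simpa using hl
    rw [h4]
    refine ⟨h2, h1, h5, ?_⟩
    rw [one_mul, reflectionLength_one, zero_add, h5] at h3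
    exact h3.symm

lemma sameClass_congr {γ δ : List B} (hprod : cs.wordProd γ = cs.wordProd δ)
    (hlen : γ.length = δ.length) {u₁ u₂ : W} : cs.SameClass γ u₁ u₂ ↔ cs.SameClass δ u₁ u₂ := by
  have key : ∀ {γ δ : List B}, cs.wordProd γ = cs.wordProd δ → γ.length = δ.length →
      cs.SameClass γ u₁ u₂ → cs.SameClass δ u₁ u₂ := by
    rintro γ δ hp hlen ⟨l, h, h'⟩
    have hf : cs.IsFactorization δ l := ⟨h.refl, h.prod_eq.trans hp, h.length_eq.trans hlen⟩
    exact ⟨l, ⟨hf, h.acute, h.ascends⟩, ⟨hf, h'.acute, h'.ascends⟩⟩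
  exact ⟨key hprod hlen, key hprod.symm hlen.symm⟩

variable [Finite W]

/-- The simple reflections of a reduced word form a factorization of minimal reflection length, so
they are distinct, and counting shows that none is missing. -/
lemma IsStandardCoxeterElement.nodup_and_mem {c : W} (hc : cs.IsStandardCoxeterElement c)
    {γ : List B} (hγ : cs.IsReducedWordFor γ c) : γ.Nodup ∧ ∀ i, i ∈ γ := by
  classical
  obtain ⟨ω, hω, hfull, h⟩ := hc
  have hl : ∀ t ∈ γ.map cs.simple, cs.IsReflection t := by
    intro t ht
    obtain ⟨i, -, rfl⟩ := List.mem_map.1 ht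
    exact cs.isReflection_simple i
  have hprod : (γ.map cs.simple).prod = cs.wordProd ω := by rw [h, ← hγ.2]; rfl
  have h1 := cs.length_le_of_prod_eq hω hl hprod
  have h2 : γ.length = cs.length c := by rw [← hγ.1.eq, hγ.2]
  have h3 := cs.length_wordProd_le ω
  rw [h] at h3
  rw [List.length_map] at h1
  have hfac : cs.IsFactorization ω (γ.map cs.simple) := ⟨hl, hprod, by rw [List.length_map]; lia⟩
  have hnd : γ.Nodup := List.Nodup.of_map _ (hfac.nodup cs hω)
  refine ⟨hnd, fun i => ?_⟩
  have hsub : γ.toFinset ⊆ ω.toFinset := fun j _ => List.mem_toFinset.2 (hfull j)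
  have heq := Finset.eq_of_subset_of_card_le hsub (by
    rw [List.toFinset_card_of_nodup hω, List.toFinset_card_of_nodup hnd]; lia)
  rw [← List.mem_toFinset, heq, List.mem_toFinset]
  exact hfull i

/-- A shorter expression of a prefix would shorten the whole factorization below the minimal length.
Hence minimal factorizations are the same as maximal chains. -/
lemma IsFactorization.reflectionLength_prod_eq {γ : List B} (hγ : γ.Nodup) {l₁ l₂ : List W}
    (h : cs.IsFactorization γ (l₁ ++ l₂)) : cs.reflectionLength l₁.prod = l₁.length := by
  have hr : ∀ t ∈ l₁, cs.IsReflection t := fun t ht => h.refl t (List.mem_append_left _ ht)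
  refine le_antisymm (cs.reflectionLength_prod_le hr) ?_
  obtain ⟨l, h1, h2, h3⟩ := cs.exists_reflectionLength_eq hr
  have h4 := cs.length_le_of_prod_eq hγ (l := l ++ l₂) (fun t ht => by
    rcases List.mem_append.1 ht with ht | ht
    · exact h2 t ht
    · exact h.refl t (List.mem_append_right _ ht))
    (by rw [← h.prod_eq, List.prod_append, List.prod_append, h3])
  have h5 := h.length_eq
  rw [List.length_append] at h4 h5
  lia

lemma IsFactorization.isChain_absoluteCover {γ : List B} (hγ : γ.Nodup) {l₁ l₂ : List W}
    (h : cs.IsFactorization γ (l₁ ++ l₂)) :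
    (partialProds l₁.prod l₂).IsChain cs.AbsoluteCover := by
  induction l₂ generalizing l₁ with
  | nil => exact List.isChain_singleton _
  | cons t l₂ ih =>
    have h' : cs.IsFactorization γ ((l₁ ++ [t]) ++ l₂) := by simpa using h
    have h1 := h.reflectionLength_prod_eq cs hγ
    have h2 := h'.reflectionLength_prod_eq cs hγ
    have h3 := ih h'
    have h4 : (l₁ ++ [t]).prod = l₁.prod * t := by simp
    rw [h4] at h2 h3
    rw [isChain_partialProds_cons]
    exact ⟨⟨by simp [h1, h2], t, h.refl t (by simp), rfl⟩, h3⟩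

lemma IsFactorization.exists_chain {γ : List B} (hγ : γ.Nodup) {l : List W}
    (h : cs.IsFactorization γ l) {c : W} (hc : cs.wordProd γ = c) :
    ∃ π : cs.NoncrossingChain c, π.reflectionWord = l :=
  ⟨⟨partialProds 1 l, head?_partialProds _ _, by
    rw [getLast?_partialProds, one_mul, h.prod_eq, hc],
    IsFactorization.isChain_absoluteCover cs hγ (l₁ := []) h⟩, zipWith_partialProds _ _⟩

lemma NoncrossingChain.isFactorization {γ : List B} (hγ : γ.Nodup) {c : W}
    (hc : cs.wordProd γ = c) (π : cs.NoncrossingChain c) :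
    cs.IsFactorization γ π.reflectionWord := by
  obtain ⟨-, h1, h2, h3⟩ := NoncrossingChain.elems_eq cs π
  refine ⟨h1, h2.trans hc.symm, h3.trans ?_⟩
  have h4 : cs.IsFactorization γ (γ.map cs.simple ++ []) := by
    rw [List.append_nil]
    refine ⟨fun t ht => ?_, rfl, List.length_map _⟩
    obtain ⟨i, -, rfl⟩ := List.mem_map.1 ht
    exact cs.isReflection_simple i
  have h5 := h4.reflectionLength_prod_eq cs hγ
  rw [List.length_map] at h5
  rw [← hc]
  exact h5

lemma concordant_iff {γ : List B} (hγ : γ.Nodup) {c u : W} (hc : cs.wordProd γ = c)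
    (hu : cs.length (u * c) = cs.length u + γ.length) (π : cs.NoncrossingChain c) :
    cs.Concordant u π ↔ cs.Ascends u π.reflectionWord := by
  have h := NoncrossingChain.isFactorization cs hγ hc π
  rw [Concordant, (NoncrossingChain.elems_eq cs π).1, map_mul_partialProds, mul_one]
  exact cs.isChain_bruhatLE_partialProds_iff h.refl (by rw [h.prod_eq, hc, hu, h.length_eq])

lemma mk_mem_concordantClasses_iff {γ : List B} (hγ : γ.Nodup) {c u : W} (hc : cs.wordProd γ = c)
    (hu : cs.length (u * c) = cs.length u + γ.length) (π : cs.NoncrossingChain c) :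
    Quotient.mk (cs.chainSetoid c) π ∈ cs.concordantClasses c u ↔
      cs.Ascends u π.reflectionWord := by
  constructor
  · rintro ⟨π', h1, h2⟩
    rw [cs.concordant_iff hγ hc hu] at h1
    exact h1.commutationEquiv cs (NoncrossingChain.isFactorization cs hγ hc π').refl
      (Quotient.exact h2)
  · exact fun h => ⟨π, (cs.concordant_iff hγ hc hu π).2 h, rfl⟩

lemma isDecreasingClass_mk_iff {γ : List B} (hγ : γ.Nodup) (hfull : ∀ i, i ∈ γ) {c : W}
    (hc : cs.wordProd γ = c) (π : cs.NoncrossingChain c) :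
    cs.IsDecreasingClass γ (Quotient.mk (cs.chainSetoid c) π) ↔ cs.Acute π.reflectionWord := by
  have hf := NoncrossingChain.isFactorization cs hγ hc
  constructor
  · rintro ⟨π', h1, h2⟩
    exact ((hf π').acute_of_decreasing cs hγ hfull h1).perm cs
      (CommutationEquiv.perm (Quotient.exact h2))
  · intro h
    obtain ⟨l, h1, h2⟩ := (hf π).exists_decreasing_of_acute cs hγ hfull h
    obtain ⟨π', rfl⟩ := ((hf π).commutationEquiv cs h1).exists_chain cs hγ hc
    exact ⟨π', h2, Quotient.sound (CommutationEquiv.symm h1)⟩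

lemma isDecreasingClassOf_mk_iff {γ : List B} (hγ : γ.Nodup) (hfull : ∀ i, i ∈ γ) {c u : W}
    (hc : cs.wordProd γ = c) (hu : cs.length (u * c) = cs.length u + γ.length)
    (π : cs.NoncrossingChain c) :
    cs.IsDecreasingClassOf γ u (Quotient.mk (cs.chainSetoid c) π) ↔
      cs.IsAcuteFactorization γ u π.reflectionWord := by
  have key : ∀ π : cs.NoncrossingChain c,
      (Quotient.mk (cs.chainSetoid c) π ∈ cs.concordantClasses c u ∧
        cs.IsDecreasingClass γ (Quotient.mk (cs.chainSetoid c) π)) ↔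
      cs.IsAcuteFactorization γ u π.reflectionWord := by
    intro π
    rw [cs.mk_mem_concordantClasses_iff hγ hc hu, cs.isDecreasingClass_mk_iff hγ hfull hc]
    exact ⟨fun h => ⟨NoncrossingChain.isFactorization cs hγ hc π, h.2, h.1⟩,
      fun h => ⟨h.ascends, h.acute⟩⟩
  constructor
  · exact fun h => (key π).1 h.1
  · intro h
    refine ⟨(key π).2 h, fun C hC hC' => ?_⟩
    induction C using Quotient.inductionOn with
    | _ π' => exact Quotient.sound (((key π').1 ⟨hC, hC'⟩).unique cs hγ h)

lemma exists_isDecreasingClassOf_iff_sameClass {γ : List B} (hγ : γ.Nodup) (hfull : ∀ i, i ∈ γ)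
    {c u₁ u₂ : W} (hc : cs.wordProd γ = c) (h₁ : cs.length (u₁ * c) = cs.length u₁ + γ.length)
    (h₂ : cs.length (u₂ * c) = cs.length u₂ + γ.length) :
    (∃ C : cs.CommutationClass c, cs.IsDecreasingClassOf γ u₁ C ∧ cs.IsDecreasingClassOf γ u₂ C) ↔
      cs.SameClass γ u₁ u₂ := by
  constructor
  · rintro ⟨C, hC₁, hC₂⟩
    induction C using Quotient.inductionOn with
    | _ π => exact ⟨_, (cs.isDecreasingClassOf_mk_iff hγ hfull hc h₁ π).1 hC₁,
        (cs.isDecreasingClassOf_mk_iff hγ hfull hc h₂ π).1 hC₂⟩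
  · rintro ⟨l, hl₁, hl₂⟩
    obtain ⟨π, rfl⟩ := hl₁.toIsFactorization.exists_chain cs hγ hc
    exact ⟨_, (cs.isDecreasingClassOf_mk_iff hγ hfull hc h₁ π).2 hl₁,
        (cs.isDecreasingClassOf_mk_iff hγ hfull hc h₂ π).2 hl₂⟩

lemma concordantClasses_eq_iff {γ : List B} (hγ : γ.Nodup) {c u₁ u₂ : W}
    (hc : cs.wordProd γ = c) (h₁ : cs.length (u₁ * c) = cs.length u₁ + γ.length)
    (h₂ : cs.length (u₂ * c) = cs.length u₂ + γ.length) :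
    cs.concordantClasses c u₁ = cs.concordantClasses c u₂ ↔
      ∀ l, cs.IsFactorization γ l → (cs.Ascends u₁ l ↔ cs.Ascends u₂ l) := by
  constructor
  · intro h l hl
    obtain ⟨π, rfl⟩ := hl.exists_chain cs hγ hc
    rw [← cs.mk_mem_concordantClasses_iff hγ hc h₁, h, cs.mk_mem_concordantClasses_iff hγ hc h₂]
  · intro h
    ext C
    induction C using Quotient.inductionOn with
    | _ π =>
      exact ((cs.mk_mem_concordantClasses_iff hγ hc h₁ π).trans
        (h _ (NoncrossingChain.isFactorization cs hγ hc π))).trans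
        (cs.mk_mem_concordantClasses_iff hγ hc h₂ π).symm

lemma sameClass_iff_ascends_iff {γ : List B} (hγ : γ.Nodup) {u₁ u₂ : W}
    (h₁ : cs.length (u₁ * cs.wordProd γ) = cs.length u₁ + γ.length) :
    cs.SameClass γ u₁ u₂ ↔
      ∀ l, cs.IsFactorization γ l → (cs.Ascends u₁ l ↔ cs.Ascends u₂ l) := by
  refine ⟨fun h l hl => h.ascends_iff cs hγ hl, fun h => ?_⟩
  obtain ⟨l, hl⟩ := cs.exists_isAcuteFactorization hγ h₁
  exact ⟨l, hl, hl.toIsFactorization, hl.acute, (h l hl.toIsFactorization).1 hl.ascends⟩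

lemma reflectionIsomorphic_iff {γ : List B} (hγ : γ.Nodup) {c u₁ u₂ : W}
    (hc : cs.wordProd γ = c) (h₁ : cs.length (u₁ * c) = cs.length u₁ + γ.length)
    (h₂ : cs.length (u₂ * c) = cs.length u₂ + γ.length) :
    cs.ReflectionIsomorphic u₁ (u₁ * c) u₂ (u₂ * c) ↔
      ∀ l, cs.IsFactorization γ l → (cs.Ascends u₁ l ↔ cs.Ascends u₂ l) := by
  have hle : ∀ {u : W}, cs.length (u * c) = cs.length u + γ.length → cs.BruhatLE u (u * c) := by
    intro u hu
    obtain ⟨l, hl⟩ := cs.exists_isAcuteFactorization hγ (u := u) (by rwa [hc])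
    have := hl.ascends.bruhatLE cs hl.refl (by rw [hl.prod_eq, hc, hu, hl.length_eq])
    rwa [hl.prod_eq, hc] at this
  constructor
  · intro h l hl
    have hp : l.prod = c := hl.prod_eq.trans hc
    exact ⟨h.ascends cs hl.refl (by rw [hp]) (by rw [h₁, hl.length_eq]) (hle h₂),
      (h.symm cs).ascends cs hl.refl (by rw [hp]) (by rw [h₂, hl.length_eq]) (hle h₁)⟩
  · exact fun h => cs.reflectionIsomorphic_of_ascends_iff h₁ h₂ fun l hr hp hlen =>
      h l ⟨hr, hp.trans hc.symm, hlen⟩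

/-- A common projection v lies between the sortable element m_i of each class and u_i⁻¹, so
convexity puts v⁻¹ into both classes. Conversely, a class has only one sortable element, and it is
the projection of each member. -/
lemma sameCambrianClass_iff {γ : List B} (hγ : γ.Nodup) (hfull : ∀ i, i ∈ γ) {u₁ u₂ : W}
    (h₁ : cs.length (u₁ * cs.wordProd γ) = cs.length u₁ + γ.length)
    (h₂ : cs.length (u₂ * cs.wordProd γ) = cs.length u₂ + γ.length) :
    cs.SameCambrianClass γ.reverse u₁⁻¹ u₂⁻¹ ↔ cs.SameClass γ u₁ u₂ := by
  have hs := cs.isSortable_iff_recSortable (List.nodup_reverse.2 hγ)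
    (fun i => List.mem_reverse.2 (hfull i))
  obtain ⟨m₁, hm₁, hle₁, hc₁⟩ := cs.exists_recSortable hγ h₁
  obtain ⟨m₂, hm₂, hle₂, hc₂⟩ := cs.exists_recSortable hγ h₂
  constructor
  · rintro ⟨v, ⟨⟨-, hv₁⟩, hmax₁⟩, ⟨-, hv₂⟩, hmax₂⟩
    have e₁ := SameClass.convex cs (hmax₁ m₁ ((hs m₁).2 hm₁) hle₁) hv₁ hc₁
    have e₂ := SameClass.convex cs (hmax₂ m₂ ((hs m₂).2 hm₂) hle₂) hv₂ hc₂
    exact (hc₁.trans cs hγ (e₁.symm cs)).trans cs hγ (e₂.trans cs hγ (hc₂.symm cs))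
  · intro h
    obtain rfl : m₁ = m₂ := hm₁.eq_of_sameClass cs hγ hm₂
      (((hc₁.symm cs).trans cs hγ h).trans cs hγ hc₂)
    exact ⟨m₁, ⟨⟨(hs m₁).2 hm₁, hle₁⟩, fun v hv hvu =>
      hm₁.le_of_le cs hγ hle₁ hc₁ ((hs v).1 hv) hvu⟩, ⟨(hs m₁).2 hm₁, hle₂⟩, fun v hv hvu =>
      hm₁.le_of_le cs hγ hle₂ hc₂ ((hs v).1 hv) hvu⟩

end CoxeterSystem

/-! ### Comparison of the four conditions -/

theorem theorem1p5 {B W : Type*} [Group W] [Finite W] {M : CoxeterMatrix B}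
    (cs : CoxeterSystem M W) (c : W) (hc : cs.IsStandardCoxeterElement c)
    (γ : List B) (hγ : cs.IsReducedWordFor γ c)
    (γ' : List B) (hγ' : cs.IsReducedWordFor γ' c⁻¹)
    (u₁ u₂ : W) (hu₁ : u₁ ∈ cs.positiveElements c) (hu₂ : u₂ ∈ cs.positiveElements c) :
    List.TFAE [
      ∃ C : cs.CommutationClass c,
        cs.IsDecreasingClassOf γ u₁ C ∧ cs.IsDecreasingClassOf γ u₂ C,
      cs.concordantClasses c u₁ = cs.concordantClasses c u₂,
      cs.ReflectionIsomorphic u₁ (u₁ * c) u₂ (u₂ * c),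
      cs.SameCambrianClass γ' u₁⁻¹ u₂⁻¹] := by
  have hδ : cs.IsReducedWordFor γ'.reverse c :=
    ⟨(cs.isReduced_reverse_iff γ').2 hγ'.1, by rw [cs.wordProd_reverse, hγ'.2, inv_inv]⟩
  obtain ⟨hnd, hfull⟩ := hc.nodup_and_mem cs hγ
  obtain ⟨hnd', hfull'⟩ := hc.nodup_and_mem cs hδ
  have hlen : cs.length c = γ.length := by rw [← hγ.2]; exact hγ.1
  have hlen' : cs.length c = γ'.reverse.length := by rw [← hδ.2]; exact hδ.1
  have h₁ : cs.length (u₁ * c) = cs.length u₁ + cs.length c := hu₁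
  have h₂ : cs.length (u₂ * c) = cs.length u₂ + cs.length c := hu₂
  have e₁ := cs.exists_isDecreasingClassOf_iff_sameClass hnd hfull hγ.2 (hlen ▸ h₁) (hlen ▸ h₂)
  have e₂ := cs.concordantClasses_eq_iff hnd hγ.2 (hlen ▸ h₁) (hlen ▸ h₂)
  have e₃ := cs.reflectionIsomorphic_iff hnd hγ.2 (hlen ▸ h₁) (hlen ▸ h₂)
  -- Sortability refers to the word `γ'` for c⁻¹, so the class relation appears for its reversal,
  -- possibly a different word for c from `γ`. It depends only on the product and the length of the
  -- word.
  have e₄ := cs.sameCambrianClass_iff hnd' hfull' (u₁ := u₁) (u₂ := u₂)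
    (by rw [hδ.2, ← hlen', h₁]) (by rw [hδ.2, ← hlen', h₂])
  rw [List.reverse_reverse, ← cs.sameClass_congr (hγ.2.trans hδ.2.symm) (hlen.symm.trans hlen')]
    at e₄
  have e₅ := cs.sameClass_iff_ascends_iff hnd (u₁ := u₁) (u₂ := u₂) (by rw [hγ.2, ← hlen, h₁])
  tfae_have 1 ↔ 2 := by rw [e₁, e₂, e₅]
  tfae_have 1 ↔ 3 := by rw [e₁, e₃, e₅]
  tfae_have 1 ↔ 4 := by rw [e₁, e₄]
  tfae_finish
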